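/- In the min sum vertex cover problem (MSVC) one is given a finite simple graph $G=(V,E)$, $n=|V|$. A schedule is a bijection from $V$ to the time slots $\{1,\dots,n\}$; the cover time of an edge is the earliest slot holding one of its endpoints, and the cost of the schedule is the sum of the cover times of all edges. Let $\mathrm{OPT}(G)$ be the minimum cost. The natural LP relaxation is $$\min \sum_{e\in E}\sum_{t\ge 1} u_{e,t}\quad\text{s.t.}\quad u_{e,t},x_{v,t}\ge 0,\qquad \sum_{v} x_{v,t}\le 1\ \ (t\ge 1),\qquad u_{e,t}+\sum_{v\in e}\sum_{1\le t'<t}x_{v,t'}\ge 1\ \ (e\in E,\ t\ge 1),$$ with time slots $t=1,2,3,\dots$ and value $\mathrm{LP}(G)$ (the infimum of the objective). Kernel rounding of a feasible solution $(x,u)$ is the following random procedure. Let $K(t,t')=\frac{4t'(t'+1)}{t(t+1)(t+2)}$ for $t\ge t'$ and $K(t,t')=0$ for $t<t'$, and put $z_{v,t}=\sum_{t'\ge 1}K(t,t')\,x_{v,t'}$. Draw $\alpha_v$, $v\in V$, independently and uniformly from $[0,1]$, let $\tau_v$ be the earliest $t\ge 1$ with $\sum_{1\le t'\le t}z_{v,t'}\ge\alpha_v$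 ($\tau_v=\infty$ if there is none), and schedule the vertices in the order of $\tau_v$, breaking ties by an independent uniformly random order of $V$. **Theorem.** 1. For every finite simple graph $G$ the LP has an optimum solution, and $\mathrm{LP}(G)\le\mathrm{OPT}(G)\le\frac{16}{9}\,\mathrm{LP}(G)$. Kernel rounding of any feasible solution $(x,u)$ always produces a schedule, and the expected cost (which is well defined) is at most $\frac{16}{9}\sum_{e\in E,\,t\ge 1}u_{e,t}$. In particular, kernel rounding of an optimum LP solution has expected cost at most $\frac{16}{9}\,\mathrm{OPT}(G)$. 2. There is a randomized polynomial time $\frac{16}{9}$-approximation algorithm for MSVC: there are one program for a random access machine with logarithmic cost and two polynomials $b,T$ such that on every graph $G$ with $n$ vertices (given by its adjacency matrix) and every outcome of $b(n)$ fair coin flips, the program halts within $T(n)$ steps with a schedule of $G$, and the expected cost of this schedule is at most $\frac{16}{9}\,\mathrm{OPT}(G)$. 3. The factor is tight for the LP. For $\varepsilon>0$ and integers $k,N$ let $G_{\varepsilon,k,N}$ be the disjoint union of complete graphs with $\lfloor N i^{-(2/3+\varepsilon)}\rfloor$ vertices, $i=1,\dots,k$. For every $\delta>0$ there is $\varepsilon_0>0$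 such that for every $\varepsilon\in(0,\varepsilon_0)$ there is $k_0$ such that for every $k\ge k_0$ there is $N_0$ such that for all $N\ge N_0$ the graph $G=G_{\varepsilon,k,N}$ satisfies $$0<\mathrm{LP}(G)\le(1+\delta)\frac{N^3}{4\varepsilon},\qquad \mathrm{OPT}(G)\ge(1-\delta)\frac{4N^3}{9\varepsilon},\qquad \mathrm{OPT}(G)\ge\Bigl(\frac{16}{9}-\delta\Bigr)\mathrm{LP}(G).$$ -/

import Mathlib

open scoped ENNReal NNReal

namespace MSVC

/-! ### Min sum vertex cover -/

/-- An assignment of the vertices to the time slots `1, …, |V|`, one vertex per slot. -/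
def IsSchedule {V : Type*} [Fintype V] (s : V → ℕ) : Prop :=
  Set.BijOn s Set.univ (Set.Icc 1 (Fintype.card V))

/-- The cover time of the edge `e`: the earliest slot that holds an endpoint of `e`. -/
noncomputable def coverTime {V : Type*} (s : V → ℕ) (e : Sym2 V) : ℕ :=
  sInf {t : ℕ | ∃ v ∈ e, s v = t}

open Classical in
/-- The sum of the cover times of all edges. -/
noncomputable def cost {V : Type*} [Fintype V] (G : SimpleGraph V) (s : V → ℕ) : ℕ :=
  ∑ e ∈ G.edgeFinset, coverTime s e

/-- The optimum of min sum vertex cover (a minimum: schedules always exist). -/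
noncomputable def opt {V : Type*} [Fintype V] (G : SimpleGraph V) : ℕ :=
  sInf {c : ℕ | ∃ s : V → ℕ, IsSchedule s ∧ cost G s = c}

/-! ### The natural LP relaxation

Time slots are `t = 1, 2, 3, …`; the values of `x v t` and `u e t` at `t = 0` are never used. -/

open Classical in
/-- `x v t` is the extent to which `v` is scheduled in slot `t`, and `u e t` the extent to which
`e` is uncovered at the start of slot `t`. Non-negativity is part of the type `ℝ≥0`. -/
structure LPFeasible {V : Type*} [Fintype V] (G : SimpleGraph V)
    (x : V → ℕ → ℝ≥0) (u : Sym2 V → ℕ → ℝ≥0) : Prop where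
  packing : ∀ t : ℕ, 1 ≤ t → ∑ v, x v t ≤ 1
  covering : ∀ e ∈ G.edgeSet, ∀ t : ℕ, 1 ≤ t →
    1 ≤ u e t + ∑ v with v ∈ e, ∑ t' ∈ Finset.Ico 1 t, x v t'

open Classical in
/-- The LP objective `∑_{e, t ≥ 1} u_{e,t}`, with value `∞` if the series diverges. -/
noncomputable def lpCost {V : Type*} [Fintype V] (G : SimpleGraph V)
    (u : Sym2 V → ℕ → ℝ≥0) : ℝ≥0∞ :=
  ∑ e ∈ G.edgeFinset, ∑' t : ℕ, (u e (t + 1) : ℝ≥0∞)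

/-- The value of the LP. -/
noncomputable def lpValue {V : Type*} [Fintype V] (G : SimpleGraph V) : ℝ≥0∞ :=
  ⨅ (x : V → ℕ → ℝ≥0) (u : Sym2 V → ℕ → ℝ≥0) (_ : LPFeasible G x u), lpCost G u

/-- `(x, u)` is an optimum solution of the LP. -/
def IsLPOptimum {V : Type*} [Fintype V] (G : SimpleGraph V)
    (x : V → ℕ → ℝ≥0) (u : Sym2 V → ℕ → ℝ≥0) : Prop :=
  LPFeasible G x u ∧
    ∀ (x' : V → ℕ → ℝ≥0) (u' : Sym2 V → ℕ → ℝ≥0), LPFeasible G x' u' → lpCost G u ≤ lpCost G u'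

/-! ### Kernel `α`-point rounding -/

/-- The kernel `K(t,t') = 4t'(t'+1) / (t(t+1)(t+2))` for `t ≥ t'`, and `0` for `t < t'`. -/
noncomputable def kernel (t t' : ℕ) : ℝ≥0 :=
  if t' ≤ t then (4 * t' * (t' + 1)) / (t * (t + 1) * (t + 2)) else 0

/-- `z_{v,t} = ∑_{t'} K(t,t') x_{v,t'}`, where only `t' ≤ t` contribute. -/
noncomputable def kernelTransform {V : Type*} (x : V → ℕ → ℝ≥0) (v : V) (t : ℕ) : ℝ≥0 :=
  ∑ t' ∈ Finset.Icc 1 t, kernel t t' * x v t'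

/-- The tentative slot of `v`: the earliest `t ≥ 1` with `∑_{t' ≤ t} z_{v,t'} ≥ α_v`, and `⊤` if
there is none. -/
noncomputable def tentative {V : Type*} (x : V → ℕ → ℝ≥0) (α : V → ℝ) (v : V) : ℕ∞ :=
  sInf {s : ℕ∞ | ∃ t : ℕ, 1 ≤ t ∧
    α v ≤ ((∑ t' ∈ Finset.Icc 1 t, kernelTransform x v t' : ℝ≥0) : ℝ) ∧ s = t}

open Classical in
/-- The schedule that orders the vertices by `τ` and breaks ties by the order `ρ`:
the slot of `v` is the number of vertices that come before `v`, plus one for `v` itself. -/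
noncomputable def orderBy {V : Type*} [Fintype V] (τ : V → ℕ∞)
    (ρ : V ≃ Fin (Fintype.card V)) (v : V) : ℕ :=
  (Finset.univ.filter fun w => τ w < τ v ∨ (τ w = τ v ∧ ρ w ≤ ρ v)).card

/-- The output of the rounding, for the thresholds `α` and the tie-breaking order `ρ`. -/
noncomputable def roundedSchedule {V : Type*} [Fintype V] (x : V → ℕ → ℝ≥0) (α : V → ℝ)
    (ρ : V ≃ Fin (Fintype.card V)) : V → ℕ :=
  orderBy (tentative x α) ρ

open Classical in
/-- The average cost of the rounded schedule over a uniformly random tie-breaking order. -/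
noncomputable def tieAverage {V : Type*} [Fintype V] (G : SimpleGraph V) (x : V → ℕ → ℝ≥0)
    (α : V → ℝ) : ℝ≥0∞ :=
  (∑ ρ : V ≃ Fin (Fintype.card V), (cost G (roundedSchedule x α ρ) : ℝ≥0∞)) /
    (Nat.factorial (Fintype.card V) : ℝ≥0∞)

/-- The expected cost of the rounded schedule, for independent `α_v` uniform in `[0,1]` and an
independent uniformly random tie-breaking order. -/
noncomputable def expectedCost {V : Type*} [Fintype V] (G : SimpleGraph V)
    (x : V → ℕ → ℝ≥0) : ℝ≥0∞ :=
  ∫⁻ α, tieAverage G x α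
    ∂(MeasureTheory.Measure.pi fun _ : V => MeasureTheory.volume.restrict (Set.Icc (0 : ℝ) 1))

/-! ### Polynomial time: a random access machine with logarithmic cost -/

/-- Memory: natural numbers in cells addressed by natural numbers. -/
abbrev Mem : Type := ℕ → ℕ

/-- Arithmetic expressions; `load a` reads the cell whose address is the value of `a`. -/
inductive Expr : Type
  | const (n : ℕ)
  | load (a : Expr)
  | add (a b : Expr)
  | sub (a b : Expr)
  | mul (a b : Expr)
  | div (a b : Expr)

namespace Expr

/-- The value of an expression (truncated subtraction, integer division). -/
def val (m : Mem) : Expr → ℕ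
  | const n => n
  | load a => m (val m a)
  | add a b => val m a + val m b
  | sub a b => val m a - val m b
  | mul a b => val m a * val m b
  | div a b => val m a / val m b

/-- The number of steps for the evaluation of an expression: `Nat.size` is the length in binary;
additions, subtractions and memory accesses take time linear in the lengths of the numbers
(and addresses) involved, multiplications and divisions the product of the lengths. -/
def steps (m : Mem) : Expr → ℕ
  | const n => n.size + 1
  | load a => steps m a + (val m a).size + (m (val m a)).size + 1
  | add a b => steps m a + steps m b + (val m a).size + (val m b).size + 1
  | sub a b => steps m a + steps m b + (val m a).size + (val m b).size + 1
  | mul a b => steps m a + steps m b + ((val m a).size + 1) * ((val m b).size + 1)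
  | div a b => steps m a + steps m b + ((val m a).size + 1) * ((val m b).size + 1)

end Expr

/-- Programs; a condition holds if its value is non-zero. -/
inductive Prog : Type
  | skip
  | store (a e : Expr)
  | seq (p q : Prog)
  | cond (c : Expr) (p q : Prog)
  | loop (c : Expr) (p : Prog)

/-- `Runs p m k m'`: started on the memory `m`, the program `p` halts after `k` steps with the
memory `m'`. -/
inductive Runs : Prog → Mem → ℕ → Mem → Prop
  | skip (m : Mem) : Runs Prog.skip m 1 m
  | store (a e : Expr) (m : Mem) :
      Runs (Prog.store a e) m
        (a.steps m + e.steps m + (a.val m).size + (e.val m).size + 1)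
        (Function.update m (a.val m) (e.val m))
  | seq {p q : Prog} {m m' m'' : Mem} {k l : ℕ} :
      Runs p m k m' → Runs q m' l m'' → Runs (Prog.seq p q) m (k + l) m''
  | condTrue {c : Expr} {p q : Prog} {m m' : Mem} {k : ℕ} :
      c.val m ≠ 0 → Runs p m k m' → Runs (Prog.cond c p q) m (c.steps m + k + 1) m'
  | condFalse {c : Expr} {p q : Prog} {m m' : Mem} {k : ℕ} :
      c.val m = 0 → Runs q m k m' → Runs (Prog.cond c p q) m (c.steps m + k + 1) m'
  | loopDone {c : Expr} {p : Prog} {m : Mem} :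
      c.val m = 0 → Runs (Prog.loop c p) m (c.steps m + 1) m
  | loopStep {c : Expr} {p : Prog} {m m' m'' : Mem} {k l : ℕ} :
      c.val m ≠ 0 → Runs p m k m' → Runs (Prog.loop c p) m' l m'' →
      Runs (Prog.loop c p) m (c.steps m + k + l + 1) m''

open Classical in
/-- The initial memory for the graph `G` and the random bits `r`: the number `n` of vertices,
then the `n × n` adjacency matrix row by row, then the random bits; all other cells are `0`. -/
noncomputable def inputMem {n : ℕ} (G : SimpleGraph (Fin n)) {b : ℕ} (r : Fin b → Bool) : Mem :=
  fun a =>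
    if a = 0 then n
    else if (∃ i j : Fin n, G.Adj i j ∧ a = n * i + j + 1) ∨
        (∃ i : Fin b, r i = true ∧ a = n * n + i + 1) then 1
    else 0

/-- `p` is a randomized polynomial time `c`-approximation algorithm for min sum vertex cover:
on every graph with `n` vertices and every outcome `r` of `bits n` fair coin flips it halts within
`time n` steps and leaves in the cells `0, …, n - 1` the slots of the vertices `0, …, n - 1` in a
schedule `s r`, whose expected cost is at most `c` times the optimum. -/
def IsRandPolyTimeApprox (p : Prog) (c : ℝ) : Prop :=
  ∃ bits time : Polynomial ℕ, ∀ (n : ℕ) (G : SimpleGraph (Fin n)),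
    ∃ s : (Fin (bits.eval n) → Bool) → Fin n → ℕ,
      (∀ r, IsSchedule (s r) ∧
        ∃ (k : ℕ) (m : Mem), k ≤ time.eval n ∧ Runs p (inputMem G r) k m ∧
          ∀ v : Fin n, m v = s r v) ∧
      (∑ r, (cost G (s r) : ℝ)) / 2 ^ (bits.eval n) ≤ c * (opt G : ℝ)

/-! ### The instances for the integrality gap -/

/-- The disjoint union of `k` complete graphs, the `i`-th with `size i` vertices. -/
def disjointCliques (k : ℕ) (size : Fin k → ℕ) : SimpleGraph (Σ i : Fin k, Fin (size i)) where
  Adj a b := a.1 = b.1 ∧ a ≠ b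
  symm := ⟨fun _ _ h => ⟨h.1.symm, h.2.symm⟩⟩
  loopless := ⟨fun _ h => h.2 rfl⟩

/-- Disjoint cliques of sizes `⌊N i ^ (-(2/3 + ε))⌋` for `i = 1, …, k`. -/
noncomputable def gapInstance (ε : ℝ) (k N : ℕ) :
    SimpleGraph (Σ i : Fin k, Fin ⌊(N : ℝ) * ((i : ℝ) + 1) ^ (-(2 / 3 + ε))⌋₊) :=
  disjointCliques k fun i => ⌊(N : ℝ) * ((i : ℝ) + 1) ^ (-(2 / 3 + ε))⌋₊

end MSVC

namespace MSVC

/-! ### The kernel inequality -/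

/-! The upper bound rests on a telescoping kernel: `K(t,i) = 2 (survival (t-1) i - survival t i)`.
Each unit of LP mass in slot `i` is doubled and released gradually from slot `i` on. Two effects are
balanced. The first is the stretch of time. By slot `t` the released mass is at most `4t/3`
(`sum_accumulated_le`), so an edge whose tentative slot is `t` waits for about `4t/3` vertices. The
second is the delay of edges. By independence an edge survives slot `t` with the product of the
survival probabilities of its endpoints, which AM-GM bounds by a square that depends only on the sum
`y` of their LP masses. Expanding the square reduces everything to `∑_t survival t i * survival t j
≤ 2/3 (i + j)` (`sum_survival_mul_le`). Hence the survival probabilities sum to at most `4/3` of the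
LP cost of the edge (`sum_sq_le_sum_uncovered`). Summation by parts multiplies the two factors to
`16/9`. The rounding and tie terms of lower order are absorbed because an edge is not delayed by its
own endpoints (`lintegral_edge_le`).

For tightness, the LP gives every vertex of a clique one half and so finishes a clique of size `s`
in about `s/2` slots. An integral schedule does best, by convexity, if it always cuts down the
largest remaining cliques (`levelPairs_le`). For clique sizes proportional to `i^(-2/3-ε)` both
costs become multiples of `∑ i^(-1-3ε)`, which is about `1/(3ε)`, and the quotient of the
coefficients tends to `16/9`.

The algorithm does not solve the LP. It minimizes the quadratic bound of the analysis directly, by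
greedy rounds in the manner of Frank and Wolfe (`pairSum_deficit_le`), and compares itself with an
optimum schedule instead of an LP optimum. Every slot is cut into quarters. Spreading an optimum
schedule over quarters saves a constant per edge, and this slack pays exactly for the greedy error,
the ties and the finitely many thresholds (`sum_cost_levelSchedule_le`). All quantities are integers
after clearing denominators, so the algorithm can be written with bounded sums and products, a
language whose compiler to the random access machine runs in polynomial time (`exists_compileSpec`).
-/

/-- The fraction of the doubled mass of slot `i` that kernel rounding has not used up to `t`. -/
noncomputable def survival (t i : ℕ) : ℝ :=
  if i ≤ t then (i * (i + 1) : ℝ) / ((t + 1) * (t + 2)) else 1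

lemma survival_of_le {t i : ℕ} (h : i ≤ t) :
    survival t i = (i * (i + 1) : ℝ) / ((t + 1) * (t + 2)) := if_pos h

lemma survival_of_lt {t i : ℕ} (h : t < i) : survival t i = 1 := if_neg (by omega)

lemma survival_nonneg (t i : ℕ) : 0 ≤ survival t i := by
  unfold survival; split_ifs <;> positivity

lemma survival_le_one (t i : ℕ) : survival t i ≤ 1 := by
  unfold survival
  split_ifs with h
  · rw [div_le_one (by positivity)]
    have : (i : ℝ) ≤ t := by exact_mod_cast h
    have : (0 : ℝ) ≤ i := by positivity
    nlinarith
  · exact le_rfl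

lemma survival_antitone {s t : ℕ} (h : s ≤ t) (i : ℕ) : survival t i ≤ survival s i := by
  by_cases hi : i ≤ s
  · rw [survival_of_le hi, survival_of_le (hi.trans h)]
    have : (s : ℝ) ≤ t := by exact_mod_cast h
    gcongr
  · rw [survival_of_lt (t := s) (by omega)]
    exact survival_le_one _ _

/-- The product is 1 before `i`, one factor decays quadratically between `i` and `j`, and both decay
after `j`. The first two pieces sum exactly; the third is dominated by a telescoping sum of inverse
cubes. -/
lemma sum_survival_mul_le_of_le {i j : ℕ} (hij : i ≤ j) (T : ℕ) :
    (T ≤ i → ∑ t ∈ Finset.range T, survival t i * survival t j = T) ∧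
    (i ≤ T → T ≤ j → ∑ t ∈ Finset.range T, survival t i * survival t j
      = 2 * i - i * (i + 1) / (T + 1)) ∧
    (j ≤ T → ∑ t ∈ Finset.range T, survival t i * survival t j
      ≤ 2 * i - i * (i + 1) / (j + 1) + i * (i + 1) * (j * (j + 1)) / 3 *
        (1 / (j + 1) ^ 3 - 1 / (T + 1) ^ 3)) := by
  have h1 : ∀ T : ℕ, T ≤ i → ∑ t ∈ Finset.range T, survival t i * survival t j = T := by
    intro T hT
    rw [Finset.sum_congr rfl (g := fun _ => (1 : ℝ))]
    · simp
    · intro t ht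
      have := Finset.mem_range.1 ht
      rw [survival_of_lt (by omega), survival_of_lt (by omega), one_mul]
  have h2 : ∀ T : ℕ, i ≤ T → T ≤ j → ∑ t ∈ Finset.range T, survival t i * survival t j
      = 2 * i - i * (i + 1) / (T + 1) := by
    intro T hT
    induction T, hT using Nat.le_induction with
    | base =>
      intro _
      rw [h1 i le_rfl]
      field_simp
      ring
    | succ T hT ih =>
      intro hj
      rw [Finset.sum_range_succ, ih (by omega), survival_of_le hT, survival_of_lt (by omega)]
      push_cast
      field_simp
      ring
  refine ⟨h1 T, h2 T, ?_⟩
  intro hT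
  induction T, hT using Nat.le_induction with
  | base =>
    rw [h2 j hij le_rfl]
    simp
  | succ T hT ih =>
    rw [Finset.sum_range_succ, survival_of_le hT, survival_of_le (hij.trans hT)]
    -- The difference of inverse cubes has numerator `3T² + 9T + 7`, one more than `3 (T + 1) (T +
    -- 2)`.
    have key : (1 : ℝ) / ((T + 1) * (T + 2)) ^ 2 ≤
        1 / 3 * (1 / (T + 1) ^ 3 - 1 / (T + 1 + 1) ^ 3) := by
      rw [show (1 : ℝ) / 3 * (1 / (T + 1) ^ 3 - 1 / (T + 1 + 1) ^ 3)
        = (3 * T ^ 2 + 9 * T + 7) / (3 * ((T + 1) * (T + 2)) ^ 3) by field_simp; ring]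
      rw [div_le_div_iff₀ (by positivity) (by positivity)]
      have : (0 : ℝ) ≤ ((T + 1) * (T + 2)) ^ 2 := by positivity
      nlinarith
    have hc : (0 : ℝ) ≤ i * (i + 1) * (j * (j + 1)) := by positivity
    have := mul_le_mul_of_nonneg_left key hc
    have e1 : (i * (i + 1) : ℝ) / ((T + 1) * (T + 2)) * (j * (j + 1) / ((T + 1) * (T + 2)))
        = i * (i + 1) * (j * (j + 1)) * (1 / ((T + 1) * (T + 2)) ^ 2) := by
      field_simp
    push_cast
    rw [e1]
    linarith [ih]

/-- A bound that is additive in `i` and `j` becomes linear when averaged over pairs from a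
probability distribution. The coefficient `2/3` is the origin of the factor `4/3` per edge. -/
lemma sum_survival_mul_le {i j : ℕ} (T : ℕ) :
    ∑ t ∈ Finset.range T, survival t i * survival t j ≤ 2 / 3 * (i + j) := by
  wlog hij : i ≤ j generalizing i j
  · have := this (i := j) (j := i) (by omega)
    rw [add_comm (i : ℝ)]
    refine le_trans (le_of_eq ?_) this
    exact Finset.sum_congr rfl fun t _ => mul_comm _ _
  obtain ⟨h1, h2, h3⟩ := sum_survival_mul_le_of_le hij T
  have hij' : (i : ℝ) ≤ j := by exact_mod_cast hij
  have hi0 : (0 : ℝ) ≤ i := by positivity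
  -- This rearranges to `(2i - j)(j + 1) ≤ i (i + 1)`, an equality for `i = j`.
  have hsq : (0 : ℝ) ≤ (j - i) * (j - i + 1) := mul_nonneg (by linarith) (by linarith)
  have final : 2 * (i : ℝ) - 2 / 3 * (i * (i + 1) / (j + 1)) ≤ 2 / 3 * (i + j) := by
    have : (2 * i - j : ℝ) ≤ i * (i + 1) / (j + 1) := by
      rw [le_div_iff₀ (by positivity)]
      nlinarith
    linarith
  rcases le_total T i with h | h
  · rw [h1 h]
    have : (T : ℝ) ≤ i := by exact_mod_cast h
    linarith
  rcases le_total T j with h' | h'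
  · rw [h2 h h']
    have hT : (T : ℝ) ≤ j := by exact_mod_cast h'
    have : (i * (i + 1) : ℝ) / (j + 1) ≤ i * (i + 1) / (T + 1) := by gcongr
    have h0 : (0 : ℝ) ≤ (i * (i + 1) : ℝ) / (j + 1) := by positivity
    linarith
  · refine (h3 h').trans (le_trans ?_ final)
    have hpos : (0 : ℝ) ≤ 1 / (T + 1) ^ 3 := by positivity
    have e : (i * (i + 1) * (j * (j + 1)) / 3 * (1 / (j + 1) ^ 3 - 1 / (T + 1) ^ 3) : ℝ)
        ≤ 1 / 3 * (i * (i + 1) / (j + 1)) := by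
      calc (i * (i + 1) * (j * (j + 1)) / 3 * (1 / (j + 1) ^ 3 - 1 / (T + 1) ^ 3) : ℝ)
          ≤ i * (i + 1) * (j * (j + 1)) / 3 * (1 / (j + 1) ^ 3) := by
            gcongr; linarith
        _ = 1 / 3 * (i * (i + 1) / (j + 1)) * (j / (j + 1)) := by field_simp
        _ ≤ 1 / 3 * (i * (i + 1) / (j + 1)) * 1 := by
            gcongr
            rw [div_le_one (by positivity)]; linarith
        _ = _ := mul_one _
    linarith

lemma sum_sq_sum_survival_le (I : Finset ℕ) (y : ℕ → ℝ) (hy : ∀ i, 0 ≤ y i)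
    (h1 : ∑ i ∈ I, y i = 1) (T : ℕ) :
    ∑ t ∈ Finset.range T, (∑ i ∈ I, y i * survival t i) ^ 2 ≤ 4 / 3 * ∑ i ∈ I, i * y i := by
  have e : ∑ t ∈ Finset.range T, (∑ i ∈ I, y i * survival t i) ^ 2 =
      ∑ i ∈ I, ∑ j ∈ I, y i * y j * ∑ t ∈ Finset.range T, survival t i * survival t j := by
    simp_rw [sq, Finset.sum_mul_sum, Finset.mul_sum]
    rw [Finset.sum_comm]
    refine Finset.sum_congr rfl fun i _ => ?_
    rw [Finset.sum_comm]
    refine Finset.sum_congr rfl fun j _ => Finset.sum_congr rfl fun t _ => ?_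
    ring
  rw [e]
  calc _ ≤ ∑ i ∈ I, ∑ j ∈ I, y i * y j * (2 / 3 * (i + j)) := by
        refine Finset.sum_le_sum fun i _ => Finset.sum_le_sum fun j _ => ?_
        exact mul_le_mul_of_nonneg_left (sum_survival_mul_le T) (mul_nonneg (hy i) (hy j))
    _ = 2 / 3 * ((∑ i ∈ I, i * y i) * ∑ j ∈ I, y j + (∑ i ∈ I, y i) * ∑ j ∈ I, j * y j) := by
        rw [Finset.sum_mul_sum, Finset.sum_mul_sum, ← Finset.sum_add_distrib, Finset.mul_sum]
        refine Finset.sum_congr rfl fun i _ => ?_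
        rw [← Finset.sum_add_distrib, Finset.mul_sum]
        refine Finset.sum_congr rfl fun j _ => ?_
        ring
    _ = _ := by rw [h1]; ring

/-- The part of a unit of demand that `y` leaves uncovered at the start of slot `t`. -/
noncomputable def uncovered (y : ℕ → ℝ) (t : ℕ) : ℝ := max 0 (1 - ∑ i ∈ Finset.Ico 1 t, y i)

lemma uncovered_nonneg (y : ℕ → ℝ) (t : ℕ) : 0 ≤ uncovered y t := le_max_left _ _

lemma uncovered_one (y : ℕ → ℝ) : uncovered y 1 = 1 := by simp [uncovered]

lemma uncovered_succ_le {y : ℕ → ℝ} (hy : ∀ i, 0 ≤ y i) (t : ℕ) :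
    uncovered y (t + 1) ≤ uncovered y t := by
  unfold uncovered
  have : ∑ i ∈ Finset.Ico 1 t, y i ≤ ∑ i ∈ Finset.Ico 1 (t + 1), y i :=
    Finset.sum_le_sum_of_subset_of_nonneg (Finset.Ico_subset_Ico le_rfl (by omega))
      fun i _ _ => hy i
  exact max_le_max le_rfl (by linarith)

lemma uncovered_sub_le {y : ℕ → ℝ} (hy : ∀ i, 0 ≤ y i) {t : ℕ} (ht : 1 ≤ t) :
    uncovered y t - uncovered y (t + 1) ≤ y t := by
  unfold uncovered
  rw [Finset.sum_Ico_succ_top ht]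
  have := hy t
  rcases le_total 0 (1 - ∑ i ∈ Finset.Ico 1 t, y i) with h | h
  · rw [max_eq_right h]
    linarith [le_max_right 0 (1 - (∑ i ∈ Finset.Ico 1 t, y i + y t))]
  · rw [max_eq_left h]
    linarith [le_max_left 0 (1 - (∑ i ∈ Finset.Ico 1 t, y i + y t))]

lemma sum_mul_uncovered_sub (w : ℕ → ℝ) (T : ℕ) :
    ∑ i ∈ Finset.Icc 1 T, i * (w i - w (i + 1)) + (T + 1) * w (T + 1)
      = ∑ i ∈ Finset.Icc 1 (T + 1), w i := by
  induction T with
  | zero => simp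
  | succ T ih =>
    rw [Finset.sum_Icc_succ_top (by omega), Finset.sum_Icc_succ_top (by omega), ← ih]
    push_cast
    ring

/-- The square of the uncovered part after kernel rounding is charged to the uncovered part. -/
theorem sum_sq_le_sum_uncovered (y : ℕ → ℝ) (hy : ∀ i, 0 ≤ y i) (T : ℕ) :
    ∑ t ∈ Finset.range T, (max 0 (1 - ∑ i ∈ Finset.Icc 1 t, y i * (1 - survival t i))) ^ 2
      ≤ 4 / 3 * ∑ t ∈ Finset.Icc 1 (T + 1), uncovered y t := by
  set w := uncovered y with hw
  -- `z` is `y` clipped to total mass 1, with the mass still missing after `T` placed at `T + 1`.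
  -- Its mean is the sum of the uncovered parts, by `sum_mul_uncovered_sub`.
  let z : ℕ → ℝ := fun i => if i ≤ T then w i - w (i + 1) else w (T + 1)
  have hz : ∀ i, 0 ≤ z i := by
    intro i
    simp only [z]
    split_ifs
    · linarith [uncovered_succ_le hy i]
    · exact uncovered_nonneg _ _
  have htel : ∀ t, ∑ i ∈ Finset.Icc 1 t, (w i - w (i + 1)) = 1 - w (t + 1) := by
    intro t
    induction t with
    | zero => simp [hw, uncovered_one]
    | succ t ih => rw [Finset.sum_Icc_succ_top (by omega), ih]; ring
  have hzl : ∀ i ∈ Finset.Icc 1 T, z i = w i - w (i + 1) := by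
    intro i hi
    simp only [Finset.mem_Icc] at hi
    simp [z, hi.2]
  have hzT : z (T + 1) = w (T + 1) := by simp [z]
  have hz1 : ∑ i ∈ Finset.Icc 1 (T + 1), z i = 1 := by
    rw [Finset.sum_Icc_succ_top (by omega), Finset.sum_congr rfl hzl, htel, hzT]
    ring
  have hzi : ∑ i ∈ Finset.Icc 1 (T + 1), i * z i = ∑ t ∈ Finset.Icc 1 (T + 1), w t := by
    rw [← sum_mul_uncovered_sub w T, Finset.sum_Icc_succ_top (by omega), hzT]
    push_cast
    congr 1
    exact Finset.sum_congr rfl fun i hi => by rw [hzl i hi]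
  rw [← hzi]
  refine le_trans (Finset.sum_le_sum fun t ht => ?_) (sum_sq_sum_survival_le _ z hz hz1 T)
  have ht' := Finset.mem_range.1 ht
  have hnn : 0 ≤ ∑ i ∈ Finset.Icc 1 (T + 1), z i * survival t i :=
    Finset.sum_nonneg fun i _ => mul_nonneg (hz i) (survival_nonneg _ _)
  -- Passing from `y` to `z` only increases what is left: `z ≤ y` up to `T`, and indices beyond `t`
  -- have survival 1 and release nothing.
  refine pow_le_pow_left₀ (le_max_left _ _) (max_le hnn ?_) 2
  have e1 : ∑ i ∈ Finset.Icc 1 (T + 1), z i * survival t i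
      = 1 - ∑ i ∈ Finset.Icc 1 (T + 1), z i * (1 - survival t i) := by
    simp_rw [mul_sub, mul_one, Finset.sum_sub_distrib, hz1]
    ring
  have e2 : ∑ i ∈ Finset.Icc 1 (T + 1), z i * (1 - survival t i)
      = ∑ i ∈ Finset.Icc 1 t, z i * (1 - survival t i) := by
    symm
    refine Finset.sum_subset (Finset.Icc_subset_Icc le_rfl (by omega)) fun i hi hi' => ?_
    simp only [Finset.mem_Icc] at hi hi'
    rw [survival_of_lt (by omega)]
    ring
  rw [e1, e2]
  have : ∑ i ∈ Finset.Icc 1 t, z i * (1 - survival t i)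
      ≤ ∑ i ∈ Finset.Icc 1 t, y i * (1 - survival t i) := by
    refine Finset.sum_le_sum fun i hi => ?_
    simp only [Finset.mem_Icc] at hi
    refine mul_le_mul_of_nonneg_right ?_ (by linarith [survival_le_one t i])
    rw [hzl i (by simp only [Finset.mem_Icc]; omega)]
    exact uncovered_sub_le hy hi.1
  linarith

end MSVC

namespace MSVC

/-! ### Schedules from linear orders -/

section Schedules

variable {V : Type*} [Fintype V]

open Classical in
/-- The position of `v` when the vertices are sorted by `κ`. -/
noncomputable def rank {β : Type*} [LinearOrder β] (κ : V → β) (v : V) : ℕ :=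
  (Finset.univ.filter fun w => κ w ≤ κ v).card

lemma rank_le_rank {β : Type*} [LinearOrder β] (κ : V → β) {v w : V} (h : κ v ≤ κ w) :
    rank κ v ≤ rank κ w := by
  classical
  refine Finset.card_le_card fun u hu => ?_
  simp only [Finset.mem_filter, Finset.mem_univ, true_and] at hu ⊢
  exact hu.trans h

lemma rank_lt_rank {β : Type*} [LinearOrder β] (κ : V → β) {v w : V} (h : κ v < κ w) :
    rank κ v < rank κ w := by
  classical
  refine Finset.card_lt_card ⟨fun u hu => ?_, fun hc => ?_⟩
  · simp only [Finset.mem_filter, Finset.mem_univ, true_and] at hu ⊢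
    exact hu.trans h.le
  · have := hc (show w ∈ Finset.univ.filter fun u => κ u ≤ κ w by simp)
    simp only [Finset.mem_filter, Finset.mem_univ, true_and] at this
    exact absurd this (not_le.2 h)

lemma isSchedule_of_injective {s : V → ℕ} (hs : Function.Injective s)
    (h : ∀ v, 1 ≤ s v ∧ s v ≤ Fintype.card V) : IsSchedule s := by
  classical
  refine ⟨fun v _ => Set.mem_Icc.2 (h v), hs.injOn, ?_⟩
  have := Finset.surjOn_of_injOn_of_card_le (s := (Finset.univ : Finset V))
    (t := Finset.Icc 1 (Fintype.card V)) s (fun v _ => by simpa using h v) hs.injOn (by simp)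
  simpa using this

lemma isSchedule_rank {β : Type*} [LinearOrder β] {κ : V → β} (hκ : Function.Injective κ) :
    IsSchedule (rank κ) := by
  classical
  refine isSchedule_of_injective (fun v w h => ?_) fun v => ⟨?_, ?_⟩
  · by_contra hne
    rcases lt_or_gt_of_ne (fun h' => hne (hκ h')) with h' | h'
    · exact absurd h (rank_lt_rank κ h').ne
    · exact absurd h (rank_lt_rank κ h').ne'
  · exact Finset.card_pos.2 ⟨v, by simp⟩
  · exact (Finset.card_le_univ _)

lemma coverTime_mk {V : Type*} (s : V → ℕ) (a b : V) : coverTime s s(a, b) = min (s a) (s b) := by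
  have : {t : ℕ | ∃ v ∈ s(a, b), s v = t} = {s a, s b} := by
    ext t
    simp [eq_comm]
  rw [coverTime, this, csInf_pair]

open Classical in
lemma coverTime_rank {β : Type*} [LinearOrder β] (κ : V → β) (a b : V) :
    coverTime (rank κ) s(a, b) = (Finset.univ.filter fun w => κ w ≤ κ a ∧ κ w ≤ κ b).card := by
  rw [coverTime_mk]
  rcases le_total (κ a) (κ b) with h | h
  · rw [min_eq_left (rank_le_rank κ h), rank]
    congr 1
    ext w
    simp only [Finset.mem_filter, Finset.mem_univ, true_and]
    exact ⟨fun hw => ⟨hw, hw.trans h⟩, fun hw => hw.1⟩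
  · rw [min_eq_right (rank_le_rank κ h), rank]
    congr 1
    ext w
    simp only [Finset.mem_filter, Finset.mem_univ, true_and]
    exact ⟨fun hw => ⟨hw.trans h, hw⟩, fun hw => hw.2⟩

open Classical in
/-- The cover time of an edge is one plus the number of other vertices before both endpoints. -/
lemma coverTime_rank_eq {β : Type*} [LinearOrder β] {κ : V → β} (hκ : Function.Injective κ)
    {a b : V} (hab : a ≠ b) :
    coverTime (rank κ) s(a, b) =
      1 + ∑ w ∈ Finset.univ \ {a, b}, if κ w ≤ κ a ∧ κ w ≤ κ b then 1 else 0 := by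
  rw [coverTime_rank, Finset.card_filter, ← Finset.sum_sdiff (Finset.subset_univ {a, b}), add_comm]
  congr 1
  rw [Finset.sum_pair hab]
  rcases lt_or_gt_of_ne (fun h => hab (hκ h)) with h | h
  · simp [h.le, not_le.2 h]
  · simp [h.le, not_le.2 h]

lemma opt_le_cost (G : SimpleGraph V) {s : V → ℕ} (hs : IsSchedule s) : opt G ≤ cost G s :=
  Nat.sInf_le ⟨s, hs, rfl⟩

lemma exists_isSchedule : ∃ s : V → ℕ, IsSchedule s :=
  ⟨_, isSchedule_rank (Fintype.equivFin V).injective⟩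

lemma exists_cost_eq_opt (G : SimpleGraph V) : ∃ s : V → ℕ, IsSchedule s ∧ cost G s = opt G := by
  obtain ⟨s, hs⟩ := exists_isSchedule (V := V)
  exact Nat.sInf_mem (s := {c : ℕ | ∃ s : V → ℕ, IsSchedule s ∧ cost G s = c}) ⟨_, s, hs, rfl⟩

lemma IsSchedule.injective {s : V → ℕ} (hs : IsSchedule s) : Function.Injective s :=
  Set.injOn_univ.1 hs.2.1

lemma IsSchedule.one_le {s : V → ℕ} (hs : IsSchedule s) (v : V) : 1 ≤ s v :=
  (hs.1 (Set.mem_univ v)).1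

lemma IsSchedule.le_card {s : V → ℕ} (hs : IsSchedule s) (v : V) : s v ≤ Fintype.card V :=
  (hs.1 (Set.mem_univ v)).2

lemma IsSchedule.exists_eq {s : V → ℕ} (hs : IsSchedule s) {t : ℕ} (h1 : 1 ≤ t)
    (h2 : t ≤ Fintype.card V) : ∃ v, s v = t := by
  obtain ⟨v, -, hv⟩ := hs.2.2 (Set.mem_Icc.2 ⟨h1, h2⟩)
  exact ⟨v, hv⟩

/-! ### Random tie-breaking -/

lemma orderBy_eq_rank (τ : V → ℕ∞) (ρ : V ≃ Fin (Fintype.card V)) :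
    orderBy τ ρ = rank fun v => toLex (τ v, ρ v) := by
  classical
  ext v
  unfold orderBy rank
  congr 1
  ext w
  simp [Prod.Lex.toLex_le_toLex]

lemma injective_toLex (τ : V → ℕ∞) (ρ : V ≃ Fin (Fintype.card V)) :
    Function.Injective fun v => toLex (τ v, ρ v) := fun v w h => by
  have := congrArg (fun p => (ofLex p).2) h
  exact ρ.injective this

lemma isSchedule_orderBy (τ : V → ℕ∞) (ρ : V ≃ Fin (Fintype.card V)) :
    IsSchedule (orderBy τ ρ) := by
  rw [orderBy_eq_rank]
  exact isSchedule_rank (injective_toLex τ ρ)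

/-- How much a vertex with tentative slot `s` delays an edge with tentative slot `t`, on average
over the tie-breaking order. -/
noncomputable def delay (s t : ℕ∞) : ℝ≥0∞ := if s < t then 1 else if s = t then 1 / 2 else 0

open Classical in
-- Swapping `w` and `a` injects the orders with `w` first into the orders with `a` first.
lemma two_mul_card_filter_lt_le {a w : V} (h : w ≠ a) :
    2 * (Finset.univ.filter fun ρ : V ≃ Fin (Fintype.card V) => ρ w ≤ ρ a).card
      ≤ (Fintype.card V).factorial := by
  have h1 : (Finset.univ.filter fun ρ : V ≃ Fin (Fintype.card V) => ρ w ≤ ρ a).card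
      ≤ (Finset.univ.filter fun ρ : V ≃ Fin (Fintype.card V) => ρ a < ρ w).card := by
    refine Finset.card_le_card_of_injOn (fun ρ => (Equiv.swap w a).trans ρ) (fun ρ hρ => ?_) ?_
    · simp only [Finset.coe_filter, Finset.mem_univ, true_and, Set.mem_ofPred_eq] at hρ ⊢
      simp only [Equiv.trans_apply, Equiv.swap_apply_left, Equiv.swap_apply_right]
      exact lt_of_le_of_ne hρ fun h' => h (ρ.injective h')
    · intro ρ _ ρ' _ hh
      ext v
      have := congrArg (fun e : V ≃ Fin (Fintype.card V) => e (Equiv.swap w a v)) hh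
      simpa using congrArg Fin.val this
  have h2 : (Finset.univ.filter fun ρ : V ≃ Fin (Fintype.card V) => ρ w ≤ ρ a).card
      + (Finset.univ.filter fun ρ : V ≃ Fin (Fintype.card V) => ¬ ρ w ≤ ρ a).card
      = (Fintype.card V).factorial := by
    rw [Finset.card_filter_add_card_filter_not, Finset.card_univ,
      Fintype.card_equiv (Fintype.equivFin V)]
  simp only [not_le] at h2
  omega

open Classical in
-- In a tie it suffices to compare `w` with one endpoint that attains the minimum, which gives
-- probability at most one half. If both endpoints tie with `w` the true probability is smaller,
-- hence the inequality.
lemma sum_coverTime_orderBy_le (τ : V → ℕ∞) {a b : V} (hab : a ≠ b) :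
    (∑ ρ : V ≃ Fin (Fintype.card V), (coverTime (orderBy τ ρ) s(a, b) : ℝ≥0∞)) /
      ((Fintype.card V).factorial : ℝ≥0∞)
      ≤ 1 + ∑ w ∈ Finset.univ \ {a, b}, delay (τ w) (min (τ a) (τ b)) := by
  have hf0 : ((Fintype.card V).factorial : ℝ≥0∞) ≠ 0 := by
    exact_mod_cast (Nat.factorial_pos _).ne'
  have hft : ((Fintype.card V).factorial : ℝ≥0∞) ≠ ⊤ := ENNReal.natCast_ne_top _
  refine ENNReal.div_le_of_le_mul ?_
  have hcard : (Finset.univ : Finset (V ≃ Fin (Fintype.card V))).card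
      = (Fintype.card V).factorial := by
    rw [Finset.card_univ, Fintype.card_equiv (Fintype.equivFin V)]
  simp_rw [orderBy_eq_rank, coverTime_rank_eq (injective_toLex τ _) hab]
  push_cast
  rw [Finset.sum_add_distrib, Finset.sum_const, hcard, Finset.sum_comm, add_mul, Finset.sum_mul]
  refine add_le_add (by simp) (Finset.sum_le_sum fun w hw => ?_)
  simp only [Finset.mem_sdiff, Finset.mem_univ, Finset.mem_insert, Finset.mem_singleton, not_or,
    true_and] at hw
  have hhalf : ∀ c : V, w ≠ c → (∑ ρ : V ≃ Fin (Fintype.card V),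
      if ρ w ≤ ρ c then (1 : ℝ≥0∞) else 0) ≤ 1 / 2 * ((Fintype.card V).factorial : ℝ≥0∞) := by
    intro c hc
    rw [← Finset.sum_filter, Finset.sum_const, nsmul_eq_mul, mul_one, one_div, mul_comm,
      ← div_eq_mul_inv, ENNReal.le_div_iff_mul_le (by simp) (by simp), mul_comm]
    exact_mod_cast two_mul_card_filter_lt_le hc
  simp only [Prod.Lex.toLex_le_toLex]
  unfold delay
  split_ifs with h1 h2
  · rw [one_mul, ← hcard]
    calc _ ≤ ∑ ρ : V ≃ Fin (Fintype.card V), (1 : ℝ≥0∞) :=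
          Finset.sum_le_sum fun ρ _ => by split_ifs <;> simp
      _ = _ := by simp
  · rcases le_total (τ a) (τ b) with h | h
    · rw [min_eq_left h] at h2
      refine le_trans (Finset.sum_le_sum fun ρ _ => ?_) (hhalf a hw.1)
      simp only [h2, lt_irrefl, true_and, false_or]
      split_ifs with h3 h4
      · exact le_rfl
      · exact absurd h3.1 h4
      · exact zero_le
      · exact le_rfl
    · rw [min_eq_right h] at h2
      refine le_trans (Finset.sum_le_sum fun ρ _ => ?_) (hhalf b hw.2)
      simp only [h2, lt_irrefl, true_and, false_or]
      split_ifs with h3 h4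
      · exact le_rfl
      · exact absurd h3.2 h4
      · exact zero_le
      · exact le_rfl
  · rw [zero_mul, nonpos_iff_eq_zero]
    refine Finset.sum_eq_zero fun ρ _ => if_neg ?_
    have h3 : min (τ a) (τ b) < τ w := lt_of_le_of_ne (not_lt.1 h1) (Ne.symm h2)
    rcases min_lt_iff.1 h3 with h | h
    · exact fun hc => by rcases hc.1 with h' | h'
                         · exact absurd h' (not_lt.2 h.le)
                         · exact h.ne h'.1.symm
    · exact fun hc => by rcases hc.2 with h' | h'
                         · exact absurd h' (not_lt.2 h.le)
                         · exact h.ne h'.1.symm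

lemma tieAverage_eq (G : SimpleGraph V) (x : V → ℕ → ℝ≥0) (α : V → ℝ) :
    open Classical in
    tieAverage G x α = ∑ e ∈ G.edgeFinset,
      (∑ ρ : V ≃ Fin (Fintype.card V), (coverTime (orderBy (tentative x α) ρ) e : ℝ≥0∞)) /
      ((Fintype.card V).factorial : ℝ≥0∞) := by
  classical
  unfold tieAverage cost roundedSchedule
  push_cast
  simp_rw [div_eq_mul_inv]
  rw [← Finset.sum_mul, Finset.sum_comm]

end Schedules

end MSVC

namespace MSVC

/-! ### Independent tentative slots -/

section Independent

open MeasureTheory ProbabilityTheory Filter Topology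

variable {V A : Type*} [Fintype V] [MeasurableSpace A]

lemma pi_min_gt (ν : Measure A) [IsProbabilityMeasure ν] {f : V → A → ℕ∞}
    (hf : ∀ v, Measurable (f v)) {a b : V} (hab : a ≠ b) (t : ℕ∞) :
    Measure.pi (fun _ : V => ν) {ω | t < min (f a (ω a)) (f b (ω b))}
      = ENNReal.ofReal (ν.real {x | t < f a x} * ν.real {x | t < f b x}) := by
  have hind := (iIndepFun_pi (μ := fun _ : V => ν) (X := f) fun v => (hf v).aemeasurable).indepFun
    hab
  have h1 := hind.measure_inter_preimage_eq_mul (s := {s | t < s}) (t := {s | t < s})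
    (MeasurableSet.of_discrete) (MeasurableSet.of_discrete)
  have e : ∀ v, Measure.pi (fun _ : V => ν) ((fun ω : V → A => f v (ω v)) ⁻¹' {s | t < s})
      = ν {x | t < f v x} := fun v =>
    (measurePreserving_eval (fun _ : V => ν) v).measure_preimage (s := f v ⁻¹' {s | t < s})
      ((hf v) MeasurableSet.of_discrete).nullMeasurableSet
  rw [e, e] at h1
  rw [ENNReal.ofReal_mul measureReal_nonneg, ofReal_measureReal, ofReal_measureReal, ← h1]
  congr 1
  ext ω
  simp

open Classical in
/-- The expected delay of the edge `{a, b}`, summed over the tentative slots of the edge. -/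
theorem lintegral_delay_le (ν : Measure A) [IsProbabilityMeasure ν] {f : V → A → ℕ∞}
    (hf : ∀ v, Measurable (f v)) (hf1 : ∀ v x, 1 ≤ f v x) {a b : V} (hab : a ≠ b)
    (θ : ℕ∞ → ℕ∞ → ℝ≥0∞) {S : ℕ → ℝ}
    (hS : ∀ t : ℕ, S t = ν.real {x | (t : ℕ∞) < f a x} * ν.real {x | (t : ℕ∞) < f b x})
    (hlim : Tendsto S atTop (𝓝 0)) (c : ℕ → ℝ)
    (hc : ∀ t : ℕ, 1 ≤ t →
      1 + ∑ w ∈ Finset.univ \ {a, b}, ∫⁻ x, θ (f w x) t ∂ν ≤ ENNReal.ofReal (c t))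
    {R : ℝ} (hR : ∀ T, ∑ t ∈ Finset.range T, (S t - S (t + 1)) * c (t + 1) ≤ R) :
    ∫⁻ ω, (1 + ∑ w ∈ Finset.univ \ {a, b}, θ (f w (ω w)) (min (f a (ω a)) (f b (ω b))))
      ∂(Measure.pi fun _ : V => ν) ≤ ENNReal.ofReal R := by
  set μ := Measure.pi fun _ : V => ν with hμ
  set M : (V → A) → ℕ∞ := fun ω => min (f a (ω a)) (f b (ω b)) with hM
  have hfm : ∀ v, Measurable fun ω : V → A => f v (ω v) := fun v =>
    (hf v).comp (measurable_pi_apply v)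
  have hMm : Measurable M :=
    (Measurable.of_discrete (f := fun p : ℕ∞ × ℕ∞ => min p.1 p.2)).comp ((hfm a).prodMk (hfm b))
  have hgt : ∀ t : ℕ, μ {ω | (t : ℕ∞) < M ω} = ENNReal.ofReal (S t) := fun t => by
    rw [hμ, hM, pi_min_gt ν hf hab, hS]
  have hS0 : ∀ t, 0 ≤ S t := fun t => by
    rw [hS]
    exact mul_nonneg measureReal_nonneg measureReal_nonneg
  have hlt : ∀ t : ℕ, (t : ℕ∞) < ((t + 1 : ℕ) : ℕ∞) := fun t => by norm_cast; omega
  have hSanti : ∀ t, S (t + 1) ≤ S t := fun t => by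
    rw [hS, hS]
    have hsub : ∀ v, ν.real {x | ((t + 1 : ℕ) : ℕ∞) < f v x} ≤ ν.real {x | (t : ℕ∞) < f v x} :=
      fun v => measureReal_mono fun x hx => (hlt t).trans (Set.mem_ofPred_eq.mp hx)
    exact mul_le_mul (hsub a) (hsub b) measureReal_nonneg measureReal_nonneg
  have heq : ∀ t : ℕ, μ {ω | M ω = ((t + 1 : ℕ) : ℕ∞)} = ENNReal.ofReal (S t - S (t + 1)) := by
    intro t
    have : {ω | M ω = ((t + 1 : ℕ) : ℕ∞)}
        = {ω | (t : ℕ∞) < M ω} \ {ω | ((t + 1 : ℕ) : ℕ∞) < M ω} := by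
      ext ω
      simp only [Set.mem_sdiff, Set.mem_ofPred_eq, not_lt]
      constructor
      · intro h
        rw [h]
        exact ⟨by norm_cast; omega, le_rfl⟩
      · rintro ⟨h1, h2⟩
        refine le_antisymm h2 ?_
        push_cast
        exact Order.add_one_le_of_lt h1
    rw [this, measure_sdiff, hgt, hgt, ENNReal.ofReal_sub _ (hS0 _)]
    · exact fun ω hω => (hlt t).trans (Set.mem_ofPred_eq.mp hω)
    · exact (hMm MeasurableSet.of_discrete).nullMeasurableSet (s := M ⁻¹' {s | _ < s})
    · exact measure_ne_top _ _
  -- The survival probabilities tend to 0, so the edge almost surely has a finite tentative slot and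
  -- the expectation splits over its values.
  have htop : ∀ᵐ ω ∂μ, M ω ≠ ⊤ := by
    rw [ae_iff]
    simp only [ne_eq, not_not]
    refine le_antisymm (ge_of_tendsto' (f := fun t => ENNReal.ofReal (S t)) (x := atTop) ?_
      fun t => ?_) zero_le
    · simpa [Function.comp_def] using (ENNReal.continuous_ofReal.tendsto 0).comp hlim
    · rw [← hgt]
      refine measure_mono fun ω hω => ?_
      simp only [Set.mem_ofPred_eq] at hω ⊢
      rw [hω]
      exact ENat.natCast_lt_top t
  have hsplit : ∀ᵐ ω ∂μ, (1 + ∑ w ∈ Finset.univ \ {a, b}, θ (f w (ω w)) (M ω))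
      = ∑' t : ℕ, (M ⁻¹' {((t + 1 : ℕ) : ℕ∞)}).indicator
        (fun ω => 1 + ∑ w ∈ Finset.univ \ {a, b}, θ (f w (ω w)) ((t + 1 : ℕ) : ℕ∞)) ω := by
    filter_upwards [htop] with ω hω
    obtain ⟨m, hm⟩ := ENat.ne_top_iff_exists.1 hω
    have hm1 : 1 ≤ m := by
      have : (1 : ℕ∞) ≤ M ω := le_min (hf1 _ _) (hf1 _ _)
      rw [← hm] at this
      exact_mod_cast this
    rw [tsum_eq_single (m - 1)]
    · rw [Set.indicator_of_mem, Nat.sub_add_cancel hm1, hm]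
      simp [Nat.sub_add_cancel hm1, hm]
    · intro t ht
      rw [Set.indicator_of_notMem]
      simp only [Set.mem_preimage, Set.mem_singleton_iff, ← hm]
      intro h
      have : m = t + 1 := by exact_mod_cast h
      omega
  have hθm : ∀ (w : V) (t : ℕ∞), Measurable fun ω : V → A => θ (f w (ω w)) t := fun w t =>
    (Measurable.of_discrete (f := fun s => θ s t)).comp (hfm w)
  have hE : ∀ t : ℕ, MeasurableSet (M ⁻¹' {((t + 1 : ℕ) : ℕ∞)}) := fun t =>
    hMm MeasurableSet.of_discrete
  have hsm : ∀ t : ℕ, Measurable ((M ⁻¹' {((t + 1 : ℕ) : ℕ∞)}).indicator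
      fun ω => 1 + ∑ w ∈ Finset.univ \ {a, b}, θ (f w (ω w)) ((t + 1 : ℕ) : ℕ∞)) := fun t =>
    (measurable_const.add (Finset.measurable_sum _ fun w _ => hθm w _)).indicator (hE t)
  rw [lintegral_congr_ae hsplit, lintegral_tsum fun t => (hsm t).aemeasurable]
  have hterm : ∀ t : ℕ, ∫⁻ ω, (M ⁻¹' {((t + 1 : ℕ) : ℕ∞)}).indicator
        (fun ω => 1 + ∑ w ∈ Finset.univ \ {a, b}, θ (f w (ω w)) ((t + 1 : ℕ) : ℕ∞)) ω ∂μ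
      ≤ ENNReal.ofReal ((S t - S (t + 1)) * c (t + 1)) := by
    intro t
    rw [ENNReal.ofReal_mul (by linarith [hSanti t]), ← heq t]
    refine le_trans (le_of_eq ?_) (mul_le_mul le_rfl (hc (t + 1) (by omega)) zero_le zero_le)
    have e1 : ∀ ω, (M ⁻¹' {((t + 1 : ℕ) : ℕ∞)}).indicator
        (fun ω => 1 + ∑ w ∈ Finset.univ \ {a, b}, θ (f w (ω w)) ((t + 1 : ℕ) : ℕ∞)) ω
        = (M ⁻¹' {((t + 1 : ℕ) : ℕ∞)}).indicator 1 ω + ∑ w ∈ Finset.univ \ {a, b},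
          (M ⁻¹' {((t + 1 : ℕ) : ℕ∞)}).indicator 1 ω * θ (f w (ω w)) ((t + 1 : ℕ) : ℕ∞) := by
      intro ω
      by_cases h : ω ∈ M ⁻¹' {((t + 1 : ℕ) : ℕ∞)}
      · simp only [Set.indicator_of_mem h, Pi.one_apply, one_mul]
      · simp only [Set.indicator_of_notMem h, zero_mul, Finset.sum_const_zero, add_zero]
    simp_rw [e1]
    have hi1 : Measurable ((M ⁻¹' {((t + 1 : ℕ) : ℕ∞)}).indicator (1 : (V → A) → ℝ≥0∞)) :=
      measurable_one.indicator (hE t)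
    have hp : ∀ w : V, Measurable fun ω => (M ⁻¹' {((t + 1 : ℕ) : ℕ∞)}).indicator
        (1 : (V → A) → ℝ≥0∞) ω * θ (f w (ω w)) ((t + 1 : ℕ) : ℕ∞) := fun w => hi1.mul (hθm w _)
    rw [lintegral_add_left hi1, lintegral_finsetSum _ fun w _ => hp w,
      lintegral_indicator_one (hE t), mul_add, mul_one, Finset.mul_sum]
    congr 1
    refine Finset.sum_congr rfl fun w hw => ?_
    simp only [Finset.mem_sdiff, Finset.mem_univ, Finset.mem_insert, Finset.mem_singleton, not_or,
      true_and] at hw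
    -- The slot of a third vertex `w` is independent of the pair `a`, `b`. So the event that the
    -- edge has slot `t + 1` factors out of the expected delay caused by `w`.
    have hind := (iIndepFun_pi (μ := fun _ : V => ν) (X := f)
      fun v => (hf v).aemeasurable).indepFun_prodMk hfm a b w (Ne.symm hw.1) (Ne.symm hw.2)
    have hind2 := hind.comp (φ := fun p : ℕ∞ × ℕ∞ =>
      if min p.1 p.2 = ((t + 1 : ℕ) : ℕ∞) then (1 : ℝ≥0∞) else 0)
      (ψ := fun s => θ s ((t + 1 : ℕ) : ℕ∞)) Measurable.of_discrete Measurable.of_discrete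
    have e2 : (M ⁻¹' {((t + 1 : ℕ) : ℕ∞)}).indicator (1 : (V → A) → ℝ≥0∞)
        = (fun p : ℕ∞ × ℕ∞ => if min p.1 p.2 = ((t + 1 : ℕ) : ℕ∞) then (1 : ℝ≥0∞) else 0) ∘
          fun ω => (f a (ω a), f b (ω b)) := by
      ext ω
      simp [Set.indicator_apply, hM]
    rw [← e2] at hind2
    rw [lintegral_mul_eq_lintegral_mul_lintegral_of_indepFun'' hi1.aemeasurable
      (hθm w _).aemeasurable hind2, lintegral_indicator_one (hE t)]
    congr 1
    exact (measurePreserving_eval (fun _ : V => ν) w).lintegral_comp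
      (f := fun x => θ (f w x) ((t + 1 : ℕ) : ℕ∞))
      ((Measurable.of_discrete (f := fun s => θ s _)).comp (hf w))
  have hc0 : ∀ t : ℕ, 1 ≤ t → 0 ≤ c t := by
    intro t ht
    by_contra h
    have := hc t ht
    rw [ENNReal.ofReal_of_nonpos (by linarith)] at this
    simp at this
  refine ENNReal.tsum_le_of_sum_range_le fun T => ?_
  calc _ ≤ ∑ t ∈ Finset.range T, ENNReal.ofReal ((S t - S (t + 1)) * c (t + 1)) :=
        Finset.sum_le_sum fun t _ => hterm t
    _ = ENNReal.ofReal (∑ t ∈ Finset.range T, (S t - S (t + 1)) * c (t + 1)) :=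
        (ENNReal.ofReal_sum_of_nonneg fun t _ =>
          mul_nonneg (by linarith [hSanti t]) (hc0 _ (by omega))).symm
    _ ≤ _ := ENNReal.ofReal_le_ofReal (hR T)

end Independent

end MSVC

namespace MSVC

/-! ### Kernel rounding -/

section KernelRounding

open MeasureTheory ProbabilityTheory Filter Topology

variable {V : Type*}

/-- The accumulated transform: `v` is tentatively scheduled by time `t` iff `α_v` is at most this. -/
noncomputable def accumulated (x : V → ℕ → ℝ≥0) (v : V) (t : ℕ) : ℝ≥0 :=
  ∑ t' ∈ Finset.Icc 1 t, kernelTransform x v t'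

lemma accumulated_zero (x : V → ℕ → ℝ≥0) (v : V) : accumulated x v 0 = 0 := by
  simp [accumulated]

lemma accumulated_mono (x : V → ℕ → ℝ≥0) (v : V) : Monotone (accumulated x v) := fun _ _ h =>
  Finset.sum_le_sum_of_subset (Finset.Icc_subset_Icc le_rfl h)

/-- The kernel telescopes in `t`: `K(t,i) = 2 (survival (t-1) i - survival t i)`. -/
lemma accumulated_eq (x : V → ℕ → ℝ≥0) (v : V) (t : ℕ) :
    (accumulated x v t : ℝ) = ∑ i ∈ Finset.Icc 1 t, 2 * x v i * (1 - survival t i) := by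
  induction t with
  | zero => simp [accumulated]
  | succ t ih =>
    unfold accumulated at ih ⊢
    rw [Finset.sum_Icc_succ_top (by omega), NNReal.coe_add, ih, kernelTransform]
    -- Mass in slot `t + 1` has released nothing by time `t`, so the summation range can be extended
    -- to match.
    have h0 : ∑ i ∈ Finset.Icc 1 t, 2 * (x v i : ℝ) * (1 - survival t i)
        = ∑ i ∈ Finset.Icc 1 (t + 1), 2 * (x v i : ℝ) * (1 - survival t i) := by
      rw [Finset.sum_Icc_succ_top (by omega), survival_of_lt (t := t) (i := t + 1) (by omega)]
      ring
    rw [h0]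
    push_cast
    rw [← Finset.sum_add_distrib]
    refine Finset.sum_congr rfl fun i hi => ?_
    simp only [Finset.mem_Icc] at hi
    rw [kernel, if_pos hi.2, survival_of_le hi.2]
    rcases Nat.lt_or_ge t i with h | h
    · rw [survival_of_lt h]
      have : i = t + 1 := by omega
      subst this
      push_cast
      field_simp
      ring
    · rw [survival_of_le h]
      push_cast
      field_simp
      ring

lemma sum_one_sub_survival (t : ℕ) :
    ∑ i ∈ Finset.Icc 1 t, (1 - survival t i) = 2 / 3 * t := by
  have h : ∀ s : ℕ, ∑ i ∈ Finset.Icc 1 s, ((i : ℝ) * (i + 1)) = s * (s + 1) * (s + 2) / 3 := by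
    intro s
    induction s with
    | zero => simp
    | succ s ih =>
      rw [Finset.sum_Icc_succ_top (by omega), ih]
      push_cast
      ring
  rw [Finset.sum_sub_distrib, Finset.sum_congr rfl fun i hi =>
    survival_of_le (Finset.mem_Icc.1 hi).2, ← Finset.sum_div, h]
  simp
  field_simp
  ring

/-- One of the two factors `4/3`: the doubled mass of the first `t` slots, of which the kernel has
released the fraction `2/3` in total if the slots are full. -/
lemma sum_accumulated_le [Fintype V] {x : V → ℕ → ℝ≥0} (hx : ∀ t, 1 ≤ t → ∑ v, x v t ≤ 1)
    (t : ℕ) : ∑ v, (accumulated x v t : ℝ) ≤ 4 / 3 * t := by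
  simp_rw [accumulated_eq]
  rw [Finset.sum_comm]
  calc _ ≤ ∑ i ∈ Finset.Icc 1 t, 2 * (1 - survival t i) := by
        refine Finset.sum_le_sum fun i hi => ?_
        have h1 : (∑ v, (x v i : ℝ)) ≤ 1 := by
          exact_mod_cast hx i (Finset.mem_Icc.1 hi).1
        rw [← Finset.sum_mul, ← Finset.mul_sum]
        have := survival_le_one t i
        nlinarith
    _ = _ := by rw [← Finset.mul_sum, sum_one_sub_survival]; ring

/-- The tentative slot of `v` as a function of its threshold. -/
noncomputable def tentativeSlot (x : V → ℕ → ℝ≥0) (v : V) (a : ℝ) : ℕ∞ :=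
  sInf {s : ℕ∞ | ∃ t : ℕ, 1 ≤ t ∧ a ≤ (accumulated x v t : ℝ) ∧ s = t}

lemma one_le_tentativeSlot (x : V → ℕ → ℝ≥0) (v : V) (a : ℝ) : 1 ≤ tentativeSlot x v a := by
  refine le_sInf ?_
  rintro s ⟨t, ht, -, rfl⟩
  exact_mod_cast ht

lemma tentativeSlot_le_iff (x : V → ℕ → ℝ≥0) (v : V) (a : ℝ) {t : ℕ} (ht : 1 ≤ t) :
    tentativeSlot x v a ≤ t ↔ a ≤ accumulated x v t := by
  constructor
  · intro h
    have hne : {s : ℕ∞ | ∃ t : ℕ, 1 ≤ t ∧ a ≤ (accumulated x v t : ℝ) ∧ s = t}.Nonempty := by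
      by_contra hc
      rw [Set.not_nonempty_iff_eq_empty] at hc
      rw [tentativeSlot, hc, sInf_empty] at h
      exact absurd h (by simp)
    obtain ⟨t', -, h2, h3⟩ := csInf_mem hne
    have h4 : t' ≤ t := by
      have h' := h
      rw [tentativeSlot, h3] at h'
      exact_mod_cast h'
    exact h2.trans (by exact_mod_cast accumulated_mono x v h4)
  · intro h
    exact sInf_le ⟨t, ht, h, rfl⟩

lemma measurable_tentativeSlot (x : V → ℕ → ℝ≥0) (v : V) : Measurable (tentativeSlot x v) := by
  have hIic : ∀ t : ℕ, MeasurableSet {a | tentativeSlot x v a ≤ t} := by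
    intro t
    rcases Nat.eq_zero_or_pos t with rfl | ht
    · convert MeasurableSet.empty
      ext a
      simp only [Set.mem_ofPred_eq, Set.mem_empty_iff_false, iff_false, not_le]
      exact lt_of_lt_of_le (by simp) (one_le_tentativeSlot x v a)
    · convert measurableSet_Iic (a := (accumulated x v t : ℝ))
      ext a
      exact tentativeSlot_le_iff x v a ht
  refine ENat.measurable_iff.2 fun t => ?_
  rcases Nat.eq_zero_or_pos t with rfl | ht
  · convert hIic 0
    ext a
    simp
  · convert (hIic t).diff (hIic (t - 1))
    ext a
    simp only [Set.mem_preimage, Set.mem_singleton_iff, Set.mem_sdiff, Set.mem_ofPred_eq, not_le]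
    constructor
    · intro h
      rw [h]
      exact ⟨le_rfl, by norm_cast; omega⟩
    · rintro ⟨h1, h2⟩
      refine le_antisymm h1 ?_
      have := Order.add_one_le_of_lt h2
      rwa [← Nat.cast_add_one, Nat.sub_add_cancel ht] at this

/-- The uniform distribution on `[0, 1]`. -/
noncomputable abbrev uniform01 : Measure ℝ := volume.restrict (Set.Icc (0 : ℝ) 1)

instance : IsProbabilityMeasure uniform01 := ⟨by simp [uniform01]⟩

lemma uniform01_gt (x : V → ℕ → ℝ≥0) (v : V) (t : ℕ) :
    uniform01.real {a | (t : ℕ∞) < tentativeSlot x v a} = max 0 (1 - (accumulated x v t : ℝ)) := by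
  rcases Nat.eq_zero_or_pos t with rfl | ht
  · rw [accumulated_zero]
    have : {a | ((0 : ℕ) : ℕ∞) < tentativeSlot x v a} = Set.univ := by
      ext a
      simpa using lt_of_lt_of_le one_pos (one_le_tentativeSlot x v a)
    rw [this]
    simp
  · have h1 : {a | (t : ℕ∞) < tentativeSlot x v a} = Set.Ioi (accumulated x v t : ℝ) := by
      ext a
      simp only [Set.mem_ofPred_eq, Set.mem_Ioi, ← not_le, tentativeSlot_le_iff x v a ht]
    rw [h1, measureReal_restrict_apply measurableSet_Ioi]
    have h2 : Set.Ioi (accumulated x v t : ℝ) ∩ Set.Icc 0 1 = Set.Ioc (accumulated x v t : ℝ) 1 := by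
      ext a
      simp only [Set.mem_inter_iff, Set.mem_Ioi, Set.mem_Icc, Set.mem_Ioc]
      have := (accumulated x v t).coe_nonneg
      constructor
      · rintro ⟨h, -, h'⟩; exact ⟨h, h'⟩
      · rintro ⟨h, h'⟩; exact ⟨h, this.trans h.le, h'⟩
    rw [h2, Measure.real, Real.volume_Ioc, ENNReal.toReal_ofReal']
    exact max_comm _ _

/-- With the value `1/2` for ties, the delay is the mean of the indicators of being placed by `t -
1` and by `t`. -/
lemma lintegral_delay_uniform01 (x : V → ℕ → ℝ≥0) (v : V) {t : ℕ} (ht : 1 ≤ t) :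
    ∫⁻ a, delay (tentativeSlot x v a) t ∂uniform01
      ≤ ENNReal.ofReal ((accumulated x v (t - 1) + accumulated x v t) / 2) := by
  have hm : ∀ s : ℕ, MeasurableSet {a | (s : ℕ∞) < tentativeSlot x v a} := fun s =>
    (measurable_tentativeSlot x v) (MeasurableSet.of_discrete (s := {r : ℕ∞ | (s : ℕ∞) < r}))
  have hle : ∀ s : ℕ, uniform01 {a | (s : ℕ∞) < tentativeSlot x v a}ᶜ ≤
      ENNReal.ofReal (accumulated x v s) := by
    intro s
    rw [prob_compl_eq_one_sub (hm s), ← ofReal_measureReal, uniform01_gt,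
      ← ENNReal.ofReal_one, ← ENNReal.ofReal_sub _ (le_max_left _ _)]
    exact ENNReal.ofReal_le_ofReal (by linarith [le_max_right 0 (1 - (accumulated x v s : ℝ))])
  have hpt : ∀ a, delay (tentativeSlot x v a) t = 1 / 2 *
      ({a | ((t - 1 : ℕ) : ℕ∞) < tentativeSlot x v a}ᶜ.indicator 1 a +
        {a | (t : ℕ∞) < tentativeSlot x v a}ᶜ.indicator 1 a) := by
    intro a
    have hiff : tentativeSlot x v a ≤ ((t - 1 : ℕ) : ℕ∞) ↔ tentativeSlot x v a < t := by
      constructor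
      · intro h
        exact lt_of_le_of_lt h (by norm_cast; omega)
      · intro h
        obtain ⟨m, hm⟩ := ENat.ne_top_iff_exists.1 (ne_top_of_lt h)
        rw [← hm] at h ⊢
        have h' : m < t := by exact_mod_cast h
        norm_cast
        omega
    have h2 : (2 : ℝ≥0∞)⁻¹ * (1 + 1) = 1 := by
      rw [one_add_one_eq_two]
      exact ENNReal.inv_mul_cancel (by simp) (by simp)
    unfold delay
    simp only [Set.indicator_apply, Set.mem_compl_iff, Set.mem_ofPred_eq, not_lt, hiff,
      Pi.one_apply]
    split_ifs with h3 h4 h5 h6 h7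
    · simp [h2]
    · exact absurd h3.le h4
    · simp
    · exact absurd h5.le h6
    · exact absurd (lt_of_le_of_ne h7 h5) h3
    · simp
  simp_rw [hpt]
  have hi : ∀ s : ℕ, Measurable fun a =>
      {a | (s : ℕ∞) < tentativeSlot x v a}ᶜ.indicator (1 : ℝ → ℝ≥0∞) a := fun s =>
    measurable_one.indicator (hm s).compl
  have hi2 : Measurable fun a =>
      {a | ((t - 1 : ℕ) : ℕ∞) < tentativeSlot x v a}ᶜ.indicator (1 : ℝ → ℝ≥0∞) a +
        {a | (t : ℕ∞) < tentativeSlot x v a}ᶜ.indicator (1 : ℝ → ℝ≥0∞) a := (hi _).add (hi _)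
  rw [lintegral_const_mul _ hi2, lintegral_add_left (hi _), lintegral_indicator_one (hm _).compl,
    lintegral_indicator_one (hm _).compl]
  calc _ ≤ 1 / 2 * (ENNReal.ofReal (accumulated x v (t - 1)) + ENNReal.ofReal (accumulated x v t)) :=
        by gcongr <;> exact hle _
    _ = _ := by
      rw [← ENNReal.ofReal_add NNReal.zero_le_coe NNReal.zero_le_coe, div_eq_inv_mul,
        ENNReal.ofReal_mul (by norm_num), ENNReal.ofReal_inv_of_pos (by norm_num)]
      simp

/-- AM-GM for the clipped factors. It replaces the separate progress of two endpoints by their sum,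
the only quantity the LP constraint of an edge controls. -/
lemma mul_max_le_sq (A B : ℝ) :
    max 0 (1 - A) * max 0 (1 - B) ≤ (max 0 (1 - (A + B) / 2)) ^ 2 := by
  rcases le_total 1 A with h | h
  · rw [max_eq_left (by linarith), zero_mul]; positivity
  rcases le_total 1 B with h' | h'
  · rw [max_eq_left (a := 0) (b := 1 - B) (by linarith), mul_zero]; positivity
  rw [max_eq_right (by linarith), max_eq_right (by linarith), max_eq_right (by linarith)]
  nlinarith [sq_nonneg (A - B)]

/-- The endpoints hold at least as much released mass as the probability that the edge is already
hit. That mass belongs to no third vertex and can be subtracted from the delay. -/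
lemma one_sub_mul_max_le (A B : ℝ) (hA : 0 ≤ A) (hB : 0 ≤ B) :
    1 - max 0 (1 - A) * max 0 (1 - B) ≤ A + B := by
  rcases le_total 1 A with h | h
  · rw [max_eq_left (by linarith), zero_mul]; linarith
  rcases le_total 1 B with h' | h'
  · rw [max_eq_left (a := 0) (b := 1 - B) (by linarith), mul_zero]; linarith
  rw [max_eq_right (by linarith), max_eq_right (by linarith)]
  nlinarith [mul_nonneg hA hB]

/-- Abel summation turns the linear part into the sum of `S`, and the `S` terms telescope to a
difference of squares. The constants leave `1/2 - 2/3 < 0`, so no additive error remains. -/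
lemma summation_by_parts_le {S : ℕ → ℝ} (h0 : S 0 = 1) (hS : ∀ t, 0 ≤ S t) (T : ℕ) :
    ∑ t ∈ Finset.range T, (S t - S (t + 1)) *
      (4 / 3 * ((t + 1 : ℕ) : ℝ) - 2 / 3 + (S t + S (t + 1)) / 2)
      ≤ 4 / 3 * ∑ t ∈ Finset.range T, S t := by
  have key : ∑ t ∈ Finset.range T, (S t - S (t + 1)) *
      (4 / 3 * ((t + 1 : ℕ) : ℝ) - 2 / 3 + (S t + S (t + 1)) / 2)
      = 4 / 3 * ∑ t ∈ Finset.range T, S t - 4 / 3 * T * S T - 2 / 3 * (1 - S T)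
        + 1 / 2 * (1 - S T ^ 2) := by
    induction T with
    | zero => simp [h0]
    | succ T ih =>
      rw [Finset.sum_range_succ, ih, Finset.sum_range_succ]
      push_cast
      ring
  rw [key]
  rcases Nat.eq_zero_or_pos T with rfl | hT
  · simp [h0]
  · have : (1 : ℝ) ≤ T := by exact_mod_cast hT
    have := hS T
    nlinarith [sq_nonneg (S T)]

open Classical in
lemma uncovered_le [Fintype V] {G : SimpleGraph V} {x : V → ℕ → ℝ≥0} {u : Sym2 V → ℕ → ℝ≥0}
    (h : LPFeasible G x u) {a b : V} (hab : G.Adj a b) {t : ℕ} (ht : 1 ≤ t) :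
    uncovered (fun i => (x a i : ℝ) + x b i) t ≤ u s(a, b) t := by
  have h1 := h.covering s(a, b) hab t ht
  have e : (Finset.univ.filter fun v => v ∈ s(a, b)) = {a, b} := by ext v; simp
  rw [e, Finset.sum_pair hab.ne] at h1
  have h2 : (1 : ℝ) ≤ u s(a, b) t + (∑ i ∈ Finset.Ico 1 t, (x a i : ℝ)
      + ∑ i ∈ Finset.Ico 1 t, (x b i : ℝ)) := by exact_mod_cast h1
  unfold uncovered
  rw [Finset.sum_add_distrib]
  exact max_le NNReal.zero_le_coe (by linarith)

open Classical in
lemma lintegral_edge_le [Fintype V] {G : SimpleGraph V} {x : V → ℕ → ℝ≥0}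
    {u : Sym2 V → ℕ → ℝ≥0} (h : LPFeasible G x u) {a b : V} (hab : G.Adj a b) :
    ∫⁻ α, (1 + ∑ w ∈ Finset.univ \ {a, b}, delay (tentative x α w)
      (min (tentative x α a) (tentative x α b))) ∂(Measure.pi fun _ : V => uniform01)
      ≤ 16 / 9 * ∑' t : ℕ, (u s(a, b) (t + 1) : ℝ≥0∞) := by
  by_cases htop : ∑' t : ℕ, (u s(a, b) (t + 1) : ℝ≥0∞) = ⊤
  · rw [htop, ENNReal.mul_top (by simp)]
    exact le_top
  set U := (∑' t : ℕ, (u s(a, b) (t + 1) : ℝ≥0∞)).toReal with hU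
  set S : ℕ → ℝ := fun t => max 0 (1 - (accumulated x a t : ℝ)) *
    max 0 (1 - (accumulated x b t : ℝ)) with hS
  have hS0 : ∀ t, 0 ≤ S t := fun t => mul_nonneg (le_max_left _ _) (le_max_left _ _)
  have hsumU : ∀ T : ℕ, ∑ t ∈ Finset.Icc 1 (T + 1), uncovered (fun i => (x a i : ℝ) + x b i) t
      ≤ U := by
    intro T
    calc _ ≤ ∑ t ∈ Finset.Icc 1 (T + 1), (u s(a, b) t : ℝ) :=
          Finset.sum_le_sum fun t ht => uncovered_le h hab (Finset.mem_Icc.1 ht).1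
      _ = ∑ t ∈ Finset.range (T + 1), (u s(a, b) (t + 1) : ℝ) := by
          rw [Finset.range_eq_Ico, Finset.sum_Ico_add' (fun t => (u s(a, b) t : ℝ)) 0 (T + 1) 1]
          rfl
      _ ≤ U := by
          rw [hU]
          refine (ENNReal.ofReal_le_iff_le_toReal htop).1 ?_
          rw [ENNReal.ofReal_sum_of_nonneg fun _ _ => NNReal.zero_le_coe]
          simp_rw [ENNReal.ofReal_coe_nnreal]
          exact ENNReal.sum_le_tsum _
  have hsumS : ∀ T, ∑ t ∈ Finset.range T, S t ≤ 4 / 3 * U := by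
    intro T
    refine le_trans (Finset.sum_le_sum fun t _ => ?_) ((sum_sq_le_sum_uncovered
      (fun i => (x a i : ℝ) + x b i) (fun i => by positivity) T).trans
      (by linarith [hsumU T]))
    refine (mul_max_le_sq _ _).trans (le_of_eq ?_)
    rw [accumulated_eq, accumulated_eq, ← Finset.sum_add_distrib, Finset.sum_div]
    congr 3
    exact Finset.sum_congr rfl fun i _ => by ring
  have hlim : Tendsto S atTop (𝓝 0) := (summable_of_sum_range_le hS0 hsumS).tendsto_atTop_zero
  -- The delay by third vertices placed by time `s` is at most `4/3 s - 1 + S s`. The bound averages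
  -- this over `s = t - 1` and `s = t` and adds 1 for the covering vertex itself. The two factors
  -- `4/3` give `R`.
  have key := lintegral_delay_le uniform01 (measurable_tentativeSlot x)
    (one_le_tentativeSlot x) hab.ne delay (S := S)
    (fun t => by rw [uniform01_gt, uniform01_gt]) hlim
    (fun t => 4 / 3 * (t : ℝ) - 2 / 3 + (S (t - 1) + S t) / 2) ?_ (R := 16 / 9 * U) ?_
  · refine key.trans (le_of_eq ?_)
    rw [ENNReal.ofReal_mul (by norm_num), hU, ENNReal.ofReal_toReal htop,
      ENNReal.ofReal_div_of_pos (by norm_num)]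
    simp
  · intro t ht
    have hacc : ∀ v s, (0 : ℝ) ≤ accumulated x v s := fun _ _ => NNReal.zero_le_coe
    calc _ ≤ 1 + ∑ w ∈ Finset.univ \ {a, b},
          ENNReal.ofReal ((accumulated x w (t - 1) + accumulated x w t) / 2) := by
          gcongr
          exact lintegral_delay_uniform01 x _ ht
      _ = ENNReal.ofReal (1 + ∑ w ∈ Finset.univ \ {a, b},
          ((accumulated x w (t - 1) + accumulated x w t) / 2 : ℝ)) := by
          rw [ENNReal.ofReal_add one_pos.le (Finset.sum_nonneg fun w _ => by positivity),
            ENNReal.ofReal_sum_of_nonneg fun w _ => by positivity, ENNReal.ofReal_one]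
      _ ≤ _ := by
          refine ENNReal.ofReal_le_ofReal ?_
          have htot : ∀ s : ℕ, ∑ w ∈ Finset.univ \ {a, b}, (accumulated x w s : ℝ) ≤
              4 / 3 * s - 1 + S s := by
            intro s
            have h1 := sum_accumulated_le h.packing s
            rw [← Finset.sum_sdiff (Finset.subset_univ {a, b}), Finset.sum_pair hab.ne] at h1
            have h2 := one_sub_mul_max_le _ _ (hacc a s) (hacc b s)
            simp only [hS]
            linarith
          rw [← Finset.sum_div, Finset.sum_add_distrib]
          have h1 := htot t
          have h2 := htot (t - 1)
          rw [Nat.cast_sub ht] at h2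
          push_cast at h2
          linarith
  · intro T
    have h1 := summation_by_parts_le (S := S) (by simp [hS, accumulated_zero]) hS0 T
    have h2 := hsumS T
    simp only [Nat.add_sub_cancel]
    linarith

/-- The tentative slots take values in a countable discrete space, so any function of them is
measurable. -/
lemma measurable_tentative [Fintype V] {β : Type*} [MeasurableSpace β] (x : V → ℕ → ℝ≥0)
    (g : (V → ℕ∞) → β) : Measurable fun α => g (tentative x α) :=
  (Measurable.of_discrete (f := g)).comp
    (measurable_pi_lambda _ fun v => (measurable_tentativeSlot x v).comp (measurable_pi_apply v))

lemma measurable_tieAverage [Fintype V] (G : SimpleGraph V) (x : V → ℕ → ℝ≥0) :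
    Measurable (tieAverage G x) := by
  classical
  exact measurable_tentative x fun τ =>
    (∑ ρ : V ≃ Fin (Fintype.card V), (cost G (orderBy τ ρ) : ℝ≥0∞)) /
      (Nat.factorial (Fintype.card V) : ℝ≥0∞)

theorem expectedCost_le [Fintype V] {G : SimpleGraph V} {x : V → ℕ → ℝ≥0}
    {u : Sym2 V → ℕ → ℝ≥0} (h : LPFeasible G x u) :
    expectedCost G x ≤ 16 / 9 * lpCost G u := by
  classical
  unfold expectedCost lpCost
  simp_rw [tieAverage_eq]
  rw [lintegral_finsetSum _ fun e _ => measurable_tentative x fun τ =>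
    (∑ ρ : V ≃ Fin (Fintype.card V), (coverTime (orderBy τ ρ) e : ℝ≥0∞)) /
      (Nat.factorial (Fintype.card V) : ℝ≥0∞), Finset.mul_sum]
  refine Finset.sum_le_sum fun e he => ?_
  induction e using Sym2.ind with
  | _ a b =>
    have hab : G.Adj a b := by simpa using he
    refine le_trans (lintegral_mono fun α => ?_) (lintegral_edge_le h hab)
    convert sum_coverTime_orderBy_le (tentative x α) hab.ne

lemma opt_le_tieAverage [Fintype V] (G : SimpleGraph V) (x : V → ℕ → ℝ≥0) (α : V → ℝ) :
    (opt G : ℝ≥0∞) ≤ tieAverage G x α := by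
  classical
  unfold tieAverage
  rw [ENNReal.le_div_iff_mul_le (by left; exact_mod_cast (Nat.factorial_pos _).ne')
    (by left; exact ENNReal.natCast_ne_top _)]
  calc (opt G : ℝ≥0∞) * (Nat.factorial (Fintype.card V) : ℝ≥0∞)
      = ∑ ρ : V ≃ Fin (Fintype.card V), (opt G : ℝ≥0∞) := by
        rw [Finset.sum_const, Finset.card_univ, Fintype.card_equiv (Fintype.equivFin V),
          nsmul_eq_mul, mul_comm]
    _ ≤ _ := Finset.sum_le_sum fun ρ _ => by
        exact_mod_cast opt_le_cost G (isSchedule_orderBy (tentative x α) ρ)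

lemma opt_le_expectedCost [Fintype V] (G : SimpleGraph V) (x : V → ℕ → ℝ≥0) :
    (opt G : ℝ≥0∞) ≤ expectedCost G x := by
  unfold expectedCost
  calc (opt G : ℝ≥0∞) = ∫⁻ _, (opt G : ℝ≥0∞) ∂(Measure.pi fun _ : V => uniform01) := by simp
    _ ≤ _ := lintegral_mono fun α => opt_le_tieAverage G x α

end KernelRounding

/-! ### The LP optimum -/

section Optimum

open Topology

variable {V : Type*} [Fintype V]

open Classical in
/-- The least feasible `u` for a given `x`. -/
noncomputable def slack (x : V → ℕ → ℝ≥0) (e : Sym2 V) (t : ℕ) : ℝ≥0 :=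
  1 - ∑ v with v ∈ e, ∑ t' ∈ Finset.Ico 1 t, x v t'

lemma lpFeasible_slack (G : SimpleGraph V) {x : V → ℕ → ℝ≥0}
    (hx : ∀ t, 1 ≤ t → ∑ v, x v t ≤ 1) : LPFeasible G x (slack x) :=
  ⟨hx, fun _ _ _ _ => le_tsub_add⟩

lemma lpCost_mono (G : SimpleGraph V) {u u' : Sym2 V → ℕ → ℝ≥0}
    (h : ∀ e ∈ G.edgeSet, ∀ t, 1 ≤ t → u e t ≤ u' e t) : lpCost G u ≤ lpCost G u' := by
  classical
  exact Finset.sum_le_sum fun e he => ENNReal.tsum_le_tsum fun t => by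
    exact_mod_cast h e (by simpa using he) (t + 1) (by omega)

/-- For fixed `x` the best `u` is `slack x`. The cost is then a sum of continuous non-negative
terms, hence lower semicontinuous, and the packing constraints cut a closed set out of a product of
unit intervals, which is compact. -/
theorem exists_isLPOptimum (G : SimpleGraph V) : ∃ x u, IsLPOptimum G x u := by
  classical
  let K : Set (V → ℕ → ℝ≥0) := (Set.univ.pi fun _ => Set.univ.pi fun _ => Set.Icc 0 1) ∩
    {x | ∀ t, 1 ≤ t → ∑ v, x v t ≤ 1}
  have hK : IsCompact K := by
    refine (isCompact_univ_pi fun _ => isCompact_univ_pi fun _ => isCompact_Icc).inter_right ?_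
    simp only [Set.ofPred_forall]
    exact isClosed_iInter fun t => isClosed_iInter fun _ =>
      isClosed_le (by fun_prop) continuous_const
  have hne : K.Nonempty := ⟨fun _ _ => 0, fun _ _ _ _ => by simp, fun t _ => by simp⟩
  have hcont : ∀ e t, Continuous fun x : V → ℕ → ℝ≥0 => slack x e t := fun e t =>
    continuous_const.sub (by fun_prop)
  have hlsc : LowerSemicontinuous fun x : V → ℕ → ℝ≥0 => lpCost G (slack x) :=
    lowerSemicontinuous_sum fun e _ => lowerSemicontinuous_tsum fun t =>
      (ENNReal.continuous_coe.comp (hcont e (t + 1))).lowerSemicontinuous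
  obtain ⟨x, hx, hmin⟩ := (hlsc.lowerSemicontinuousOn K).exists_isMinOn hne hK
  refine ⟨x, slack x, lpFeasible_slack G hx.2, fun x' u' h' => ?_⟩
  -- Slot 0 is unconstrained and never used; clearing it moves `x'` into the compact set without
  -- affecting the slack in slots `t ≥ 1`.
  let y : V → ℕ → ℝ≥0 := fun v t => if t = 0 then 0 else x' v t
  have hy : ∀ t, 1 ≤ t → ∑ v, y v t ≤ 1 := fun t ht => by
    have : t ≠ 0 := by omega
    simpa [y, this] using h'.packing t ht
  have hyK : y ∈ K := by
    refine ⟨fun v _ t _ => ⟨zero_le, ?_⟩, hy⟩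
    rcases Nat.eq_zero_or_pos t with rfl | ht
    · simp [y]
    · exact (Finset.single_le_sum (f := fun v => y v t) (fun _ _ => zero_le)
        (Finset.mem_univ v)).trans (hy t ht)
  refine (hmin hyK).trans (lpCost_mono G fun e he t ht => ?_)
  refine tsub_le_iff_right.2 ((h'.covering e he t ht).trans (le_of_eq ?_))
  congr 1
  refine Finset.sum_congr rfl fun v _ => Finset.sum_congr rfl fun s hs => ?_
  have : s ≠ 0 := by have := (Finset.mem_Ico.1 hs).1; omega
  simp [y, this]

lemma lpValue_le (G : SimpleGraph V) {x : V → ℕ → ℝ≥0} {u : Sym2 V → ℕ → ℝ≥0}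
    (h : LPFeasible G x u) : lpValue G ≤ lpCost G u :=
  iInf_le_of_le x (iInf_le_of_le u (iInf_le_of_le h le_rfl))

lemma IsLPOptimum.lpCost_eq {G : SimpleGraph V} {x : V → ℕ → ℝ≥0} {u : Sym2 V → ℕ → ℝ≥0}
    (h : IsLPOptimum G x u) : lpCost G u = lpValue G :=
  le_antisymm (le_iInf fun x' => le_iInf fun u' => le_iInf fun h' => h.2 x' u' h')
    (lpValue_le G h.1)

theorem lpValue_le_opt (G : SimpleGraph V) : lpValue G ≤ (opt G : ℝ≥0∞) := by
  classical
  obtain ⟨s, hs, hcost⟩ := exists_cost_eq_opt G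
  let x : V → ℕ → ℝ≥0 := fun v t => if s v = t then 1 else 0
  -- An edge is still uncovered at the start of the slot that covers it, so `≤` makes the LP cost
  -- equal to the cover time.
  let u : Sym2 V → ℕ → ℝ≥0 := fun e t => if t ≤ coverTime s e then 1 else 0
  have hf : LPFeasible G x u := by
    refine ⟨fun t _ => ?_, fun e he t ht => ?_⟩
    · rw [← Finset.sum_filter, Finset.sum_const, nsmul_eq_mul, mul_one]
      have : (Finset.univ.filter fun v => s v = t).card ≤ 1 :=
        Finset.card_le_one.2 fun v hv w hw => hs.injective
          ((Finset.mem_filter.1 hv).2.trans (Finset.mem_filter.1 hw).2.symm)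
      exact_mod_cast this
    · rcases Nat.lt_or_ge (coverTime s e) t with h | h
      · obtain ⟨v, hv, hvs⟩ : coverTime s e ∈ {t : ℕ | ∃ v ∈ e, s v = t} := by
          induction e using Sym2.ind with
          | _ a b => exact Nat.sInf_mem ⟨s a, a, Sym2.mem_mk_left a b, rfl⟩
        calc (1 : ℝ≥0) = x v (s v) := by simp [x]
          _ ≤ ∑ t' ∈ Finset.Ico 1 t, x v t' :=
            Finset.single_le_sum (f := fun t' => x v t') (fun _ _ => zero_le)
              (Finset.mem_Ico.2 ⟨hs.one_le v, by omega⟩)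
          _ ≤ ∑ v with v ∈ e, ∑ t' ∈ Finset.Ico 1 t, x v t' :=
            Finset.single_le_sum (f := fun v => ∑ t' ∈ Finset.Ico 1 t, x v t')
              (fun _ _ => zero_le) (Finset.mem_filter.2 ⟨Finset.mem_univ v, hv⟩)
          _ ≤ _ := le_add_self
      · simp [u, h]
  refine (lpValue_le G hf).trans (le_of_eq ?_)
  rw [← hcost, lpCost, cost]
  push_cast
  refine Finset.sum_congr rfl fun e _ => ?_
  rw [tsum_eq_sum (s := Finset.range (coverTime s e))]
  · rw [Finset.sum_congr rfl (g := fun _ => (1 : ℝ≥0∞))]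
    · simp
    · intro t ht
      have : t + 1 ≤ coverTime s e := by have := Finset.mem_range.1 ht; omega
      simp [u, this]
  · intro t ht
    have : ¬ t + 1 ≤ coverTime s e := by rw [Finset.mem_range] at ht; omega
    simp [u, this]

theorem opt_le_lpValue (G : SimpleGraph V) : (opt G : ℝ≥0∞) ≤ 16 / 9 * lpValue G := by
  obtain ⟨x, u, h⟩ := exists_isLPOptimum G
  rw [← h.lpCost_eq]
  exact (opt_le_expectedCost G x).trans (expectedCost_le h.1)

theorem IsLPOptimum.expectedCost_le_opt {G : SimpleGraph V} {x : V → ℕ → ℝ≥0}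
    {u : Sym2 V → ℕ → ℝ≥0} (h : IsLPOptimum G x u) :
    expectedCost G x ≤ 16 / 9 * (opt G : ℝ≥0∞) :=
  (expectedCost_le h.1).trans (by
    rw [h.lpCost_eq]
    exact mul_le_mul le_rfl (lpValue_le_opt G) zero_le zero_le)

end Optimum

end MSVC

namespace MSVC

/-! ### Disjoint cliques: bounds for the optimum and the LP value -/

section Cliques

open Classical in
-- Sums over ordered pairs split into independent sums inside each clique; this is the source of the
-- factors 2 in the clique bounds.
lemma sum_sum_adj_eq {V M : Type*} [Fintype V] [Semiring M] (G : SimpleGraph V)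
    (g : Sym2 V → M) :
    ∑ a, ∑ b, (if G.Adj a b then g s(a, b) else 0) = 2 * ∑ e ∈ G.edgeFinset, g e := by
  rw [← Finset.sum_product', ← Finset.sum_filter, Finset.mul_sum,
    ← Finset.sum_fiberwise_of_maps_to (t := G.edgeFinset) (g := fun p : V × V => s(p.1, p.2))
      (fun p hp => by simpa using hp)]
  refine Finset.sum_congr rfl fun e he => ?_
  induction e using Sym2.ind with
  | _ a b =>
    have hab : G.Adj a b := by simpa using he
    have : (Finset.filter (fun p : V × V => s(p.1, p.2) = s(a, b))
        (Finset.filter (fun p : V × V => G.Adj p.1 p.2) (Finset.univ ×ˢ Finset.univ)))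
        = {(a, b), (b, a)} := by
      ext ⟨p, q⟩
      simp only [Finset.mem_filter, Finset.mem_product, Finset.mem_univ, true_and,
        Finset.mem_insert, Finset.mem_singleton, Sym2.eq_iff, Prod.mk.injEq]
      constructor
      · exact fun h => h.2
      · rintro (⟨rfl, rfl⟩ | ⟨rfl, rfl⟩)
        · exact ⟨hab, by simp⟩
        · exact ⟨hab.symm, by simp⟩
    rw [this, Finset.sum_pair (by simp [hab.ne])]
    simp only [Sym2.eq_swap (a := b) (b := a)]
    rw [two_mul]

variable {k : ℕ} {size : ℕ → ℕ}

open Classical in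
lemma sum_sum_disjointCliques {M : Type*} [AddCommMonoid M] (sz : Fin k → ℕ)
    (F : (Σ i : Fin k, Fin (sz i)) → (Σ i : Fin k, Fin (sz i)) → M) :
    ∑ a, ∑ b, (if (disjointCliques k sz).Adj a b then F a b else 0)
      = ∑ i, ∑ p, ∑ q ∈ Finset.univ.erase p, F ⟨i, p⟩ ⟨i, q⟩ := by
  rw [Fintype.sum_sigma]
  refine Finset.sum_congr rfl fun i _ => Finset.sum_congr rfl fun p _ => ?_
  rw [Fintype.sum_sigma, Finset.sum_eq_single i]
  · rw [← Finset.sum_filter]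
    refine Finset.sum_congr ?_ fun _ _ => rfl
    ext q
    simp [disjointCliques, eq_comm]
  · intro j _ hj
    exact Finset.sum_eq_zero fun q _ => if_neg fun h => hj h.1.symm
  · simp

open Classical in
/-- The number of ordered pairs of distinct vertices that are both in slots after `t`. -/
lemma sum_pairs_after {m : ℕ} (s : Fin m → ℕ) (t : ℕ) :
    (∑ p : Fin m, ∑ q ∈ Finset.univ.erase p, if t < s p ∧ t < s q then (1 : ℤ) else 0)
      = ((Finset.univ.filter fun p => t < s p).card : ℤ) *
        ((Finset.univ.filter fun p => t < s p).card - 1) := by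
  set A := Finset.univ.filter fun p => t < s p with hA
  have h1 : ∀ p : Fin m, (∑ q ∈ Finset.univ.erase p, if t < s p ∧ t < s q then (1 : ℤ) else 0)
      = if p ∈ A then ((A.card : ℤ) - 1) else 0 := by
    intro p
    by_cases hp : t < s p
    · have hpA : p ∈ A := by simp [hA, hp]
      have : (Finset.univ.erase p).filter (fun q => t < s q) = A.erase p := by
        ext q; simp [hA]
      simp only [hp, true_and, hpA, if_true]
      rw [← Finset.sum_filter, this, Finset.sum_const, Finset.card_erase_of_mem hpA, nsmul_eq_mul,
        mul_one, Nat.cast_sub (Finset.card_pos.2 ⟨p, hpA⟩)]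
      simp
    · have hpA : p ∉ A := by simp [hA, hp]
      simp [hp, hpA]
  simp_rw [h1]
  rw [← Finset.sum_filter, Finset.sum_const, nsmul_eq_mul]
  congr 2
  congr 1
  ext p
  simp

/-- The number of ordered pairs of adjacent vertices that are uncovered once the `q` largest
cliques have been cut down to the size of the next one. -/
def levelPairs (size : ℕ → ℕ) (k q : ℕ) : ℤ :=
  q * ((size q : ℤ) * (size q - 1)) + ∑ i ∈ Finset.Ico q k, (size i : ℤ) * (size i - 1)

/-- The number of slots needed to cut the `q` largest cliques down to the size of the next one. -/
def levelTime (size : ℕ → ℕ) (q : ℕ) : ℤ := ∑ i ∈ Finset.range q, ((size i : ℤ) - size q)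

lemma levelTime_succ (size : ℕ → ℕ) (q : ℕ) :
    levelTime size (q + 1) - levelTime size q = (q + 1) * ((size q : ℤ) - size (q + 1)) := by
  unfold levelTime
  rw [Finset.sum_range_succ]
  simp only [Finset.sum_sub_distrib, Finset.sum_const, Finset.card_range, nsmul_eq_mul]
  ring

/-- A Lagrangian argument: with `l = size q`, removing one vertex is charged `2 (l - 1)` ordered
pairs. Cutting the larger cliques to `l` and leaving the others alone is optimal at this price, and
the time bound limits the number of removals. -/
lemma levelPairs_le (hanti : Antitone size) {q : ℕ} (hq : q < k) (m : ℕ → ℤ)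
    (hm : ∀ i, m i ≤ size i)
    (ht : ∑ i ∈ Finset.range k, ((size i : ℤ) - m i) ≤ levelTime size q) :
    levelPairs size k q ≤ ∑ i ∈ Finset.range k, m i * (m i - 1) := by
  have hnn : ∀ a : ℤ, 0 ≤ a * (a - 1) := fun a => by
    rcases le_or_gt a 0 with h | h
    · nlinarith
    · exact mul_nonneg h.le (by omega)
  have hsplit : ∀ f : ℕ → ℤ, ∑ i ∈ Finset.range k, f i =
      ∑ i ∈ Finset.range q, f i + ∑ i ∈ Finset.Ico q k, f i := fun f => by
    rw [Finset.range_eq_Ico, Finset.range_eq_Ico, Finset.sum_Ico_consecutive _ (by omega) hq.le]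
  -- For `size q = 0` the price `2 (l - 1)` would be negative, but then there is nothing to show.
  rcases Nat.eq_zero_or_pos (size q) with h0 | hpos
  · have : levelPairs size k q = 0 := by
      unfold levelPairs
      rw [h0, Finset.sum_eq_zero]
      · simp
      · intro i hi
        have := hanti (Finset.mem_Ico.1 hi).1
        have : size i = 0 := by omega
        simp [this]
    rw [this]
    exact Finset.sum_nonneg fun i _ => hnn _
  obtain ⟨l, hl⟩ : ∃ l : ℤ, l = size q := ⟨_, rfl⟩
  have hl1 : 1 ≤ l := by omega
  -- The quadratic minus the line is `(l - m) (l - m - 1)`, a product of consecutive integers.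
  have hlow : ∑ i ∈ Finset.range q, (l * (l - 1) + 2 * (l - 1) * (m i - l))
      ≤ ∑ i ∈ Finset.range q, m i * (m i - 1) := by
    refine Finset.sum_le_sum fun i _ => ?_
    have := hnn (l - m i)
    nlinarith
  -- In a clique of at most `l` vertices each removal destroys at most `2 (l - 1)` ordered pairs.
  have hhigh : ∑ i ∈ Finset.Ico q k, ((size i : ℤ) * (size i - 1) - 2 * (l - 1) * (size i - m i))
      ≤ ∑ i ∈ Finset.Ico q k, m i * (m i - 1) := by
    refine Finset.sum_le_sum fun i hi => ?_
    have h1 : (size i : ℤ) ≤ l := by rw [hl]; exact_mod_cast hanti (Finset.mem_Ico.1 hi).1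
    rcases (hm i).eq_or_lt with h | h
    · rw [h]; linarith
    · have : 0 ≤ (size i - m i : ℤ) * (2 * (l - 1) - (size i + m i - 1)) :=
        mul_nonneg (by linarith) (by omega)
      nlinarith
  rw [hsplit] at ht ⊢
  refine le_trans ?_ (add_le_add hlow hhigh)
  simp only [levelPairs, levelTime, ← hl, Finset.sum_add_distrib, Finset.sum_sub_distrib,
    ← Finset.mul_sum, Finset.sum_const, Finset.card_range, nsmul_eq_mul] at ht ⊢
  nlinarith

open Classical in
-- Twice the cost is the sum over all times of the number of ordered pairs still uncovered. Before
-- `levelTime size (q + 1)` at most that many vertices have been placed, so at least `levelPairs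
-- size k (q + 1)` pairs remain; the time from one level to the next is given by `levelTime_succ`.
lemma sum_levels_le_two_mul_cost (hanti : Antitone size)
    (s : (Σ i : Fin k, Fin (size i)) → ℕ) (hs : IsSchedule s) :
    ∑ q ∈ Finset.range (k - 1), (q + 1 : ℤ) * ((size q : ℤ) - size (q + 1)) *
      levelPairs size k (q + 1) ≤ 2 * cost (disjointCliques k fun i => size i) s := by
  set G := disjointCliques k fun i => size i with hG
  let m : ℕ → ℕ → ℤ := fun t i =>
    if h : i < k then ((Finset.univ.filter fun p : Fin (size i) => t < s ⟨⟨i, h⟩, p⟩).card : ℤ)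
    else 0
  let g : ℕ → ℤ := fun t => ∑ i ∈ Finset.range k, m t i * (m t i - 1)
  have hm : ∀ t (i : Fin k),
      m t i = ((Finset.univ.filter fun p : Fin (size i) => t < s ⟨i, p⟩).card : ℤ) :=
    fun t i => by simp [m, i.2]
  have hmle : ∀ t i, m t i ≤ size i := fun t i => by
    simp only [m]
    split_ifs
    · exact_mod_cast (Finset.card_le_univ _).trans (by simp)
    · simp
  have hg : ∀ t, g t = ∑ a, ∑ b,
      (if G.Adj a b then (if t < s a ∧ t < s b then (1 : ℤ) else 0) else 0) := by
    intro t
    rw [hG, sum_sum_disjointCliques (fun i : Fin k => size i)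
      fun a b => if t < s a ∧ t < s b then (1 : ℤ) else 0]
    simp only [g, Finset.sum_range]
    refine Finset.sum_congr rfl fun i _ => ?_
    rw [hm, ← sum_pairs_after fun p => s ⟨i, p⟩]
  have hcost : ∀ R : ℕ, ∑ t ∈ Finset.range R, g t ≤ 2 * cost G s := by
    intro R
    have h2 : (2 * cost G s : ℤ) = ∑ a, ∑ b, if G.Adj a b then ((min (s a) (s b) : ℕ) : ℤ) else 0 := by
      rw [cost]
      push_cast
      rw [← sum_sum_adj_eq G fun e => (coverTime s e : ℤ)]
      simp_rw [coverTime_mk]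
      push_cast
      rfl
    rw [h2]
    simp_rw [hg]
    rw [Finset.sum_comm]
    refine Finset.sum_le_sum fun a _ => ?_
    rw [Finset.sum_comm]
    refine Finset.sum_le_sum fun b _ => ?_
    split_ifs
    · rw [← Finset.sum_filter, Finset.sum_const, nsmul_eq_mul, mul_one]
      have : ((Finset.range R).filter fun t => t < s a ∧ t < s b) ⊆
          Finset.range (min (s a) (s b)) := fun t ht => by
        simp only [Finset.mem_filter, Finset.mem_range] at ht ⊢
        omega
      exact_mod_cast (Finset.card_le_card this).trans (by simp)
    · simp
  have hcount : ∀ t, ∑ i ∈ Finset.range k, ((size i : ℤ) - m t i) ≤ t := by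
    intro t
    have h1 : ∑ i ∈ Finset.range k, ((size i : ℤ) - m t i)
        = ((Finset.univ.filter fun v => s v ≤ t).card : ℤ) := by
      rw [Finset.sum_range, Finset.card_filter, Fintype.sum_sigma]
      push_cast
      refine Finset.sum_congr rfl fun i _ => ?_
      rw [hm]
      have h2 := Finset.card_filter_add_card_filter_not (s := (Finset.univ : Finset (Fin (size i))))
        (fun p => t < s ⟨i, p⟩)
      simp only [not_lt, Finset.card_univ, Fintype.card_fin] at h2
      rw [← Finset.sum_filter, Finset.sum_const, nsmul_eq_mul, mul_one]
      omega
    rw [h1]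
    have h3 : (Finset.univ.filter fun v => s v ≤ t).card ≤ (Finset.Icc 1 t).card :=
      Finset.card_le_card_of_injOn s (fun v hv => by
        simp only [Finset.coe_filter, Finset.mem_univ, true_and, Set.mem_ofPred_eq] at hv
        simpa using ⟨hs.one_le v, hv⟩) hs.injective.injOn
    simpa using h3
  have hmono : ∀ q, levelTime size q ≤ levelTime size (q + 1) := fun q => by
    have h1 := levelTime_succ size q
    have h2 : (0 : ℤ) ≤ size q - size (q + 1) := by
      have := hanti (Nat.le_succ q); simp only [Nat.succ_eq_add_one] at this; omega
    have : 0 ≤ (q + 1 : ℤ) * (size q - size (q + 1)) := mul_nonneg (by omega) h2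
    linarith
  have h0 : ∀ q, 0 ≤ levelTime size q := fun q => by
    induction q with
    | zero => simp [levelTime]
    | succ q ih => exact ih.trans (hmono q)
  -- The time axis is cut at the level times, and each window is bounded by the number of pairs at
  -- its right end.
  have hind : ∀ Q, Q ≤ k - 1 → ∑ q ∈ Finset.range Q, (q + 1 : ℤ) *
      ((size q : ℤ) - size (q + 1)) * levelPairs size k (q + 1)
      ≤ ∑ t ∈ Finset.range (levelTime size Q).toNat, g t := by
    intro Q
    induction Q with
    | zero => intro _; simp [levelTime]
    | succ Q ih =>
      intro hQ
      rw [Finset.sum_range_succ, ← Finset.sum_range_add_sum_Ico g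
        (Int.toNat_le_toNat (hmono Q)), ← levelTime_succ]
      refine add_le_add (ih (by omega)) ?_
      have hcard : (levelTime size (Q + 1) - levelTime size Q : ℤ) =
          (Finset.Ico (levelTime size Q).toNat (levelTime size (Q + 1)).toNat).card := by
        have := h0 Q
        have := hmono Q
        rw [Nat.card_Ico]
        omega
      rw [hcard, ← nsmul_eq_mul, ← Finset.sum_const]
      refine Finset.sum_le_sum fun t ht => ?_
      refine levelPairs_le hanti (by omega) (m t) (hmle t) ((hcount t).trans ?_)
      have := (Finset.mem_Ico.1 ht).2
      omega
  exact (hind _ le_rfl).trans (hcost _)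

lemma sum_levels_le_two_mul_opt (hanti : Antitone size) :
    ∑ q ∈ Finset.range (k - 1), (q + 1 : ℤ) * ((size q : ℤ) - size (q + 1)) *
      levelPairs size k (q + 1) ≤ 2 * opt (disjointCliques k fun i => size i) := by
  obtain ⟨s, hs, hc⟩ := exists_cost_eq_opt (disjointCliques k fun i : Fin k => size i)
  rw [← hc]
  exact sum_levels_le_two_mul_cost hanti s hs

/-! ### A fractional solution for disjoint cliques -/

/-- The number of slots in which the first `i` cliques can be covered fractionally. -/
def halfTime (size : ℕ → ℕ) (i : ℕ) : ℕ := ∑ j ∈ Finset.range i, (size j + 1) / 2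

lemma halfTime_mono (size : ℕ → ℕ) : Monotone (halfTime size) := fun _ _ h =>
  Finset.sum_le_sum_of_subset (Finset.range_subset_range.2 h)

lemma slack_mk {V : Type*} [Fintype V] (x : V → ℕ → ℝ≥0) {a b : V} (hab : a ≠ b) (t : ℕ) :
    slack x s(a, b) t =
      1 - (∑ t' ∈ Finset.Ico 1 t, x a t' + ∑ t' ∈ Finset.Ico 1 t, x b t') := by
  classical
  have e : (Finset.univ.filter fun v => v ∈ s(a, b)) = {a, b} := by ext v; simp
  rw [slack, ← Finset.sum_pair hab (f := fun v => ∑ t' ∈ Finset.Ico 1 t, x v t'), ← e]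

/-- The cliques are treated one after another, each slot being shared equally within the current
clique. After half as many slots as it has vertices, rounded up, every vertex has mass at least one
half, so all edges of the clique are covered. -/
lemma two_mul_lpValue_le :
    2 * lpValue (disjointCliques k fun i => size i) ≤
      ((∑ i ∈ Finset.range k, size i * (size i - 1) * halfTime size (i + 1) : ℕ) : ℝ≥0∞) := by
  classical
  set G := disjointCliques k fun i : Fin k => size i with hG
  let x : (Σ i : Fin k, Fin (size i)) → ℕ → ℝ≥0 := fun a t =>
    if halfTime size a.1 < t ∧ t ≤ halfTime size (a.1 + 1) then (size a.1 : ℝ≥0)⁻¹ else 0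
  have hx : ∀ t, 1 ≤ t → ∑ a, x a t ≤ 1 := by
    intro t _
    rw [Fintype.sum_sigma]
    have h1 : ∀ i : Fin k, ∑ p : Fin (size i), x ⟨i, p⟩ t ≤
        if halfTime size i < t ∧ t ≤ halfTime size (i + 1) then 1 else 0 := by
      intro i
      simp only [x]
      split_ifs
      · rw [Finset.sum_const, Finset.card_univ, Fintype.card_fin, nsmul_eq_mul]
        exact mul_inv_le_one
      · simp
    refine (Finset.sum_le_sum fun i _ => h1 i).trans ?_
    rw [← Finset.sum_filter, Finset.sum_const, nsmul_eq_mul, mul_one]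
    have : (Finset.univ.filter fun i : Fin k =>
        halfTime size i < t ∧ t ≤ halfTime size (i + 1)).card ≤ 1 := by
      refine Finset.card_le_one.2 fun i hi j hj => ?_
      simp only [Finset.mem_filter, Finset.mem_univ, true_and] at hi hj
      ext
      by_contra hne
      rcases Nat.lt_or_gt_of_ne hne with h | h
      · have := halfTime_mono size (show (i : ℕ) + 1 ≤ j from h); omega
      · have := halfTime_mono size (show (j : ℕ) + 1 ≤ i from h); omega
    exact_mod_cast this
  have hslack : ∀ a b, G.Adj a b → ∑' t : ℕ, (slack x s(a, b) (t + 1) : ℝ≥0∞)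
      ≤ (halfTime size (a.1 + 1) : ℝ≥0∞) := by
    intro a b hab
    have hsz : 0 < size a.1 := lt_of_le_of_lt (Nat.zero_le _) a.2.2
    have hzero : ∀ t, halfTime size (a.1 + 1) < t → slack x s(a, b) t = 0 := by
      intro t ht
      rw [slack_mk _ hab.ne, tsub_eq_zero_iff_le]
      have hhalf : ∀ c : Σ i : Fin k, Fin (size i), c.1 = a.1 →
          1 / 2 ≤ ∑ t' ∈ Finset.Ico 1 t, x c t' := by
        intro c hc
        have hle : ∑ t' ∈ Finset.Ioc (halfTime size a.1) (halfTime size (a.1 + 1)), x c t' ≤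
            ∑ t' ∈ Finset.Ico 1 t, x c t' :=
          Finset.sum_le_sum_of_subset fun t' ht' => by
            simp only [Finset.mem_Ioc, Finset.mem_Ico] at ht' ⊢
            omega
        refine le_trans ?_ hle
        rw [Finset.sum_congr rfl (g := fun _ => (size a.1 : ℝ≥0)⁻¹)]
        · have hc2 : halfTime size (a.1 + 1) - halfTime size a.1 = (size a.1 + 1) / 2 := by
            simp [halfTime, Finset.sum_range_succ]
          rw [Finset.sum_const, Nat.card_Ioc, hc2, nsmul_eq_mul, ← div_eq_mul_inv,
            div_le_div_iff₀ (by norm_num) (by exact_mod_cast hsz)]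
          have : 1 * size a.1 ≤ (size a.1 + 1) / 2 * 2 := by omega
          exact_mod_cast this
        · intro t' ht'
          simp only [Finset.mem_Ioc] at ht'
          simp only [x, hc, ht', true_and, if_true]
      calc (1 : ℝ≥0) = 1 / 2 + 1 / 2 := by norm_num
        _ ≤ _ := add_le_add (hhalf a rfl) (hhalf b hab.1.symm)
    rw [tsum_eq_sum (s := Finset.range (halfTime size (a.1 + 1))) fun t ht => by
      rw [hzero (t + 1) (by rw [Finset.mem_range] at ht; omega)]; rfl]
    calc _ ≤ ∑ t ∈ Finset.range (halfTime size (a.1 + 1)), (1 : ℝ≥0∞) :=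
          Finset.sum_le_sum fun t _ => by exact_mod_cast tsub_le_self
      _ = _ := by simp
  calc 2 * lpValue G ≤ 2 * lpCost G (slack x) := by
        gcongr
        exact lpValue_le G (lpFeasible_slack G hx)
    _ = ∑ a, ∑ b, (if G.Adj a b then ∑' t : ℕ, (slack x s(a, b) (t + 1) : ℝ≥0∞) else 0) := by
        rw [sum_sum_adj_eq G fun e => ∑' t : ℕ, (slack x e (t + 1) : ℝ≥0∞), lpCost]
    _ ≤ ∑ a, ∑ b, (if G.Adj a b then (halfTime size (a.1 + 1) : ℝ≥0∞) else 0) :=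
        Finset.sum_le_sum fun a _ => Finset.sum_le_sum fun b _ => by
          split_ifs with h
          · exact hslack a b h
          · exact le_rfl
    _ = _ := by
        rw [hG, sum_sum_disjointCliques (fun i : Fin k => size i)
          fun a _ => (halfTime size (a.1 + 1) : ℝ≥0∞)]
        simp only [Finset.sum_const, Finset.card_erase_of_mem (Finset.mem_univ _),
          Finset.card_univ, Fintype.card_fin, nsmul_eq_mul]
        rw [Finset.sum_range]
        push_cast
        refine Finset.sum_congr rfl fun i _ => ?_
        ring

lemma one_le_lpValue {V : Type*} [Fintype V] {G : SimpleGraph V} {a b : V} (hab : G.Adj a b) :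
    1 ≤ lpValue G := by
  classical
  refine le_iInf fun x => le_iInf fun u => le_iInf fun h => ?_
  have h1 : (1 : ℝ≥0) ≤ u s(a, b) 1 := by simpa using h.covering s(a, b) hab 1 le_rfl
  calc (1 : ℝ≥0∞) ≤ (u s(a, b) (0 + 1) : ℝ≥0∞) := by exact_mod_cast h1
    _ ≤ ∑' t : ℕ, (u s(a, b) (t + 1) : ℝ≥0∞) := ENNReal.le_tsum 0
    _ ≤ lpCost G u := Finset.single_le_sum
        (f := fun e => ∑' t : ℕ, (u e (t + 1) : ℝ≥0∞)) (fun _ _ => zero_le)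
        (by simpa using hab)

end Cliques

end MSVC

namespace MSVC

/-! ### The integrality gap -/

section Gap

open Filter Topology

/-! ### Power sums compared with integrals -/

lemma one_sub_mul_le_rpow_neg {u c : ℝ} (hu : 0 < u) (hc : 0 ≤ c) : 1 - c * (u - 1) ≤ u ^ (-c) := by
  rw [Real.rpow_def_of_pos hu]
  have h1 := Real.add_one_le_exp (Real.log u * -c)
  have h2 := mul_le_mul_of_nonneg_left (Real.log_le_sub_one_of_pos hu) hc
  linarith

/-- A convex function lies above its tangents. Between neighbouring integers, with either one as
base point, this bounds power sums by telescoping differences from above and from below. -/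
lemma tangent_le_rpow_neg {x y c : ℝ} (hx : 0 < x) (hy : 0 < y) (hc : 0 ≤ c) :
    y ^ (-c) - c * y ^ (-c - 1) * (x - y) ≤ x ^ (-c) := by
  have h := mul_le_mul_of_nonneg_left (one_sub_mul_le_rpow_neg (div_pos hx hy) hc)
    (Real.rpow_nonneg hy.le (-c))
  rw [← Real.mul_rpow hy.le (by positivity), mul_div_cancel₀ _ hy.ne'] at h
  refine le_trans (le_of_eq ?_) h
  rw [Real.rpow_sub_one hy.ne']
  field_simp

lemma rpow_le_tangent {x y c : ℝ} (hx : 0 ≤ x) (hy : 0 < y) (hc : 0 ≤ c) (hc1 : c ≤ 1) :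
    x ^ c ≤ y ^ c + c * y ^ (c - 1) * (x - y) := by
  have hxy : (0 : ℝ) ≤ x / y := by positivity
  have h := mul_le_mul_of_nonneg_left (rpow_one_add_le_one_add_mul_self (s := x / y - 1)
    (by linarith) hc hc1) (Real.rpow_nonneg hy.le c)
  rw [add_sub_cancel, ← Real.mul_rpow hy.le hxy, mul_div_cancel₀ _ hy.ne'] at h
  refine h.trans (le_of_eq ?_)
  rw [Real.rpow_sub_one hy.ne']
  field_simp

lemma sum_rpow_neg_one_sub_le {c : ℝ} (hc : 0 < c) (k : ℕ) :
    ∑ i ∈ Finset.range k, ((i : ℝ) + 1) ^ (-1 - c) ≤ 1 + 1 / c := by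
  have h : ∀ k : ℕ, ∑ i ∈ Finset.range (k + 1), ((i : ℝ) + 1) ^ (-1 - c)
      ≤ 1 + (1 - ((k : ℝ) + 1) ^ (-c)) / c := by
    intro k
    induction k with
    | zero => simp
    | succ k ih =>
      rw [Finset.sum_range_succ]
      have ht := tangent_le_rpow_neg (x := (k : ℝ) + 1) (y := (k : ℝ) + 1 + 1) (by positivity)
        (by positivity) hc.le
      have e : (-c - 1 : ℝ) = -1 - c := by ring
      rw [e] at ht
      push_cast
      have : ((k : ℝ) + 1 + 1) ^ (-1 - c) ≤
          (((k : ℝ) + 1) ^ (-c) - ((k : ℝ) + 1 + 1) ^ (-c)) / c := by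
        rw [le_div_iff₀ hc]
        linarith
      calc _ ≤ 1 + (1 - ((k : ℝ) + 1) ^ (-c)) / c
            + (((k : ℝ) + 1) ^ (-c) - ((k : ℝ) + 1 + 1) ^ (-c)) / c := add_le_add ih this
        _ = _ := by ring
  rcases k with _ | k
  · simp; positivity
  · refine (h k).trans ?_
    have : (0 : ℝ) ≤ ((k : ℝ) + 1) ^ (-c) := by positivity
    gcongr
    linarith

lemma le_sum_rpow_neg_one_sub {c : ℝ} (hc : 0 < c) {m k : ℕ} (hmk : m ≤ k) :
    (((m : ℝ) + 1) ^ (-c) - ((k : ℝ) + 1) ^ (-c)) / c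
      ≤ ∑ i ∈ Finset.Ico m k, ((i : ℝ) + 1) ^ (-1 - c) := by
  induction k, hmk using Nat.le_induction with
  | base => simp
  | succ k hk ih =>
    rw [Finset.sum_Ico_succ_top hk]
    have ht := tangent_le_rpow_neg (x := (k : ℝ) + 1 + 1) (y := (k : ℝ) + 1) (by positivity)
      (by positivity) hc.le
    have e : (-c - 1 : ℝ) = -1 - c := by ring
    rw [e] at ht
    have : (((k : ℝ) + 1) ^ (-c) - ((k : ℝ) + 1 + 1) ^ (-c)) / c ≤ ((k : ℝ) + 1) ^ (-1 - c) := by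
      rw [div_le_iff₀ hc]
      linarith
    push_cast
    calc _ = (((m : ℝ) + 1) ^ (-c) - ((k : ℝ) + 1) ^ (-c)) / c
          + (((k : ℝ) + 1) ^ (-c) - ((k : ℝ) + 1 + 1) ^ (-c)) / c := by ring
      _ ≤ _ := add_le_add ih this

lemma sum_rpow_neg_le {r : ℝ} (hr0 : 0 ≤ r) (hr1 : r < 1) (k : ℕ) :
    ∑ i ∈ Finset.range k, ((i : ℝ) + 1) ^ (-r) ≤ (k : ℝ) ^ (1 - r) / (1 - r) := by
  induction k with
  | zero => simp [Real.zero_rpow (show 1 - r ≠ 0 by linarith)]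
  | succ k ih =>
    rw [Finset.sum_range_succ]
    have ht := rpow_le_tangent (x := k) (y := (k : ℝ) + 1) (by positivity)
      (by positivity) (show 0 ≤ 1 - r by linarith) (by linarith)
    have e : (1 - r - 1 : ℝ) = -r := by ring
    rw [e] at ht
    have : ((k : ℝ) + 1) ^ (-r) ≤ (((k : ℝ) + 1) ^ (1 - r) - (k : ℝ) ^ (1 - r)) / (1 - r) := by
      rw [le_div_iff₀ (by linarith)]
      linarith
    push_cast
    calc _ ≤ (k : ℝ) ^ (1 - r) / (1 - r) +
          (((k : ℝ) + 1) ^ (1 - r) - (k : ℝ) ^ (1 - r)) / (1 - r) := add_le_add ih this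
      _ = _ := by ring

/-! ### Asymptotics of the two clique bounds -/

/-- The relative size of the `i`-th clique. -/
noncomputable def cliqueRatio (ε : ℝ) (i : ℕ) : ℝ := ((i : ℝ) + 1) ^ (-(2 / 3 + ε))

/-- The size of the `i`-th clique. -/
noncomputable def cliqueSize (ε : ℝ) (N i : ℕ) : ℕ := ⌊(N : ℝ) * cliqueRatio ε i⌋₊

lemma cliqueRatio_nonneg (ε : ℝ) (i : ℕ) : 0 ≤ cliqueRatio ε i := by
  unfold cliqueRatio; positivity

lemma cliqueRatio_antitone {ε : ℝ} (hε : 0 < ε) : Antitone (cliqueRatio ε) := fun i j h => by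
  have h' : (i : ℝ) ≤ j := by exact_mod_cast h
  exact Real.rpow_le_rpow_of_nonpos (by positivity) (by linarith) (by linarith)

lemma cliqueSize_antitone {ε : ℝ} (hε : 0 < ε) (N : ℕ) : Antitone (cliqueSize ε N) :=
  fun _ _ h => Nat.floor_le_floor
    (mul_le_mul_of_nonneg_left (cliqueRatio_antitone hε h) (Nat.cast_nonneg N))

/-- Twice the LP bound, relative to `N ^ 3 / 2`. -/
noncomputable def lpSum (ε : ℝ) (k : ℕ) : ℝ :=
  ∑ i ∈ Finset.range k, cliqueRatio ε i ^ 2 * ∑ j ∈ Finset.range (i + 1), cliqueRatio ε j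

/-- Twice the bound for the optimum, relative to `N ^ 3`. -/
noncomputable def optSum (ε : ℝ) (k : ℕ) : ℝ :=
  ∑ q ∈ Finset.range (k - 1), (q + 1 : ℝ) * (cliqueRatio ε q - cliqueRatio ε (q + 1)) *
    ((q + 1) * cliqueRatio ε (q + 1) ^ 2 + ∑ i ∈ Finset.Ico (q + 1) k, cliqueRatio ε i ^ 2)

/-- The partial sums of `i^(-2/3-ε)` are at most `i^(1/3-ε) / (1/3 - ε)`, so the terms are about `3
i^(-1-3ε)`. The exponent `2/3` is the one that makes the series nearly harmonic, with sum about
`1/ε`. -/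
lemma lpSum_le {ε : ℝ} (hε : 0 < ε) (hε1 : ε < 1 / 3) (k : ℕ) :
    lpSum ε k ≤ (1 + 3 * ε) / (ε * (1 - 3 * ε)) := by
  have h1 : (0 : ℝ) < 1 - 3 * ε := by linarith
  calc lpSum ε k ≤ ∑ i ∈ Finset.range k, ((i : ℝ) + 1) ^ (-1 - 3 * ε) / (1 - (2 / 3 + ε)) := by
        refine Finset.sum_le_sum fun i _ => ?_
        have h2 := sum_rpow_neg_le (r := 2 / 3 + ε) (by linarith) (by linarith) (i + 1)
        have hp : (0 : ℝ) < (i : ℝ) + 1 := by positivity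
        calc _ ≤ cliqueRatio ε i ^ 2 * (((i + 1 : ℕ) : ℝ) ^ (1 - (2 / 3 + ε)) / (1 - (2 / 3 + ε))) :=
              mul_le_mul_of_nonneg_left h2 (by positivity)
          _ = _ := by
              unfold cliqueRatio
              push_cast
              rw [← mul_div_assoc, ← Real.rpow_natCast, ← Real.rpow_mul hp.le, ← Real.rpow_add hp]
              congr 2
              push_cast
              ring
    _ = (∑ i ∈ Finset.range k, ((i : ℝ) + 1) ^ (-1 - 3 * ε)) / (1 - (2 / 3 + ε)) := by
        rw [Finset.sum_div]
    _ ≤ (1 + 1 / (3 * ε)) / (1 - (2 / 3 + ε)) := by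
        have := sum_rpow_neg_one_sub_le (c := 3 * ε) (by linarith) k
        have h3 : (0 : ℝ) < 1 - (2 / 3 + ε) := by linarith
        gcongr
    _ = _ := by
        have h3 : (1 - (2 / 3 + ε)) = (1 - 3 * ε) / 3 := by ring
        rw [h3]
        field_simp
        ring

/-- Put `r = 2/3 + ε`, `d = 2r - 1` and `p = q + 2`. The size difference times `q + 1` is about `r
p^(-r)`, the levelled cliques contribute about `p^(-d)` and the tail `p^(-d)/d`. The product is `r
(1 + 1/d) p^(-1-3ε)`, with coefficient tending to `8/3`. Dropping the terms with `p < P` allows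
replacing `q + 1` by `(1 - 1/P) p`. The subtracted term is the cost of ending the tail at `k`. -/
lemma le_optSum {ε : ℝ} (hε : 0 < ε) (hε1 : ε < 1 / 3) {P k : ℕ} (hP : 2 ≤ P) (hk : P ≤ k) :
    (2 / 3 + ε) * (1 + 1 / (1 / 3 + 2 * ε)) * (1 - 1 / (P : ℝ)) ^ 2 *
      (((P : ℝ) ^ (-(3 * ε)) - ((k : ℝ) + 1) ^ (-(3 * ε))) / (3 * ε))
      - (2 / 3 + ε) / (1 / 3 + 2 * ε) / (1 / 3 - ε) * ((k : ℝ) + 1) ^ (-(3 * ε)) ≤ optSum ε k := by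
  set r := 2 / 3 + ε with hr
  set d := 1 / 3 + 2 * ε with hd
  set θ := 1 - 1 / (P : ℝ) with hθ
  set K := ((k : ℝ) + 1) ^ (-d) with hK
  have hd0 : 0 < d := by positivity
  have hr0 : 0 < r := by positivity
  have hP' : (2 : ℝ) ≤ P := by exact_mod_cast hP
  have hθ0 : 0 ≤ θ := by
    rw [hθ, sub_nonneg, div_le_one (by linarith)]; linarith
  have hθ1 : θ ≤ 1 := by
    rw [hθ]
    have : (0 : ℝ) ≤ 1 / P := by positivity
    linarith
  have hK0 : 0 ≤ K := by positivity
  have hterm : ∀ q ∈ Finset.range (k - 1),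
      (if P ≤ q + 2 then θ ^ 2 * r * (1 + 1 / d) * ((q : ℝ) + 1 + 1) ^ (-1 - 3 * ε) else 0)
      - r / d * K * ((q : ℝ) + 1 + 1) ^ (-r) ≤
      (q + 1 : ℝ) * (cliqueRatio ε q - cliqueRatio ε (q + 1)) *
    ((q + 1) * cliqueRatio ε (q + 1) ^ 2 + ∑ i ∈ Finset.Ico (q + 1) k, cliqueRatio ε i ^ 2) := by
    intro q hq
    have hqk : q + 1 ≤ k := by have := Finset.mem_range.1 hq; omega
    have hq0 : (0 : ℝ) < (q : ℝ) + 1 := by positivity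
    have hp0 : (0 : ℝ) < (q : ℝ) + 1 + 1 := by positivity
    set p := (q : ℝ) + 1 + 1 with hp
    have hY0 : 0 ≤ (q + 1) * cliqueRatio ε (q + 1) ^ 2 +
        ∑ i ∈ Finset.Ico (q + 1) k, cliqueRatio ε i ^ 2 :=
      add_nonneg (by positivity) (Finset.sum_nonneg fun i _ => sq_nonneg _)
    have hX0 : 0 ≤ (q + 1 : ℝ) * (cliqueRatio ε q - cliqueRatio ε (q + 1)) :=
      mul_nonneg hq0.le (by linarith [cliqueRatio_antitone hε (Nat.le_succ q)])
    have hpr : 0 ≤ p ^ (-r) := by positivity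
    split_ifs with hPq
    · have hθp : θ * p ≤ (q : ℝ) + 1 := by
        have h1 : (P : ℝ) ≤ p := by rw [hp]; exact_mod_cast hPq
        have : 1 ≤ 1 / (P : ℝ) * p := by
          rw [one_div, inv_mul_eq_div, one_le_div (by linarith)]; exact h1
        rw [hθ]
        linarith
      have hX : θ * r * p ^ (-r) ≤ (q + 1 : ℝ) * (cliqueRatio ε q - cliqueRatio ε (q + 1)) := by
        have ht := tangent_le_rpow_neg (x := (q : ℝ) + 1) (y := p) hq0 hp0 hr0.le
        have h2 : r * p ^ (-r - 1) ≤ cliqueRatio ε q - cliqueRatio ε (q + 1) := by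
          unfold cliqueRatio
          push_cast
          have e : (q : ℝ) + 1 - p = -1 := by rw [hp]; ring
          rw [e] at ht
          linarith
        have h3 : p ^ (-r) = p * p ^ (-r - 1) := by
          rw [Real.rpow_sub_one hp0.ne']; field_simp
        calc θ * r * p ^ (-r) = (θ * p) * (r * p ^ (-r - 1)) := by rw [h3]; ring
          _ ≤ _ := mul_le_mul hθp h2 (by positivity) hq0.le
      have hY : θ * p ^ (-d) + (p ^ (-d) - K) / d ≤ (q + 1) * cliqueRatio ε (q + 1) ^ 2 +
          ∑ i ∈ Finset.Ico (q + 1) k, cliqueRatio ε i ^ 2 := by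
        have hsq : ∀ i : ℕ, cliqueRatio ε i ^ 2 = ((i : ℝ) + 1) ^ (-1 - d) := fun i => by
          unfold cliqueRatio
          rw [← Real.rpow_natCast, ← Real.rpow_mul (by positivity), hd]
          congr 1
          push_cast
          ring
        simp_rw [hsq]
        have hs := le_sum_rpow_neg_one_sub hd0 hqk
        push_cast at hs ⊢
        rw [← hp] at hs ⊢
        refine add_le_add ?_ hs
        have h3 : p ^ (-d) = p * p ^ (-1 - d) := by
          rw [show (-1 - d : ℝ) = -d - 1 by ring, Real.rpow_sub_one hp0.ne']; field_simp
        rw [h3, ← mul_assoc]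
        exact mul_le_mul_of_nonneg_right hθp (by positivity)
      have e3 : p ^ (-1 - 3 * ε) = p ^ (-r) * p ^ (-d) := by
        rw [← Real.rpow_add hp0]
        congr 1
        rw [hr, hd]; ring
      calc _ ≤ θ * r * p ^ (-r) * (θ * p ^ (-d) + (p ^ (-d) - K) / d) := by
            rw [e3]
            have h1 : 0 ≤ (1 - θ) * (r / d * K * p ^ (-r)) :=
              mul_nonneg (by linarith) (by positivity)
            have h2 : 0 ≤ θ * (1 - θ) * (r / d * (p ^ (-r) * p ^ (-d))) :=
              mul_nonneg (mul_nonneg hθ0 (by linarith)) (by positivity)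
            have e4 : θ * r * p ^ (-r) * (θ * p ^ (-d) + (p ^ (-d) - K) / d)
                - (θ ^ 2 * r * (1 + 1 / d) * (p ^ (-r) * p ^ (-d)) - r / d * K * p ^ (-r))
                = (1 - θ) * (r / d * K * p ^ (-r)) +
                  θ * (1 - θ) * (r / d * (p ^ (-r) * p ^ (-d))) := by
              field_simp
              ring
            linarith
        _ ≤ θ * r * p ^ (-r) * _ := mul_le_mul_of_nonneg_left hY (by positivity)
        _ ≤ _ := mul_le_mul_of_nonneg_right hX hY0
    · have h1 : 0 ≤ r / d * K * p ^ (-r) := by positivity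
      have h2 := mul_nonneg hX0 hY0
      linarith
  refine le_trans ?_ (Finset.sum_le_sum hterm)
  rw [Finset.sum_sub_distrib]
  refine sub_le_sub ?_ ?_
  · have h1 := le_sum_rpow_neg_one_sub (c := 3 * ε) (by linarith) (m := P - 1) (k := k) (by omega)
    have e1 : ((P - 1 : ℕ) : ℝ) + 1 = P := by
      rw [Nat.cast_sub (by omega)]; simp
    rw [e1] at h1
    have e2 : ∑ q ∈ Finset.range (k - 1),
        (if P ≤ q + 2 then θ ^ 2 * r * (1 + 1 / d) * ((q : ℝ) + 1 + 1) ^ (-1 - 3 * ε) else 0)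
        = θ ^ 2 * r * (1 + 1 / d) * ∑ i ∈ Finset.Ico (P - 1) k, ((i : ℝ) + 1) ^ (-1 - 3 * ε) := by
      rw [← Finset.sum_filter, ← Finset.mul_sum]
      congr 1
      have : (Finset.range (k - 1)).filter (fun q => P ≤ q + 2) = Finset.Ico (P - 2) (k - 1) := by
        ext q
        simp only [Finset.mem_filter, Finset.mem_range, Finset.mem_Ico]
        omega
      rw [this]
      have e5 := Finset.sum_Ico_add' (fun i : ℕ => ((i : ℝ) + 1) ^ (-1 - 3 * ε)) (P - 2) (k - 1) 1
      rw [show P - 2 + 1 = P - 1 by omega, show k - 1 + 1 = k by omega] at e5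
      rw [← e5]
      refine Finset.sum_congr rfl fun i _ => ?_
      push_cast
      rfl
    rw [e2]
    calc _ = θ ^ 2 * r * (1 + 1 / d) *
          (((P : ℝ) ^ (-(3 * ε)) - ((k : ℝ) + 1) ^ (-(3 * ε))) / (3 * ε)) := by ring
      _ ≤ _ := mul_le_mul_of_nonneg_left h1 (by positivity)
  · rw [← Finset.mul_sum]
    have h1 : ∑ q ∈ Finset.range (k - 1), ((q : ℝ) + 1 + 1) ^ (-r) ≤
        ((k : ℝ) + 1) ^ (1 - r) / (1 - r) := by
      have h2 := sum_rpow_neg_le (r := r) hr0.le (by rw [hr]; linarith) k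
      have h3 : ∑ q ∈ Finset.range (k - 1), ((q : ℝ) + 1 + 1) ^ (-r) ≤
          ∑ i ∈ Finset.range k, ((i : ℝ) + 1) ^ (-r) := by
        obtain ⟨k', rfl⟩ : ∃ k', k = k' + 1 := ⟨k - 1, by omega⟩
        rw [Finset.sum_range_succ']
        simp only [Nat.add_sub_cancel]
        push_cast
        have : (0 : ℝ) ≤ (0 + 1) ^ (-r) := by positivity
        linarith
      refine h3.trans (h2.trans ?_)
      have h4 : 0 < 1 - r := by rw [hr]; linarith
      gcongr
      linarith
    calc _ ≤ r / d * K * (((k : ℝ) + 1) ^ (1 - r) / (1 - r)) :=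
          mul_le_mul_of_nonneg_left h1 (by positivity)
      _ = r / d / (1 / 3 - ε) * (K * ((k : ℝ) + 1) ^ (1 - r)) := by
          rw [show 1 - r = 1 / 3 - ε by rw [hr]; ring]
          ring
      _ = _ := by
          rw [hK, ← Real.rpow_add (by positivity)]
          congr 2
          rw [hd, hr]; ring

/-- The order of choices matters: `P` makes `(1 - 1/P)²` close to 1, then a small `ε` brings the
coefficient close to `8/3` and `P^(-3ε)` close to 1, and only then is `k` large enough to make `(k +
1)^(-3ε)` negligible. -/
lemma exists_lt_optSum {δ : ℝ} (hδ : 0 < δ) : ∃ ε₀ : ℝ, 0 < ε₀ ∧ ∀ ε : ℝ, 0 < ε → ε < ε₀ →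
    ∃ k₀ : ℕ, ∀ k : ℕ, k₀ ≤ k → (1 - δ) * (8 / (9 * ε)) < optSum ε k := by
  obtain ⟨P, hPδ⟩ := exists_nat_gt (max 2 (2 / δ))
  have hP2 : (2 : ℝ) < P := lt_of_le_of_lt (le_max_left _ _) hPδ
  have hP2' : 2 ≤ P := by exact_mod_cast hP2.le
  have hPd : 2 / δ < P := lt_of_le_of_lt (le_max_right _ _) hPδ
  have hθ : 1 - δ < (1 - 1 / (P : ℝ)) ^ 2 := by
    have : 2 / (P : ℝ) < δ := by
      rw [div_lt_iff₀ (by linarith)]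
      rw [div_lt_iff₀ hδ] at hPd
      linarith
    have h2 : 1 / (P : ℝ) = (2 / P) / 2 := by ring
    nlinarith [sq_nonneg (1 / (P : ℝ))]
  have hcont : ContinuousAt (fun ε : ℝ => (2 / 3 + ε) * (1 + 1 / (1 / 3 + 2 * ε)) *
      (1 - 1 / (P : ℝ)) ^ 2 * (P : ℝ) ^ (-(3 * ε))) 0 := by
    have h1 : ContinuousAt (fun ε : ℝ => (1 : ℝ) / (1 / 3 + 2 * ε)) 0 :=
      continuousAt_const.div (by fun_prop) (by norm_num)
    have h2 : ContinuousAt (fun ε : ℝ => (P : ℝ) ^ (-(3 * ε))) 0 :=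
      ContinuousAt.rpow continuousAt_const (by fun_prop) (Or.inl (by linarith))
    fun_prop
  have hev : ∀ᶠ ε in 𝓝 (0 : ℝ), (1 - δ) * (8 / 3) < (2 / 3 + ε) * (1 + 1 / (1 / 3 + 2 * ε)) *
      (1 - 1 / (P : ℝ)) ^ 2 * (P : ℝ) ^ (-(3 * ε)) := by
    refine hcont.eventually (lt_mem_nhds ?_)
    norm_num
    norm_num at hθ
    linarith
  obtain ⟨η, hη, hball⟩ := Metric.eventually_nhds_iff.1 hev
  refine ⟨min η (1 / 3), lt_min hη (by norm_num), fun ε hε hεlt => ?_⟩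
  have hε1 : ε < 1 / 3 := lt_of_lt_of_le hεlt (min_le_right _ _)
  have hA := hball (y := ε) (by
    rw [Real.dist_eq, sub_zero, abs_of_pos hε]; exact lt_of_lt_of_le hεlt (min_le_left _ _))
  have hK : Tendsto (fun k : ℕ => ((k : ℝ) + 1) ^ (-(3 * ε))) atTop (𝓝 0) :=
    (tendsto_rpow_neg_atTop (by linarith)).comp
      (tendsto_atTop_add_const_right _ _ tendsto_natCast_atTop_atTop)
  have hlim : Tendsto (fun k : ℕ => (2 / 3 + ε) * (1 + 1 / (1 / 3 + 2 * ε)) *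
      (1 - 1 / (P : ℝ)) ^ 2 * (((P : ℝ) ^ (-(3 * ε)) - ((k : ℝ) + 1) ^ (-(3 * ε))) / (3 * ε))
      - (2 / 3 + ε) / (1 / 3 + 2 * ε) / (1 / 3 - ε) * ((k : ℝ) + 1) ^ (-(3 * ε))) atTop
      (𝓝 ((2 / 3 + ε) * (1 + 1 / (1 / 3 + 2 * ε)) *
      (1 - 1 / (P : ℝ)) ^ 2 * (((P : ℝ) ^ (-(3 * ε)) - 0) / (3 * ε))
      - (2 / 3 + ε) / (1 / 3 + 2 * ε) / (1 / 3 - ε) * 0)) :=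
    (((hK.const_sub _).div_const _).const_mul _).sub (hK.const_mul _)
  have hlt : (1 - δ) * (8 / (9 * ε)) < (2 / 3 + ε) * (1 + 1 / (1 / 3 + 2 * ε)) *
      (1 - 1 / (P : ℝ)) ^ 2 * (((P : ℝ) ^ (-(3 * ε)) - 0) / (3 * ε))
      - (2 / 3 + ε) / (1 / 3 + 2 * ε) / (1 / 3 - ε) * 0 := by
    rw [mul_zero, sub_zero, sub_zero]
    have h3 := div_lt_div_of_pos_right hA (show 0 < 3 * ε by linarith)
    rw [show 8 / (9 * ε) = 8 / 3 / (3 * ε) by rw [div_div]; ring_nf]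
    rwa [mul_div_assoc, mul_div_assoc] at h3
  obtain ⟨k₀, hk₀⟩ := eventually_atTop.1 ((hlim.eventually (lt_mem_nhds hlt)).and
    (eventually_ge_atTop P))
  exact ⟨k₀, fun k hk => lt_of_lt_of_le (hk₀ k hk).1 (le_optSum hε hε1 hP2' (hk₀ k hk).2)⟩

/-! ### From the limit sums to cliques of integral size -/

lemma tendsto_cliqueSize (ε : ℝ) (i : ℕ) :
    Tendsto (fun N : ℕ => (cliqueSize ε N i : ℝ) / N) atTop (𝓝 (cliqueRatio ε i)) := by
  have h := (tendsto_nat_floor_mul_div_atTop (R := ℝ) (cliqueRatio_nonneg ε i)).comp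
    tendsto_natCast_atTop_atTop
  refine h.congr fun N => ?_
  simp [cliqueSize, mul_comm]

/-- With `k` fixed, division by `N³` turns the rounded sizes into ratios, and the rounding up in
`halfTime` has lower order. A strict inequality in the limit therefore holds for all large `N`. -/
lemma eventually_lpBound {ε R : ℝ} {k : ℕ} (h : lpSum ε k < R) : ∀ᶠ N : ℕ in atTop,
    ((∑ i ∈ Finset.range k, cliqueSize ε N i * (cliqueSize ε N i - 1) *
      halfTime (cliqueSize ε N) (i + 1) : ℕ) : ℝ) ≤ R / 2 * (N : ℝ) ^ 3 := by
  have hinv : Tendsto (fun N : ℕ => 1 / (N : ℝ)) atTop (𝓝 0) := tendsto_one_div_atTop_nhds_zero_nat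
  have hlim : Tendsto (fun N : ℕ => ∑ i ∈ Finset.range k, ((cliqueSize ε N i : ℝ) / N) ^ 2 *
      ∑ j ∈ Finset.range (i + 1), ((cliqueSize ε N j : ℝ) / N + 1 / N)) atTop
      (𝓝 (∑ i ∈ Finset.range k, cliqueRatio ε i ^ 2 *
        ∑ j ∈ Finset.range (i + 1), (cliqueRatio ε j + 0))) :=
    tendsto_finsetSum _ fun i _ => ((tendsto_cliqueSize ε i).pow 2).mul
      (tendsto_finsetSum _ fun j _ => (tendsto_cliqueSize ε j).add hinv)
  simp only [add_zero] at hlim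
  filter_upwards [hlim.eventually (gt_mem_nhds h), eventually_gt_atTop 0] with N hN hN0
  have hNpos : (0 : ℝ) < N := by exact_mod_cast hN0
  have e : (∑ i ∈ Finset.range k, ((cliqueSize ε N i : ℝ) / N) ^ 2 *
      ∑ j ∈ Finset.range (i + 1), ((cliqueSize ε N j : ℝ) / N + 1 / N)) * (N : ℝ) ^ 3
      = ∑ i ∈ Finset.range k, (cliqueSize ε N i : ℝ) ^ 2 *
        ∑ j ∈ Finset.range (i + 1), ((cliqueSize ε N j : ℝ) + 1) := by
    simp_rw [← add_div, ← Finset.sum_div]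
    rw [Finset.sum_mul]
    refine Finset.sum_congr rfl fun i _ => ?_
    field_simp
  have h2 : ((∑ i ∈ Finset.range k, cliqueSize ε N i * (cliqueSize ε N i - 1) *
      halfTime (cliqueSize ε N) (i + 1) : ℕ) : ℝ) ≤ (∑ i ∈ Finset.range k,
      (cliqueSize ε N i : ℝ) ^ 2 * ∑ j ∈ Finset.range (i + 1), ((cliqueSize ε N j : ℝ) + 1)) / 2 := by
    rw [Finset.sum_div]
    push_cast
    refine Finset.sum_le_sum fun i _ => ?_
    rw [mul_div_assoc]
    refine mul_le_mul ?_ ?_ (Nat.cast_nonneg _) (by positivity)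
    · rw [sq]
      refine mul_le_mul_of_nonneg_left ?_ (Nat.cast_nonneg _)
      exact_mod_cast Nat.sub_le _ _
    · rw [halfTime, Finset.sum_div]
      push_cast
      refine Finset.sum_le_sum fun j _ => ?_
      refine Nat.cast_div_le.trans ?_
      push_cast
      exact le_rfl
  have h3 := mul_le_mul_of_nonneg_right hN.le (show (0 : ℝ) ≤ (N : ℝ) ^ 3 by positivity)
  rw [e] at h3
  linarith

lemma eventually_optBound {ε R : ℝ} {k : ℕ} (h : R < optSum ε k) : ∀ᶠ N : ℕ in atTop,
    R * (N : ℝ) ^ 3 ≤ ((∑ q ∈ Finset.range (k - 1), (q + 1 : ℤ) *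
      ((cliqueSize ε N q : ℤ) - cliqueSize ε N (q + 1)) *
      levelPairs (cliqueSize ε N) k (q + 1) : ℤ) : ℝ) := by
  have hinv : Tendsto (fun N : ℕ => 1 / (N : ℝ)) atTop (𝓝 0) := tendsto_one_div_atTop_nhds_zero_nat
  have hsq : ∀ i, Tendsto (fun N : ℕ => ((cliqueSize ε N i : ℝ) / N) *
      ((cliqueSize ε N i : ℝ) / N - 1 / N)) atTop (𝓝 (cliqueRatio ε i ^ 2)) := fun i => by
    have := (tendsto_cliqueSize ε i).mul ((tendsto_cliqueSize ε i).sub hinv)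
    rwa [sub_zero, ← sq] at this
  have hlim : Tendsto (fun N : ℕ => ∑ q ∈ Finset.range (k - 1), (q + 1 : ℝ) *
      ((cliqueSize ε N q : ℝ) / N - (cliqueSize ε N (q + 1) : ℝ) / N) *
      ((q + 1) * (((cliqueSize ε N (q + 1) : ℝ) / N) * ((cliqueSize ε N (q + 1) : ℝ) / N - 1 / N))
        + ∑ i ∈ Finset.Ico (q + 1) k, ((cliqueSize ε N i : ℝ) / N) *
          ((cliqueSize ε N i : ℝ) / N - 1 / N))) atTop (𝓝 (optSum ε k)) :=
    tendsto_finsetSum _ fun q _ =>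
      (((tendsto_cliqueSize ε q).sub (tendsto_cliqueSize ε (q + 1))).const_mul _).mul
        (((hsq (q + 1)).const_mul _).add (tendsto_finsetSum _ fun i _ => hsq i))
  filter_upwards [hlim.eventually (lt_mem_nhds h), eventually_gt_atTop 0] with N hN hN0
  have hNpos : (0 : ℝ) < N := by exact_mod_cast hN0
  refine (mul_le_mul_of_nonneg_right hN.le (show (0 : ℝ) ≤ (N : ℝ) ^ 3 by positivity)).trans
    (le_of_eq ?_)
  rw [Finset.sum_mul]
  push_cast
  refine Finset.sum_congr rfl fun q _ => ?_
  unfold levelPairs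
  push_cast
  simp_rw [← sub_div, div_mul_div_comm, ← Finset.sum_div]
  field_simp

theorem exists_gap (δ : ℝ) (hδ : 0 < δ) : ∃ ε₀ : ℝ, 0 < ε₀ ∧ ∀ ε : ℝ, 0 < ε → ε < ε₀ →
    ∃ k₀ : ℕ, ∀ k : ℕ, k₀ ≤ k → ∃ N₀ : ℕ, ∀ N : ℕ, N₀ ≤ N →
      0 < lpValue (gapInstance ε k N) ∧
      lpValue (gapInstance ε k N) ≤ ENNReal.ofReal ((1 + δ) * ((N : ℝ) ^ 3 / (4 * ε))) ∧
      (1 - δ) * (4 * (N : ℝ) ^ 3 / (9 * ε)) ≤ (opt (gapInstance ε k N) : ℝ) := by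
  obtain ⟨ε₁, hε₁, h₁⟩ := exists_lt_optSum hδ
  -- The last bound on `ε` is equivalent to `1 + 3ε < (1 + δ)(1 - 3ε)`.
  refine ⟨min ε₁ (min (1 / 3) (δ / (3 * (2 + δ)))), by positivity, fun ε hε hlt => ?_⟩
  have hl1 : ε < ε₁ := lt_of_lt_of_le hlt (min_le_left _ _)
  have hl2 : ε < 1 / 3 := lt_of_lt_of_le hlt ((min_le_right _ _).trans (min_le_left _ _))
  have hl3 : ε < δ / (3 * (2 + δ)) :=
    lt_of_lt_of_le hlt ((min_le_right _ _).trans (min_le_right _ _))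
  obtain ⟨k₀, hk₀⟩ := h₁ ε hε hl1
  refine ⟨max k₀ 1, fun k hk => ?_⟩
  have hk1 : 1 ≤ k := (le_max_right _ _).trans hk
  have hlp : lpSum ε k < (1 + δ) / ε := by
    refine lt_of_le_of_lt (lpSum_le hε hl2 k) ?_
    rw [lt_div_iff₀ (by positivity)] at hl3
    rw [div_lt_div_iff₀ (mul_pos hε (by linarith)) hε]
    nlinarith
  obtain ⟨N₀, hN₀⟩ := eventually_atTop.1 ((eventually_lpBound hlp).and
    ((eventually_optBound (hk₀ k ((le_max_left _ _).trans hk))).and (eventually_ge_atTop 2)))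
  refine ⟨N₀, fun N hN => ?_⟩
  obtain ⟨hub, hlb, hN2⟩ := hN₀ N hN
  have hanti := cliqueSize_antitone hε N
  have hgap : gapInstance ε k N = disjointCliques k fun i => cliqueSize ε N i := rfl
  refine ⟨?_, ?_, ?_⟩
  · have hsz : 2 ≤ cliqueSize ε N 0 := by simpa [cliqueSize, cliqueRatio] using hN2
    have hadj : (disjointCliques k fun i : Fin k => cliqueSize ε N i).Adj
        ⟨⟨0, hk1⟩, ⟨0, by show 0 < cliqueSize ε N 0; omega⟩⟩
        ⟨⟨0, hk1⟩, ⟨1, by show 1 < cliqueSize ε N 0; omega⟩⟩ := by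
      refine ⟨rfl, fun h => ?_⟩
      simp at h
    rw [hgap]
    exact lt_of_lt_of_le one_pos (one_le_lpValue hadj)
  · rw [hgap]
    have h2 := two_mul_lpValue_le (k := k) (size := cliqueSize ε N)
    rw [← ENNReal.ofReal_natCast] at h2
    have h3 := h2.trans (ENNReal.ofReal_le_ofReal hub)
    have h4 : (1 + δ) / ε / 2 * (N : ℝ) ^ 3 = 2 * ((1 + δ) * ((N : ℝ) ^ 3 / (4 * ε))) := by
      field_simp
      ring
    rw [h4, ENNReal.ofReal_mul (by norm_num), ENNReal.ofReal_ofNat] at h3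
    exact (ENNReal.mul_le_mul_iff_right (by simp) (by simp)).1 h3
  · change _ ≤ (opt (disjointCliques k fun i : Fin k => cliqueSize ε N i) : ℝ)
    have h2 : ((∑ q ∈ Finset.range (k - 1), (q + 1 : ℤ) *
      ((cliqueSize ε N q : ℤ) - cliqueSize ε N (q + 1)) *
      levelPairs (cliqueSize ε N) k (q + 1) : ℤ) : ℝ) ≤
      ((2 * opt (disjointCliques k fun i : Fin k => cliqueSize ε N i) : ℤ) : ℝ) := by
      exact_mod_cast sum_levels_le_two_mul_opt hanti
    have h3 := hlb.trans h2
    push_cast at h3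
    have h4 : (1 - δ) * (8 / (9 * ε)) * (N : ℝ) ^ 3
        = 2 * ((1 - δ) * (4 * (N : ℝ) ^ 3 / (9 * ε))) := by
      field_simp
      ring
    linarith

theorem exists_tight (δ : ℝ) (hδ : 0 < δ) : ∃ ε₀ : ℝ, 0 < ε₀ ∧ ∀ ε : ℝ, 0 < ε → ε < ε₀ →
    ∃ k₀ : ℕ, ∀ k : ℕ, k₀ ≤ k → ∃ N₀ : ℕ, ∀ N : ℕ, N₀ ≤ N →
      0 < lpValue (gapInstance ε k N) ∧
      lpValue (gapInstance ε k N) ≤ ENNReal.ofReal ((1 + δ) * ((N : ℝ) ^ 3 / (4 * ε))) ∧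
      (1 - δ) * (4 * (N : ℝ) ^ 3 / (9 * ε)) ≤ (opt (gapInstance ε k N) : ℝ) ∧
      ENNReal.ofReal (16 / 9 - δ) * lpValue (gapInstance ε k N) ≤
        (opt (gapInstance ε k N) : ℝ≥0∞) := by
  -- An error of `δ/4` on either side costs at most `δ` in the quotient, because `2/9 < 1/4`.
  obtain ⟨ε₀, hε₀, h⟩ := exists_gap (δ / 4) (by positivity)
  refine ⟨ε₀, hε₀, fun ε hε hlt => ?_⟩
  obtain ⟨k₀, hk₀⟩ := h ε hε hlt
  refine ⟨k₀, fun k hk => ?_⟩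
  obtain ⟨N₀, hN₀⟩ := hk₀ k hk
  refine ⟨N₀, fun N hN => ?_⟩
  obtain ⟨h1, h2, h3⟩ := hN₀ N hN
  have hX : 0 ≤ (N : ℝ) ^ 3 / ε := by positivity
  have e1 : (N : ℝ) ^ 3 / (4 * ε) = (N : ℝ) ^ 3 / ε / 4 := by field_simp
  have e2 : 4 * (N : ℝ) ^ 3 / (9 * ε) = 4 / 9 * ((N : ℝ) ^ 3 / ε) := by field_simp
  rw [e1] at h2 ⊢
  rw [e2] at h3 ⊢
  refine ⟨h1, h2.trans (ENNReal.ofReal_le_ofReal ?_), le_trans ?_ h3, ?_⟩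
  · gcongr; linarith
  · exact mul_le_mul_of_nonneg_right (by linarith) (by positivity)
  · rcases le_total (16 / 9 - δ) 0 with hn | hn
    · rw [ENNReal.ofReal_of_nonpos hn, zero_mul]
      exact zero_le
    · refine (mul_le_mul le_rfl h2 zero_le zero_le).trans ?_
      rw [← ENNReal.ofReal_mul hn, ← ENNReal.ofReal_natCast]
      refine ENNReal.ofReal_le_ofReal (le_trans ?_ h3)
      have : (16 / 9 - δ) * ((1 + δ / 4) / 4) ≤ (1 - δ / 4) * (4 / 9) := by nlinarith
      nlinarith

end Gap

end MSVC

namespace MSVC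

/-! ### A language of bounded sums and products, compiled to the random access machine -/

section Machine

open Polynomial

lemma size_add_le (a b : ℕ) : (a + b).size ≤ a.size + b.size + 1 := by
  rw [Nat.size_le]
  have ha := Nat.lt_size_self a
  have hb := Nat.lt_size_self b
  have h1 : 2 ^ a.size ≤ 2 ^ (a.size + b.size) := Nat.pow_le_pow_right (by norm_num) (by omega)
  have h2 : 2 ^ b.size ≤ 2 ^ (a.size + b.size) := Nat.pow_le_pow_right (by norm_num) (by omega)
  rw [pow_succ]
  omega

lemma size_mul_le (a b : ℕ) : (a * b).size ≤ a.size + b.size := by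
  rw [Nat.size_le, pow_add]
  exact Nat.mul_lt_mul'' (Nat.lt_size_self a) (Nat.lt_size_self b)

lemma size_le_self (a : ℕ) : a.size ≤ a := Nat.size_le.2 Nat.lt_two_pow_self

/-- Every memory cell holds a number of binary length at most `X`. -/
def MemBound (X : ℕ) (m : Mem) : Prop := ∀ a, (m a).size ≤ X

lemma MemBound.update {X : ℕ} {m : Mem} (hm : MemBound X m) (a : ℕ) {v : ℕ} (hv : v.size ≤ X) :
    MemBound X (Function.update m a v) := fun a' => by
  rcases eq_or_ne a' a with rfl | h
  · simpa using hv
  · simpa [h] using hm a'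

/-- An expression is fixed, so finitely many nested operations make the lengths and the time a
polynomial in the maximal length of a memory cell. -/
lemma Expr.exists_bound (e : Expr) : ∃ P : ℕ[X], ∀ X m, MemBound X m →
    (e.val m).size ≤ P.eval X ∧ e.steps m ≤ P.eval X := by
  induction e with
  | const n => exact ⟨C (n.size + 1), fun X m _ => by simp [val, steps]⟩
  | load a ih =>
    obtain ⟨P, hP⟩ := ih
    refine ⟨P + P + Polynomial.X + 1, fun X m hm => ?_⟩
    have h := hP X m hm
    have h2 := hm (a.val m)
    simp only [val, steps, eval_add, eval_X, eval_one]
    omega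
  | add a b iha ihb =>
    obtain ⟨P, hP⟩ := iha
    obtain ⟨Q, hQ⟩ := ihb
    refine ⟨P + Q + P + Q + 1, fun X m hm => ?_⟩
    have h := hP X m hm
    have h' := hQ X m hm
    have h2 := size_add_le (a.val m) (b.val m)
    simp only [val, steps, eval_add, eval_one]
    omega
  | sub a b iha ihb =>
    obtain ⟨P, hP⟩ := iha
    obtain ⟨Q, hQ⟩ := ihb
    refine ⟨P + Q + P + Q + 1, fun X m hm => ?_⟩
    have h := hP X m hm
    have h' := hQ X m hm
    have h2 := Nat.size_le_size (Nat.sub_le (a.val m) (b.val m))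
    simp only [val, steps, eval_add, eval_one]
    omega
  | mul a b iha ihb =>
    obtain ⟨P, hP⟩ := iha
    obtain ⟨Q, hQ⟩ := ihb
    refine ⟨P + Q + (P + 1) * (Q + 1), fun X m hm => ?_⟩
    obtain ⟨h, h1⟩ := hP X m hm
    obtain ⟨h', h1'⟩ := hQ X m hm
    have h2 := size_mul_le (a.val m) (b.val m)
    have h3 := Nat.mul_le_mul (Nat.add_le_add_right h 1) (Nat.add_le_add_right h' 1)
    simp only [val, steps, eval_add, eval_one, eval_mul]
    constructor
    · nlinarith
    · omega
  | div a b iha ihb =>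
    obtain ⟨P, hP⟩ := iha
    obtain ⟨Q, hQ⟩ := ihb
    refine ⟨P + Q + (P + 1) * (Q + 1), fun X m hm => ?_⟩
    obtain ⟨h, h1⟩ := hP X m hm
    obtain ⟨h', h1'⟩ := hQ X m hm
    have h2 := Nat.size_le_size (Nat.div_le_self (a.val m) (b.val m))
    have h3 := Nat.mul_le_mul (Nat.add_le_add_right h 1) (Nat.add_le_add_right h' 1)
    simp only [val, steps, eval_add, eval_one, eval_mul]
    constructor
    · nlinarith
    · omega

lemma exists_runs_store (a e : Expr) : ∃ P : ℕ[X], ∀ X m, MemBound X m → (e.val m).size ≤ X →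
    ∃ k, k ≤ P.eval X ∧
      Runs (Prog.store a e) m k (Function.update m (a.val m) (e.val m)) := by
  obtain ⟨P, hP⟩ := a.exists_bound
  obtain ⟨Q, hQ⟩ := e.exists_bound
  refine ⟨P + P + Q + Q + 1, fun X m hm _ => ⟨_, ?_, Runs.store a e m⟩⟩
  have h1 := hP X m hm
  have h2 := hQ X m hm
  simp only [eval_add, eval_one]
  omega

/-- A loop whose condition counts down from `b`. -/
lemma exists_runs_loop {c : Expr} {p : Prog} {b K : ℕ} (I : ℕ → Mem → Prop)
    (hc : ∀ i m, I i m → c.val m = b - i ∧ c.steps m ≤ K)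
    (hp : ∀ i, i < b → ∀ m, I i m → ∃ k m', k ≤ K ∧ Runs p m k m' ∧ I (i + 1) m')
    {m : Mem} (hm : I 0 m) :
    ∃ k m', k ≤ (b + 1) * (2 * K + 1) ∧ Runs (Prog.loop c p) m k m' ∧ I b m' := by
  have h : ∀ r i m, i + r = b → I i m →
      ∃ k m', k ≤ (r + 1) * (2 * K + 1) ∧ Runs (Prog.loop c p) m k m' ∧ I b m' := by
    intro r
    induction r with
    | zero =>
      intro i m hi hI
      have h1 := hc i m hI
      refine ⟨_, m, ?_, Runs.loopDone (by omega), by rwa [← hi]⟩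
      omega
    | succ r ih =>
      intro i m hi hI
      have h1 := hc i m hI
      obtain ⟨k, m', hk, hr, hI'⟩ := hp i (by omega) m hI
      obtain ⟨l, m'', hl, hr', hI''⟩ := ih (i + 1) m' (by omega) hI'
      refine ⟨_, m'', ?_, Runs.loopStep (by omega) hr hr', hI''⟩
      have : (r + 1 + 1) * (2 * K + 1) = (r + 1) * (2 * K + 1) + (2 * K + 1) := by ring
      omega
  exact h b 0 m (by omega) hm

/-! ### Terms, their values and the lengths of their values -/

/-- Polynomials in the number of vertices. -/
inductive Bound : Type
  | const (c : ℕ)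
  | size
  | add (a b : Bound)
  | mul (a b : Bound)

/-- The value of a bound as a polynomial. -/
noncomputable def Bound.poly : Bound → ℕ[X]
  | const c => C c
  | size => X
  | add a b => a.poly + b.poly
  | mul a b => a.poly * b.poly

/-- The value of a bound for `n` vertices. -/
def Bound.val (n : ℕ) : Bound → ℕ
  | const c => c
  | size => n
  | add a b => a.val n + b.val n
  | mul a b => a.val n * b.val n

lemma Bound.eval_poly (b : Bound) (n : ℕ) : b.poly.eval n = b.val n := by
  induction b with
  | const c => simp [poly, val]
  | size => simp [poly, val]
  | add a b iha ihb => simp [poly, val, iha, ihb]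
  | mul a b iha ihb => simp [poly, val, iha, ihb]

/-- The expression for a bound; cell `0` holds the number of vertices. -/
def Bound.expr : Bound → Expr
  | const c => Expr.const c
  | size => Expr.load (Expr.const 0)
  | add a b => Expr.add a.expr b.expr
  | mul a b => Expr.mul a.expr b.expr

lemma Bound.val_expr (b : Bound) (m : Mem) : b.expr.val m = b.val (m 0) := by
  induction b with
  | const c => rfl
  | size => rfl
  | add a b iha ihb => simp [expr, val, Expr.val, iha, ihb]
  | mul a b iha ihb => simp [expr, val, Expr.val, iha, ihb]

/-- The binary operations. -/
inductive Op : Type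
  | add
  | sub
  | mul
  | div

/-- The function of a binary operation. -/
def Op.fn : Op → ℕ → ℕ → ℕ
  | add, a, b => a + b
  | sub, a, b => a - b
  | mul, a, b => a * b
  | div, a, b => a / b

/-- The machine expression of a binary operation. -/
def Op.expr : Op → Expr → Expr → Expr
  | add => Expr.add
  | sub => Expr.sub
  | mul => Expr.mul
  | div => Expr.div

lemma Op.val_expr (o : Op) (a b : Expr) (m : Mem) :
    (o.expr a b).val m = o.fn (a.val m) (b.val m) := by
  cases o <;> rfl

lemma Op.size_fn_le (o : Op) (a b : ℕ) : (o.fn a b).size ≤ a.size + b.size + 1 := by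
  cases o
  · exact size_add_le a b
  · exact (Nat.size_le_size (Nat.sub_le a b)).trans (by omega)
  · exact (size_mul_le a b).trans (by omega)
  · exact (Nat.size_le_size (Nat.div_le_self a b)).trans (by omega)

/-- The two big operations. -/
inductive BigOp : Type
  | sum
  | prod

/-- The binary operation that is iterated. -/
def BigOp.op : BigOp → Op
  | sum => Op.add
  | prod => Op.mul

/-- The value of the empty sum or product. -/
def BigOp.init : BigOp → ℕ
  | sum => 0
  | prod => 1

/-- The sum or product of the first `j` values of `f`. -/
def BigOp.fold : BigOp → (ℕ → ℕ) → ℕ → ℕ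
  | sum, f, j => ∑ i ∈ Finset.range j, f i
  | prod, f, j => ∏ i ∈ Finset.range j, f i

lemma BigOp.fold_zero (o : BigOp) (f : ℕ → ℕ) : o.fold f 0 = o.init := by
  cases o <;> simp [fold, init]

lemma BigOp.fold_succ (o : BigOp) (f : ℕ → ℕ) (j : ℕ) :
    o.fold f (j + 1) = o.op.fn (o.fold f j) (f j) := by
  cases o
  · exact Finset.sum_range_succ f j
  · exact Finset.prod_range_succ f j

/-- In a product lengths add up, so even products over polynomial ranges have polynomial length;
sums are covered by the same bound. -/
lemma BigOp.size_fold_le (o : BigOp) (f : ℕ → ℕ) {s j : ℕ} (hf : ∀ i, i < j → (f i).size ≤ s) :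
    (o.fold f j).size ≤ j * s + j + 1 := by
  induction j with
  | zero => rw [fold_zero]; cases o <;> simp [init]
  | succ j ih =>
    cases o with
    | sum =>
      have h1 : ∀ i ∈ Finset.range (j + 1), f i ≤ 2 ^ s := fun i hi =>
        (Nat.size_le.1 (hf i (Finset.mem_range.1 hi))).le
      have h2 : ∑ i ∈ Finset.range (j + 1), f i ≤ (j + 1) * 2 ^ s := by
        simpa using Finset.sum_le_card_nsmul _ _ _ h1
      rw [Nat.size_le]
      calc _ ≤ (j + 1) * 2 ^ s := h2
        _ < 2 ^ (j + 1) * 2 ^ s := Nat.mul_lt_mul_of_pos_right Nat.lt_two_pow_self (by positivity)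
        _ = 2 ^ (j + 1 + s) := (pow_add 2 (j + 1) s).symm
        _ ≤ _ := Nat.pow_le_pow_right (by norm_num) (by nlinarith)
    | prod =>
      rw [fold_succ]
      have h1 := ih fun i hi => hf i (by omega)
      have h2 := size_mul_le (prod.fold f j) (f j)
      have h3 := hf j (by omega)
      change (prod.fold f j * f j).size ≤ _
      have : (j + 1) * s + (j + 1) + 1 = j * s + j + 1 + s + 1 := by ring
      omega

/-- Terms with named variables; `big o b x t` is the sum or product of `t` over `x < b`. -/
inductive Term : Type
  | const (c : ℕ)
  | bound (b : Bound)
  | var (x : ℕ)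
  | load (a : Term)
  | bin (o : Op) (a b : Term)
  | big (o : BigOp) (b : Bound) (x : ℕ) (t : Term)

namespace Term

/-- The value of a term for the data `δ` and the values `ρ` of the variables. -/
def eval (δ : ℕ → ℕ) : Term → (ℕ → ℕ) → ℕ
  | const c, _ => c
  | bound b, _ => b.val (δ 0)
  | var x, ρ => ρ x
  | load a, ρ => δ (a.eval δ ρ)
  | bin o a b, ρ => o.fn (a.eval δ ρ) (b.eval δ ρ)
  | big o b x t, ρ => o.fold (fun i => t.eval δ (Function.update ρ x i)) (b.val (δ 0))

/-- The sum of all ranges of bound variables. -/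
noncomputable def ranges : Term → ℕ[X]
  | const _ => 0
  | bound b => b.poly
  | var _ => 0
  | load a => a.ranges
  | bin _ a b => a.ranges + b.ranges
  | big _ b _ t => b.poly + t.ranges

/-- A bound for the length of the value of a term. -/
noncomputable def len : Term → ℕ[X]
  | const c => C c.size
  | bound _ => X
  | var _ => X
  | load _ => X
  | bin _ a b => a.len + b.len + 1
  | big _ _ _ t => X * t.len + X + 1

/-- A bound for the lengths of all intermediate results. -/
noncomputable def maxLen : Term → ℕ[X]
  | load a => X + a.maxLen
  | bin o a b => (bin o a b).len + a.maxLen + b.maxLen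
  | big o b x t => (big o b x t).len + t.maxLen
  | t => t.len

/-- The single parameter `W` bounds data, variables and ranges. A bound variable stays below its
range, so the hypothesis persists under the binder. -/
lemma size_eval_le {δ : ℕ → ℕ} {W : ℕ} (hδ : ∀ a, (δ a).size ≤ W) (t : Term) :
    ∀ ρ : ℕ → ℕ, (∀ x, (ρ x).size ≤ W) → t.ranges.eval (δ 0) ≤ W →
      (t.eval δ ρ).size ≤ t.len.eval W := by
  induction t with
  | const c => intro ρ _ _; simp [eval, len]
  | bound b =>
    intro ρ _ hr
    simp only [ranges, Bound.eval_poly] at hr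
    simpa [eval, len] using (size_le_self _).trans hr
  | var x => intro ρ hρ _; simpa [eval, len] using hρ x
  | load a ih => intro ρ _ _; simpa [eval, len] using hδ _
  | bin o a b iha ihb =>
    intro ρ hρ hr
    simp only [ranges, eval_add] at hr
    have h1 := iha ρ hρ (by omega)
    have h2 := ihb ρ hρ (by omega)
    have h3 := o.size_fn_le (a.eval δ ρ) (b.eval δ ρ)
    simp only [eval, len, eval_add, eval_one]
    omega
  | big o b x t ih =>
    intro ρ hρ hr
    simp only [ranges, eval_add, Bound.eval_poly] at hr
    have h1 := o.size_fold_le (fun i => t.eval δ (Function.update ρ x i)) (s := t.len.eval W)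
      (j := b.val (δ 0)) fun i hi => by
        refine ih _ (fun y => ?_) (by omega)
        rcases eq_or_ne y x with rfl | h
        · simpa using (size_le_self i).trans (by omega)
        · simpa [h] using hρ y
    simp only [eval, len, eval_add, eval_one, eval_mul, eval_X]
    refine h1.trans ?_
    have : b.val (δ 0) ≤ W := by omega
    gcongr

/-! ### Memory layout and compilation of terms -/

/-- The machine address of the stack cell `j`; data and stack cells alternate from `B` on. -/
def stackAddr (B j : ℕ) : ℕ := B + (2 * j + 1)

/-- The machine address of the data cell `a`. -/
def dataAddr (B a : ℕ) : ℕ := a + (a - B)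

/-- Data cells up to `B` stay in place; beyond `B` data uses the even and the stack the odd offsets.
Both areas are unbounded and the input need not be moved. -/
lemma dataAddr_ne_stackAddr (B a j : ℕ) : dataAddr B a ≠ stackAddr B j := by
  unfold dataAddr stackAddr; omega

lemma dataAddr_injective (B : ℕ) : Function.Injective (dataAddr B) := fun a b h => by
  unfold dataAddr at h; omega

lemma stackAddr_injective (B : ℕ) : Function.Injective (stackAddr B) := fun a b h => by
  unfold stackAddr at h; omega

/-- The expression for the address of a stack cell. -/
def stackExpr (base : Bound) (j : ℕ) : Expr := Expr.add base.expr (Expr.const (2 * j + 1))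

/-- The expression for the machine address of the data cell whose number is the value of `a`. -/
def dataExpr (base : Bound) (a : Expr) : Expr := Expr.add a (Expr.sub a base.expr)

lemma val_stackExpr (base : Bound) (j : ℕ) (m : Mem) :
    (stackExpr base j).val m = stackAddr (base.val (m 0)) j := by
  simp [stackExpr, stackAddr, Expr.val, Bound.val_expr]

lemma val_dataExpr (base : Bound) (a : Expr) (m : Mem) :
    (dataExpr base a).val m = dataAddr (base.val (m 0)) (a.val m) := by
  simp [dataExpr, dataAddr, Expr.val, Bound.val_expr]

/-- The program that puts the value of a term into the stack cell `d`, where the variable `x` is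
kept in the stack cell `env x`. -/
def compile (base : Bound) : Term → (ℕ → ℕ) → ℕ → Prog
  | const c, _, d => Prog.store (stackExpr base d) (Expr.const c)
  | bound b, _, d => Prog.store (stackExpr base d) b.expr
  | var x, env, d => Prog.store (stackExpr base d) (Expr.load (stackExpr base (env x)))
  | load a, env, d =>
    Prog.seq (compile base a env d) (Prog.store (stackExpr base d)
      (Expr.load (dataExpr base (Expr.load (stackExpr base d)))))
  | bin o a b, env, d =>
    Prog.seq (compile base a env d) (Prog.seq (compile base b env (d + 1))
      (Prog.store (stackExpr base d)
        (o.expr (Expr.load (stackExpr base d)) (Expr.load (stackExpr base (d + 1))))))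
  -- Cell `d` accumulates, cell `d + 1` is both the counter and the home of the bound variable, and
  -- the body works from `d + 2` on.
  | big o b x t, env, d =>
    Prog.seq (Prog.store (stackExpr base d) (Expr.const o.init))
      (Prog.seq (Prog.store (stackExpr base (d + 1)) (Expr.const 0))
        (Prog.loop (Expr.sub b.expr (Expr.load (stackExpr base (d + 1))))
          (Prog.seq (compile base t (Function.update env x (d + 1)) (d + 2))
            (Prog.seq (Prog.store (stackExpr base d)
                (o.op.expr (Expr.load (stackExpr base d)) (Expr.load (stackExpr base (d + 2)))))
              (Prog.store (stackExpr base (d + 1))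
                (Expr.add (Expr.load (stackExpr base (d + 1))) (Expr.const 1)))))))

/-- The memory `m` holds the data `δ`. -/
def HoldsData (base : Bound) (δ : ℕ → ℕ) (m : Mem) : Prop :=
  ∀ a, m (dataAddr (base.val (δ 0)) a) = δ a

lemma HoldsData.zero {base : Bound} {δ : ℕ → ℕ} {m : Mem} (h : HoldsData base δ m) :
    m 0 = δ 0 := by
  have := h 0
  rwa [dataAddr, Nat.zero_sub, Nat.zero_add] at this

lemma HoldsData.of_eq {base : Bound} {δ : ℕ → ℕ} {m m' : Mem} (h : HoldsData base δ m)
    (d : ℕ) (hm : ∀ a, (∀ j, d ≤ j → a ≠ stackAddr (base.val (δ 0)) j) → m' a = m a) :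
    HoldsData base δ m' := fun a => by
  rw [hm _ fun j _ => dataAddr_ne_stackAddr _ _ _, h a]

/-- The specification of the program for a term: it halts in polynomial time, leaves the value in
the stack cell `d`, and changes no other cells than the stack cells from `d` on. -/
def CompileSpec (base : Bound) (t : Term) (env : ℕ → ℕ) (d : ℕ) (P : ℕ[X]) : Prop :=
  ∀ (W X : ℕ) (δ ρ : ℕ → ℕ) (m : Mem), (∀ a, (δ a).size ≤ W) → (∀ x, (ρ x).size ≤ W) →
    t.ranges.eval (δ 0) ≤ W → t.maxLen.eval W ≤ X → W ≤ X → HoldsData base δ m →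
    (∀ x, m (stackAddr (base.val (δ 0)) (env x)) = ρ x) → MemBound X m →
    ∃ k m', k ≤ P.eval X ∧ Runs (compile base t env d) m k m' ∧
      m' (stackAddr (base.val (δ 0)) d) = t.eval δ ρ ∧
      (∀ a, (∀ j, d ≤ j → a ≠ stackAddr (base.val (δ 0)) j) → m' a = m a) ∧ MemBound X m'

lemma exists_runs_storeStack (base : Bound) (d : ℕ) (e : Expr) : ∃ P : ℕ[X],
    ∀ (X : ℕ) (δ : ℕ → ℕ) (m : Mem), HoldsData base δ m → MemBound X m → (e.val m).size ≤ X →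
    ∃ k, k ≤ P.eval X ∧ Runs (Prog.store (stackExpr base d) e) m k
        (Function.update m (stackAddr (base.val (δ 0)) d) (e.val m)) ∧
      MemBound X (Function.update m (stackAddr (base.val (δ 0)) d) (e.val m)) := by
  obtain ⟨P, hP⟩ := exists_runs_store (stackExpr base d) e
  refine ⟨P, fun X δ m hδ hm he => ?_⟩
  obtain ⟨k, hk, hr⟩ := hP X m hm he
  rw [val_stackExpr, hδ.zero] at hr
  exact ⟨k, hk, hr, hm.update _ he⟩

lemma update_stack_of_ne {B d : ℕ} {m : Mem} {v a : ℕ}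
    (ha : ∀ j, d ≤ j → a ≠ stackAddr B j) {d' : ℕ} (hd : d ≤ d') :
    Function.update m (stackAddr B d') v a = m a :=
  Function.update_of_ne (ha d' hd) _ _

lemma update_stack_stack {B d d' : ℕ} {m : Mem} {v : ℕ} (h : d ≠ d') :
    Function.update m (stackAddr B d') v (stackAddr B d) = m (stackAddr B d) :=
  Function.update_of_ne (fun h' => h (stackAddr_injective B h')) _ _

lemma HoldsData.update_stack {base : Bound} {δ : ℕ → ℕ} {m : Mem} (h : HoldsData base δ m)
    (d v : ℕ) : HoldsData base δ (Function.update m (stackAddr (base.val (δ 0)) d) v) := fun a => by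
  rw [Function.update_of_ne (dataAddr_ne_stackAddr _ _ _), h a]

lemma stackAddr_ne {B d j : ℕ} (h : j < d) (j' : ℕ) (hj' : d ≤ j') :
    stackAddr B j ≠ stackAddr B j' := fun h' => by
  have := stackAddr_injective B h'; omega

lemma compileSpec_store {base : Bound} {t : Term} {env : ℕ → ℕ} {d : ℕ} {e : Expr}
    (hc : compile base t env d = Prog.store (stackExpr base d) e)
    (hl : t.maxLen = t.len)
    (he : ∀ (δ ρ : ℕ → ℕ) (m : Mem), HoldsData base δ m →
      (∀ x, m (stackAddr (base.val (δ 0)) (env x)) = ρ x) → e.val m = t.eval δ ρ) :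
    ∃ P, CompileSpec base t env d P := by
  obtain ⟨P, hP⟩ := exists_runs_storeStack base d e
  refine ⟨P, fun W X δ ρ m hδ hρ hr hlen _ hm henv hX => ?_⟩
  have hv := he δ ρ m hm henv
  have hs := size_eval_le hδ t ρ hρ hr
  rw [hl] at hlen
  obtain ⟨k, hk, hrun, hb⟩ := hP X δ m hm hX (by rw [hv]; exact hs.trans hlen)
  refine ⟨k, _, hk, by rw [hc]; exact hrun, by simp [hv], fun a ha => ?_, hb⟩
  exact update_stack_of_ne ha le_rfl

lemma compileSpec_load {base : Bound} {a : Term} {env : ℕ → ℕ} {d : ℕ}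
    (ih : ∃ P, CompileSpec base a env d P) : ∃ P, CompileSpec base (load a) env d P := by
  obtain ⟨P, hP⟩ := ih
  obtain ⟨Q, hQ⟩ := exists_runs_storeStack base d
    (Expr.load (dataExpr base (Expr.load (stackExpr base d))))
  refine ⟨P + Q, fun W X δ ρ m hδ hρ hr hlen hWX hm henv hX => ?_⟩
  simp only [maxLen, eval_add, eval_X] at hlen
  obtain ⟨k, m', hk, hrun, hv, heq, hb⟩ := hP W X δ ρ m hδ hρ hr (by omega) hWX hm henv hX
  have hm' := hm.of_eq d heq
  have hval : (Expr.load (dataExpr base (Expr.load (stackExpr base d)))).val m'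
      = (load a).eval δ ρ := by
    simp only [Expr.val, val_dataExpr, val_stackExpr, hm'.zero, hv, eval]
    exact hm' _
  obtain ⟨l, hl, hrun', hb'⟩ := hQ X δ m' hm' hb (by rw [hval]; exact (hδ _).trans hWX)
  refine ⟨k + l, _, ?_, Runs.seq hrun hrun', by simp [hval], fun c hc => ?_, hb'⟩
  · rw [eval_add]; omega
  · rw [update_stack_of_ne hc le_rfl, heq c hc]

lemma compileSpec_bin {base : Bound} (o : Op) {a b : Term} {env : ℕ → ℕ} {d : ℕ}
    (hd : ∀ x, env x < d)
    (iha : ∃ P, CompileSpec base a env d P) (ihb : ∃ P, CompileSpec base b env (d + 1) P) :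
    ∃ P, CompileSpec base (bin o a b) env d P := by
  obtain ⟨P, hP⟩ := iha
  obtain ⟨Q, hQ⟩ := ihb
  obtain ⟨R, hR⟩ := exists_runs_storeStack base d
    (o.expr (Expr.load (stackExpr base d)) (Expr.load (stackExpr base (d + 1))))
  refine ⟨P + (Q + R), fun W X δ ρ m hδ hρ hr hlen hWX hm henv hX => ?_⟩
  have hsz := size_eval_le hδ (bin o a b) ρ hρ hr
  simp only [maxLen, eval_add] at hlen
  simp only [ranges, eval_add] at hr
  obtain ⟨k, m', hk, hrun, hv, heq, hb⟩ := hP W X δ ρ m hδ hρ (by omega) (by omega) hWX hm henv hX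
  have hm' := hm.of_eq d heq
  obtain ⟨k', m'', hk', hrun', hv', heq', hb'⟩ := hQ W X δ ρ m' hδ hρ (by omega) (by omega) hWX hm'
    (fun x => by rw [heq _ (stackAddr_ne (hd x)), henv x]) hb
  have hm'' := hm'.of_eq (d + 1) heq'
  have hval : (o.expr (Expr.load (stackExpr base d)) (Expr.load (stackExpr base (d + 1)))).val m''
      = (bin o a b).eval δ ρ := by
    simp only [Op.val_expr, Expr.val, val_stackExpr, hm''.zero, hv', eval]
    rw [heq' _ (stackAddr_ne (by omega)), hv]
  obtain ⟨l, hl, hrun'', hb''⟩ := hR X δ m'' hm'' hb' (by rw [hval]; omega)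
  refine ⟨k + (k' + l), _, ?_, Runs.seq hrun (Runs.seq hrun' hrun''), by simp [hval],
    fun c hc => ?_, hb''⟩
  · simp only [eval_add]; omega
  · rw [update_stack_of_ne hc le_rfl, heq' c fun j hj => hc j (by omega), heq c hc]

lemma compileSpec_big {base : Bound} (o : BigOp) (b : Bound) (x : ℕ) {t : Term} {env : ℕ → ℕ}
    {d : ℕ} (hd : ∀ x, env x < d)
    (ih : ∃ P, CompileSpec base t (Function.update env x (d + 1)) (d + 2) P) :
    ∃ P, CompileSpec base (big o b x t) env d P := by
  obtain ⟨P, hP⟩ := ih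
  obtain ⟨Q₁, hQ₁⟩ := exists_runs_storeStack base d (Expr.const o.init)
  obtain ⟨Q₂, hQ₂⟩ := exists_runs_storeStack base (d + 1) (Expr.const 0)
  obtain ⟨Q₃, hQ₃⟩ := exists_runs_storeStack base d
    (o.op.expr (Expr.load (stackExpr base d)) (Expr.load (stackExpr base (d + 2))))
  obtain ⟨Q₄, hQ₄⟩ := exists_runs_storeStack base (d + 1)
    (Expr.add (Expr.load (stackExpr base (d + 1))) (Expr.const 1))
  obtain ⟨Q₅, hQ₅⟩ := (Expr.sub b.expr (Expr.load (stackExpr base (d + 1)))).exists_bound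
  -- The factor `X + 1` counts evaluations of the loop condition: the range is at most `W`, hence at
  -- most the bound on cell lengths.
  refine ⟨Q₁ + (Q₂ + (X + 1) * (2 * (P + (Q₃ + Q₄) + Q₅) + 1)),
    fun W Y δ ρ m hδ hρ hr hlen hWY hm henv hY => ?_⟩
  have hr' := hr
  simp only [ranges, eval_add, Bound.eval_poly] at hr'
  simp only [maxLen, len, eval_add, eval_mul, eval_X, eval_one] at hlen
  set B := base.val (δ 0) with hB
  set f : ℕ → ℕ := fun i => t.eval δ (Function.update ρ x i) with hf
  have hup : ∀ i, i ≤ b.val (δ 0) → ∀ y, (Function.update ρ x i y).size ≤ W := fun i hi y => by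
    rcases eq_or_ne y x with rfl | h
    · simpa using (size_le_self i).trans (by omega)
    · simpa [h] using hρ y
  have hfold : ∀ j, j ≤ b.val (δ 0) → (o.fold f j).size ≤ Y := fun j hj => by
    refine (o.size_fold_le f (s := t.len.eval W) fun i hi =>
      size_eval_le hδ t _ (hup i (by omega)) (by omega)).trans (le_trans ?_ hlen)
    have : j ≤ W := by omega
    have := Nat.mul_le_mul_right (t.len.eval W) this
    omega
  let I : ℕ → Mem → Prop := fun i m' => i ≤ b.val (δ 0) ∧ m' (stackAddr B d) = o.fold f i ∧
    m' (stackAddr B (d + 1)) = i ∧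
    (∀ a, (∀ j, d ≤ j → a ≠ stackAddr B j) → m' a = m a) ∧ MemBound Y m'
  obtain ⟨k₁, hk₁, hrun₁, hb₁⟩ := hQ₁ Y δ m hm hY (by
    have := hfold 0 (Nat.zero_le _)
    rwa [BigOp.fold_zero] at this)
  have hm₁ := hm.update_stack d ((Expr.const o.init).val m)
  obtain ⟨k₂, hk₂, hrun₂, hb₂⟩ := hQ₂ Y δ _ hm₁ hb₁ (by simp [Expr.val])
  have hI₀ : I 0 (Function.update (Function.update m (stackAddr B d) o.init)
      (stackAddr B (d + 1)) 0) := by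
    refine ⟨Nat.zero_le _, ?_, by simp, fun a ha => ?_, hb₂⟩
    · rw [update_stack_stack (by omega), BigOp.fold_zero]; simp
    · rw [update_stack_of_ne ha (by omega), update_stack_of_ne ha le_rfl]
  have hloop := exists_runs_loop (c := Expr.sub b.expr (Expr.load (stackExpr base (d + 1))))
    (p := Prog.seq (compile base t (Function.update env x (d + 1)) (d + 2))
            (Prog.seq (Prog.store (stackExpr base d)
                (o.op.expr (Expr.load (stackExpr base d)) (Expr.load (stackExpr base (d + 2)))))
              (Prog.store (stackExpr base (d + 1))
                (Expr.add (Expr.load (stackExpr base (d + 1))) (Expr.const 1)))))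
    (b := b.val (δ 0)) (K := (P + (Q₃ + Q₄) + Q₅).eval Y) I ?_ ?_ hI₀
  · obtain ⟨k₃, m', hk₃, hrun₃, -, hv, -, heq, hb⟩ := hloop
    refine ⟨k₁ + (k₂ + k₃), m', ?_, Runs.seq hrun₁ (Runs.seq hrun₂ hrun₃), hv, heq, hb⟩
    rw [eval_add, eval_add, eval_mul]
    refine add_le_add hk₁ (add_le_add hk₂ (hk₃.trans ?_))
    simp only [eval_add, eval_mul, eval_X, eval_one, eval_ofNat]
    refine Nat.mul_le_mul ?_ le_rfl
    omega
  · rintro i m' ⟨-, -, hi, heq, hb⟩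
    have hm' := hm.of_eq d heq
    have h5 := (hQ₅ Y m' hb).2
    refine ⟨?_, h5.trans ?_⟩
    · simp only [Expr.val, val_stackExpr, Bound.val_expr, hm'.zero, ← hB, hi]
    · simp only [eval_add]; omega
  · rintro i hi m₀ ⟨-, hacc, hcnt, heq, hb⟩
    have hm₀ := hm.of_eq d heq
    obtain ⟨l₁, m₁, hl₁, hr₁, hv₁, heq₁, hb₁⟩ := hP W Y δ (Function.update ρ x i) m₀ hδ
      (hup i hi.le) (by omega) (by omega) hWY hm₀ (fun y => by
        rcases eq_or_ne y x with rfl | h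
        · simpa using hcnt
        · rw [Function.update_of_ne h, Function.update_of_ne h, heq _ (stackAddr_ne (hd y)),
            henv y]) hb
    have hm₁ := hm₀.of_eq (d + 2) heq₁
    have hval : (o.op.expr (Expr.load (stackExpr base d))
        (Expr.load (stackExpr base (d + 2)))).val m₁ = o.fold f (i + 1) := by
      simp only [Op.val_expr, Expr.val, val_stackExpr, hm₁.zero, hv₁]
      rw [heq₁ _ (stackAddr_ne (by omega)), hacc, BigOp.fold_succ]
    obtain ⟨l₂, hl₂, hr₂, hb₂⟩ := hQ₃ Y δ m₁ hm₁ hb₁ (by rw [hval]; exact hfold _ hi)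
    rw [hval, ← hB] at hr₂ hb₂
    have hm₂ := hm₁.update_stack d (o.fold f (i + 1))
    rw [← hB] at hm₂
    have hval' : (Expr.add (Expr.load (stackExpr base (d + 1))) (Expr.const 1)).val
        (Function.update m₁ (stackAddr B d) (o.fold f (i + 1))) = i + 1 := by
      simp only [Expr.val, val_stackExpr, hm₂.zero, ← hB]
      rw [update_stack_stack (by omega), heq₁ _ (stackAddr_ne (by omega)), hcnt]
    obtain ⟨l₃, hl₃, hr₃, hb₃⟩ := hQ₄ Y δ _ hm₂ hb₂ (by
      rw [hval']
      exact (size_le_self _).trans (by omega))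
    rw [hval', ← hB] at hr₃ hb₃
    refine ⟨l₁ + (l₂ + l₃), _, ?_, Runs.seq hr₁ (Runs.seq hr₂ hr₃), hi, ?_, by simp,
      fun a ha => ?_, hb₃⟩
    · simp only [eval_add]; omega
    · rw [update_stack_stack (by omega)]; simp
    · rw [update_stack_of_ne ha (by omega), update_stack_of_ne ha le_rfl,
        heq₁ a fun j hj => ha j (by omega), heq a ha]

theorem exists_compileSpec (base : Bound) (t : Term) : ∀ (env : ℕ → ℕ) (d : ℕ),
    (∀ x, env x < d) → ∃ P, CompileSpec base t env d P := by
  induction t with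
  | const c =>
    exact fun env d _ => compileSpec_store (e := Expr.const c) rfl rfl fun _ _ _ _ _ => rfl
  | bound b =>
    exact fun env d _ => compileSpec_store (e := b.expr) rfl rfl fun δ ρ m hm _ => by
      rw [Bound.val_expr, hm.zero, eval]
  | var x =>
    exact fun env d _ => compileSpec_store (e := Expr.load (stackExpr base (env x))) rfl rfl
      fun δ ρ m hm henv => by rw [Expr.val, val_stackExpr, hm.zero, henv, eval]
  | load a ih => exact fun env d hd => compileSpec_load (ih env d hd)
  | bin o a b iha ihb =>
    exact fun env d hd => compileSpec_bin o hd (iha env d hd)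
      (ihb env (d + 1) fun x => (hd x).trans (Nat.lt_succ_self d))
  | big o b x t ih =>
    refine fun env d hd => compileSpec_big o b x hd (ih _ (d + 2) fun y => ?_)
    rcases eq_or_ne y x with rfl | h
    · simp
    · rw [Function.update_of_ne h]
      exact (hd y).trans (by omega)

end Term

end Machine

end MSVC

namespace MSVC

/-! ### A greedy approximation of the kernel rounding bound

Every slot is divided into four; round `j` chooses a vertex `d j q` for each of the `T` parts. -/

section Greedy

open Classical

variable {V : Type*} [Fintype V]

/-- How much one unit in part `q + 1` has been used up to time `s`. -/
noncomputable def gain (s q : ℕ) : ℝ := 1 - survival s (q + 1)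

lemma gain_nonneg (s q : ℕ) : 0 ≤ gain s q := sub_nonneg.2 (survival_le_one _ _)

lemma gain_le_one (s q : ℕ) : gain s q ≤ 1 := sub_le_self _ (survival_nonneg _ _)

lemma gain_mono {s t : ℕ} (h : s ≤ t) (q : ℕ) : gain s q ≤ gain t q :=
  sub_le_sub_left (survival_antitone h _) _

lemma gain_eq_zero {s q : ℕ} (h : s ≤ q) : gain s q = 0 := by
  rw [gain, survival_of_lt (by omega), sub_self]

/-- What one round with the choices `c` contributes to `v` at time `s`. -/
noncomputable def contrib (T : ℕ) (c : ℕ → V) (v : V) (s : ℕ) : ℝ :=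
  ∑ q ∈ Finset.range T, if c q = v then gain s q else 0

/-- What the first `j` rounds contribute to `v` at time `s`. -/
noncomputable def total (T : ℕ) (d : ℕ → ℕ → V) (j : ℕ) (v : V) (s : ℕ) : ℝ :=
  ∑ j' ∈ Finset.range j, contrib T (d j') v s

/-- The deficit of the pair `a`, `b` at time `s` after `j` rounds. -/
noncomputable def deficit (T : ℕ) (d : ℕ → ℕ → V) (j : ℕ) (a b : V) (s : ℕ) : ℝ :=
  max 0 (4 * j - (total T d j a s + total T d j b s))

/-- The value of the choice of `v` for part `q` in round `j`. -/
noncomputable def score (G : SimpleGraph V) (T : ℕ) (d : ℕ → ℕ → V) (j q : ℕ) (v : V) : ℝ :=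
  ∑ u, if G.Adj v u then ∑ s ∈ Finset.range T, deficit T d j v u s * gain s q else 0

/-- The sum over all ordered pairs of adjacent vertices and all times. -/
noncomputable def pairSum (G : SimpleGraph V) (T : ℕ) (F : V → V → ℕ → ℝ) : ℝ :=
  ∑ a, ∑ b, if G.Adj a b then ∑ s ∈ Finset.range T, F a b s else 0

lemma pairSum_mono {G : SimpleGraph V} {T : ℕ} {F F' : V → V → ℕ → ℝ}
    (h : ∀ a b s, G.Adj a b → F a b s ≤ F' a b s) : pairSum G T F ≤ pairSum G T F' :=
  Finset.sum_le_sum fun a _ => Finset.sum_le_sum fun b _ => by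
    split_ifs with hab
    · exact Finset.sum_le_sum fun s _ => h a b s hab
    · exact le_rfl

lemma pairSum_add (G : SimpleGraph V) (T : ℕ) (F F' : V → V → ℕ → ℝ) :
    pairSum G T (fun a b s => F a b s + F' a b s) = pairSum G T F + pairSum G T F' := by
  unfold pairSum
  simp_rw [← Finset.sum_add_distrib]
  refine Finset.sum_congr rfl fun a _ => Finset.sum_congr rfl fun b _ => ?_
  split_ifs
  · rw [Finset.sum_add_distrib]
  · rw [add_zero]

lemma pairSum_mul (G : SimpleGraph V) (T : ℕ) (r : ℝ) (F : V → V → ℕ → ℝ) :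
    pairSum G T (fun a b s => r * F a b s) = r * pairSum G T F := by
  unfold pairSum
  simp_rw [Finset.mul_sum]
  refine Finset.sum_congr rfl fun a _ => Finset.sum_congr rfl fun b _ => ?_
  split_ifs <;> simp [Finset.mul_sum]

lemma pairSum_swap (G : SimpleGraph V) (T : ℕ) (F : V → V → ℕ → ℝ) :
    pairSum G T (fun a b s => F b a s) = pairSum G T F := by
  unfold pairSum
  rw [Finset.sum_comm]
  simp_rw [G.adj_comm]

lemma pairSum_const (G : SimpleGraph V) (T : ℕ) (r : ℝ) :
    pairSum G T (fun _ _ _ => r) = 2 * G.edgeFinset.card * (T * r) := by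
  have := sum_sum_adj_eq G fun _ => (T * r : ℝ)
  unfold pairSum
  simp only [Finset.sum_const, Finset.card_range, nsmul_eq_mul] at this ⊢
  rw [this]
  ring

lemma deficit_comm {V : Type*} (T : ℕ) (d : ℕ → ℕ → V) (j : ℕ) (a b : V) (s : ℕ) :
    deficit T d j a b s = deficit T d j b a s := by
  unfold deficit; rw [add_comm (total T d j a s)]

/-- The linearized objective at the choices `c`. -/
lemma pairSum_deficit_mul_contrib (G : SimpleGraph V) (T : ℕ) (d : ℕ → ℕ → V) (j : ℕ)
    (c : ℕ → V) :
    pairSum G T (fun a b s => deficit T d j a b s * (contrib T c a s + contrib T c b s))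
      = 2 * ∑ q ∈ Finset.range T, score G T d j q (c q) := by
  have h1 : pairSum G T (fun a b s => deficit T d j a b s * contrib T c a s)
      = ∑ q ∈ Finset.range T, score G T d j q (c q) := by
    have h2 : ∀ q, score G T d j q (c q) = ∑ a, if c q = a then score G T d j q a else 0 := by
      intro q; simp
    simp_rw [h2]
    rw [Finset.sum_comm, pairSum]
    refine Finset.sum_congr rfl fun a _ => ?_
    have h3 : ∀ q, (if c q = a then score G T d j q a else 0) = ∑ b, if G.Adj a b then
        ∑ s ∈ Finset.range T, deficit T d j a b s * (if c q = a then gain s q else 0) else 0 := by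
      intro q
      by_cases hq : c q = a
      · simp [hq, score]
      · simp [hq]
    simp_rw [h3]
    rw [Finset.sum_comm]
    refine Finset.sum_congr rfl fun b _ => ?_
    split_ifs
    · rw [Finset.sum_comm]
      refine Finset.sum_congr rfl fun s _ => ?_
      rw [contrib, Finset.mul_sum]
    · simp
  have h2 : pairSum G T (fun a b s => deficit T d j a b s * contrib T c b s)
      = pairSum G T (fun a b s => deficit T d j a b s * contrib T c a s) := by
    rw [← pairSum_swap]
    simp_rw [deficit_comm T d j]
  simp_rw [mul_add]
  rw [pairSum_add, h2, h1]
  ring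

lemma contrib_nonneg {V : Type*} (T : ℕ) (c : ℕ → V) (v : V) (s : ℕ) : 0 ≤ contrib T c v s :=
  Finset.sum_nonneg fun q _ => by split_ifs <;> simp [gain_nonneg]

lemma contrib_add_le {V : Type*} {T : ℕ} (c : ℕ → V) {a b : V} (hab : a ≠ b) (s : ℕ) :
    contrib T c a s + contrib T c b s ≤ T := by
  unfold contrib
  rw [← Finset.sum_add_distrib]
  refine (Finset.sum_le_sum (g := fun _ => (1 : ℝ)) fun q _ => ?_).trans (by simp)
  have := gain_le_one s q
  split_ifs with h1 h2
  · exact absurd (h1.symm.trans h2) hab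
  · simpa using this
  · simpa using this
  · simp

/-- The clipped square is smooth: its first-order expansion has error at most the square of the
step, even across the kink. -/
lemma max_zero_add_sq_le (R δ : ℝ) :
    (max 0 (R + δ)) ^ 2 ≤ (max 0 R) ^ 2 + 2 * (max 0 R * δ) + δ ^ 2 := by
  have h0 : R + δ ≤ max 0 R + δ := by linarith [le_max_right 0 R]
  have h : max 0 (R + δ) ≤ |max 0 R + δ| :=
    max_le (abs_nonneg _) (h0.trans (le_abs_self _))
  calc _ ≤ |max 0 R + δ| ^ 2 := pow_le_pow_left₀ (le_max_left _ _) h 2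
    _ = _ := by rw [sq_abs]; ring

/-- A logarithm would be the true order, but `√k` suffices and is the polynomial `T ^ 3` for `k = T
^ 6` rounds. -/
lemma sum_inv_le_two_mul_sqrt (k : ℕ) :
    ∑ i ∈ Finset.range k, 1 / ((i : ℝ) + 1) ≤ 2 * √k := by
  induction k with
  | zero => simp
  | succ k ih =>
    rw [Finset.sum_range_succ]
    push_cast
    have h0 : 0 ≤ √(k : ℝ) := Real.sqrt_nonneg _
    have h1 : √(k : ℝ) ^ 2 = k := Real.sq_sqrt (by positivity)
    have h2 : √((k : ℝ) + 1) ^ 2 = k + 1 := Real.sq_sqrt (by positivity)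
    have h3 : √(k : ℝ) ≤ √((k : ℝ) + 1) := Real.sqrt_le_sqrt (by linarith)
    have hk : (0 : ℝ) ≤ k := by positivity
    have h4 : 1 ≤ √((k : ℝ) + 1) := by
      rw [Real.one_le_sqrt]
      linarith
    have h5 : 1 / ((k : ℝ) + 1) ≤ 2 * √((k : ℝ) + 1) - 2 * √(k : ℝ) := by
      rw [div_le_iff₀ (by positivity)]
      generalize √((k : ℝ) + 1) = x at *
      generalize √(k : ℝ) = y at *
      have h6 : (x - y) * (x + y) = 1 := by linear_combination h2 - h1
      have h7 : x + y ≤ 2 * x ^ 2 := by nlinarith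
      have h8 := mul_le_mul_of_nonneg_left h7 (sub_nonneg.2 h3)
      rw [h6, h2] at h8
      linarith
    linarith

/-- Greedy choices are nearly as good as any fixed choices `c` in every round. -/
theorem pairSum_deficit_le (G : SimpleGraph V) {T : ℕ} (hT : 4 ≤ T) (d : ℕ → ℕ → V) (k : ℕ)
    (hd : ∀ j < k, ∀ q < T, ∀ v, score G T d j q v ≤ score G T d j q (d j q)) (c : ℕ → V) :
    pairSum G T (fun a b s => deficit T d k a b s ^ 2)
      ≤ k ^ 2 * pairSum G T
          (fun a b s => (max 0 (4 - (contrib T c a s + contrib T c b s))) ^ 2)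
        + k * (2 * G.edgeFinset.card * T ^ 3) * (2 * √k) := by
  set Q : V → V → ℕ → ℝ := fun a b s => max 0 (4 - (contrib T c a s + contrib T c b s)) with hQ
  set Γ := pairSum G T fun a b s => Q a b s ^ 2 with hΓ
  set B : ℝ := 2 * G.edgeFinset.card * T ^ 3 with hB
  have hB0 : 0 ≤ B := by positivity
  -- The square is expanded to first order. The greedy choice maximizes the score of every part,
  -- hence minimizes the linear term, which is therefore no larger than for the choices `c`.
  have hstep : ∀ j < k, pairSum G T (fun a b s => deficit T d (j + 1) a b s ^ 2)
      ≤ pairSum G T (fun a b s => deficit T d j a b s ^ 2)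
        + 2 * pairSum G T (fun a b s => deficit T d j a b s * Q a b s) + B := by
    intro j hj
    have h1 : pairSum G T (fun a b s => deficit T d (j + 1) a b s ^ 2) ≤
        pairSum G T (fun a b s => deficit T d j a b s ^ 2
          + 2 * (deficit T d j a b s * (4 - (contrib T (d j) a s + contrib T (d j) b s)))
          + (T : ℝ) ^ 2) := by
      refine pairSum_mono fun a b s hab => ?_
      set δ := 4 - (contrib T (d j) a s + contrib T (d j) b s) with hδ
      have e : deficit T d (j + 1) a b s
          = max 0 ((4 * j - (total T d j a s + total T d j b s)) + δ) := by
        rw [deficit, total, total, Finset.sum_range_succ, Finset.sum_range_succ, hδ]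
        unfold total
        push_cast
        congr 1
        ring
      rw [e]
      refine (max_zero_add_sq_le _ _).trans ?_
      have hT' : (4 : ℝ) ≤ T := by exact_mod_cast hT
      -- The contributions to a pair lie between 0 and `T`, so `4 - T ≤ δ ≤ 4`, and `4 ≤ T`.
      have hδ2 : δ ^ 2 ≤ (T : ℝ) ^ 2 := by
        refine sq_le_sq' ?_ ?_
        · linarith [contrib_add_le (T := T) (d j) hab.ne s]
        · linarith [contrib_nonneg T (d j) a s, contrib_nonneg T (d j) b s]
      have : deficit T d j a b s = max 0 (4 * j - (total T d j a s + total T d j b s)) := rfl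
      rw [this]
      linarith
    refine h1.trans ?_
    rw [pairSum_add, pairSum_add, pairSum_mul, pairSum_const]
    have h2 : ∀ c' : ℕ → V, pairSum G T (fun a b s => deficit T d j a b s *
        (4 - (contrib T c' a s + contrib T c' b s)))
        = pairSum G T (fun a b s => deficit T d j a b s * 4)
          - 2 * ∑ q ∈ Finset.range T, score G T d j q (c' q) := by
      intro c'
      rw [← pairSum_deficit_mul_contrib, eq_sub_iff_add_eq, ← pairSum_add]
      congr 1
      ext a b s
      ring
    have h3 : pairSum G T (fun a b s => deficit T d j a b s *
        (4 - (contrib T (d j) a s + contrib T (d j) b s)))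
        ≤ pairSum G T (fun a b s => deficit T d j a b s * Q a b s) := by
      calc _ ≤ pairSum G T (fun a b s => deficit T d j a b s *
            (4 - (contrib T c a s + contrib T c b s))) := by
            rw [h2, h2]
            have := Finset.sum_le_sum fun q (hq : q ∈ Finset.range T) =>
              hd j hj q (Finset.mem_range.1 hq) (c q)
            linarith
        _ ≤ _ := pairSum_mono fun a b s _ =>
            mul_le_mul_of_nonneg_left (le_max_right _ _) (le_max_left _ _)
    have h4 : 2 * (G.edgeFinset.card : ℝ) * (T * T ^ 2) = B := by rw [hB]; ring
    rw [h4]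
    linarith
  -- By AM-GM with weight `j`, the linear term is at most `1/j` times the current sum of squares
  -- plus `j Γ`. The factors `1 + 1/j` of the resulting recursion accumulate to `j² Γ` and to `j B`
  -- times a harmonic sum.
  have hind : ∀ j ≤ k, pairSum G T (fun a b s => deficit T d j a b s ^ 2)
      ≤ j ^ 2 * Γ + j * B * ∑ i ∈ Finset.range j, 1 / ((i : ℝ) + 1) := by
    intro j
    induction j with
    | zero =>
      intro _
      simp [pairSum, deficit, total]
    | succ j ih =>
      intro hj
      have hj' := ih (by omega)
      refine (hstep j (by omega)).trans ?_
      -- The weight `1/j` is unavailable in the first round, where the deficits and hence the linear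
      -- term vanish.
      rcases Nat.eq_zero_or_pos j with rfl | hjpos
      · have h0 : ∀ a b s, deficit T d 0 a b s = 0 := by
          intro a b s; simp [deficit, total]
        have hΓ0 : 0 ≤ Γ := Finset.sum_nonneg fun a _ => Finset.sum_nonneg fun b _ => by
          split_ifs
          · exact Finset.sum_nonneg fun s _ => sq_nonneg _
          · exact le_rfl
        simp only [h0]
        simp [pairSum]
        linarith
      · have hjr : (0 : ℝ) < j := by exact_mod_cast hjpos
        have h1 : 2 * pairSum G T (fun a b s => deficit T d j a b s * Q a b s)
            ≤ 1 / j * pairSum G T (fun a b s => deficit T d j a b s ^ 2) + j * Γ := by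
          rw [hΓ, ← pairSum_mul, ← pairSum_mul, ← pairSum_mul, ← pairSum_add]
          refine pairSum_mono fun a b s _ => ?_
          have : 0 ≤ 1 / (j : ℝ) * (deficit T d j a b s - j * Q a b s) ^ 2 := by positivity
          have e : 1 / (j : ℝ) * (deficit T d j a b s - j * Q a b s) ^ 2
              = 1 / j * deficit T d j a b s ^ 2 + j * Q a b s ^ 2
                - 2 * (deficit T d j a b s * Q a b s) := by
            field_simp
            ring
          linarith
        rw [Finset.sum_range_succ]
        have h2 : (1 + 1 / (j : ℝ)) * pairSum G T (fun a b s => deficit T d j a b s ^ 2) ≤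
            (1 + 1 / (j : ℝ)) * (j ^ 2 * Γ + j * B * ∑ i ∈ Finset.range j, 1 / ((i : ℝ) + 1)) :=
          mul_le_mul_of_nonneg_left hj' (by positivity)
        have e1 : (1 + 1 / (j : ℝ)) * (j ^ 2 * Γ + j * B * ∑ i ∈ Finset.range j, 1 / ((i : ℝ) + 1))
            = (j ^ 2 + j) * Γ + (j + 1) * B * ∑ i ∈ Finset.range j, 1 / ((i : ℝ) + 1) := by
          field_simp
        have hΓ0 : 0 ≤ Γ := Finset.sum_nonneg fun a _ => Finset.sum_nonneg fun b _ => by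
          split_ifs
          · exact Finset.sum_nonneg fun s _ => sq_nonneg _
          · exact le_rfl
        have e2 : ((j : ℝ) + 1) * B * (1 / ((j : ℝ) + 1)) = B := by field_simp
        push_cast
        rw [mul_add, e2]
        nlinarith
  refine (hind k le_rfl).trans ?_
  have := mul_le_mul_of_nonneg_left (sum_inv_le_two_mul_sqrt k)
    (show 0 ≤ (k : ℝ) * B by positivity)
  linarith

/-- Choices that follow a schedule. -/
lemma sum_sq_contrib_le {T : ℕ} (hT : T = 4 * Fintype.card V) {s₀ : V → ℕ} (hs : IsSchedule s₀)
    {c : ℕ → V} (hc : ∀ q < T, s₀ (c q) = q / 4 + 1) (a b : V) :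
    ∑ s ∈ Finset.range T, (max 0 (4 - (contrib T c a s + contrib T c b s))) ^ 2
      ≤ 64 / 3 * (4 * (min (s₀ a) (s₀ b) : ℕ) - 3 / 2) := by
  -- Each of the four parts of a slot carries mass `1/4` of its vertex. Part `q` corresponds to time
  -- `q + 1`, hence the shift.
  let y : ℕ → ℝ := fun i => if 1 ≤ i ∧ i ≤ T then
    ((if c (i - 1) = a then 1 else 0) + (if c (i - 1) = b then 1 else 0)) / 4 else 0
  have hy : ∀ i, 0 ≤ y i := fun i => by
    simp only [y]
    split_ifs <;> norm_num
  have hy1 : ∀ s ∈ Finset.range T, (max 0 (4 - (contrib T c a s + contrib T c b s))) ^ 2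
      = 16 * (max 0 (1 - ∑ i ∈ Finset.Icc 1 s, y i * (1 - survival s i))) ^ 2 := by
    intro s hs'
    have hsT := Finset.mem_range.1 hs'
    have e : contrib T c a s + contrib T c b s =
        4 * ∑ i ∈ Finset.Icc 1 s, y i * (1 - survival s i) := by
      have hsub : ∀ v, contrib T c v s = ∑ q ∈ Finset.range s, if c q = v then gain s q else 0 := by
        intro v
        symm
        refine Finset.sum_subset (Finset.range_subset_range.2 hsT.le) fun q _ hq => ?_
        rw [Finset.mem_range] at hq
        rw [gain_eq_zero (by omega)]
        simp
      rw [hsub, hsub, ← Finset.sum_add_distrib, Finset.mul_sum, Finset.range_eq_Ico]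
      have e2 := Finset.sum_Ico_add' (fun i => 4 * (y i * (1 - survival s i))) 0 s 1
      rw [show Finset.Icc 1 s = Finset.Ico (0 + 1) (s + 1) from by ext; simp, ← e2]
      refine Finset.sum_congr rfl fun q hq => ?_
      have hq' := (Finset.mem_Ico.1 hq).2
      have : 1 ≤ q + 1 ∧ q + 1 ≤ T := ⟨by omega, by omega⟩
      simp only [y, this, and_self, if_true, Nat.add_sub_cancel, gain]
      split_ifs <;> ring
    rw [e, show (4 : ℝ) - 4 * ∑ i ∈ Finset.Icc 1 s, y i * (1 - survival s i)
      = 4 * (1 - ∑ i ∈ Finset.Icc 1 s, y i * (1 - survival s i)) by ring]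
    have : max 0 (4 * (1 - ∑ i ∈ Finset.Icc 1 s, y i * (1 - survival s i)))
        = 4 * max 0 (1 - ∑ i ∈ Finset.Icc 1 s, y i * (1 - survival s i)) := by
      rw [mul_max_of_nonneg _ _ (by norm_num), mul_zero]
    rw [this]
    ring
  rw [Finset.sum_congr rfl hy1, ← Finset.mul_sum]
  obtain ⟨m, hm⟩ : ∃ m, min (s₀ a) (s₀ b) = m + 1 :=
    ⟨min (s₀ a) (s₀ b) - 1, by have := hs.one_le a; have := hs.one_le b; omega⟩
  have hmT : 4 * m + 4 ≤ T := by have := hs.le_card a; have := hs.le_card b; omega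
  have hyc : ∀ i, 4 * m + 1 ≤ i → i ≤ 4 * m + 4 → 1 / 4 ≤ y i := by
    intro i h1 h2
    have h3 : s₀ (c (i - 1)) = m + 1 := by rw [hc (i - 1) (by omega)]; omega
    have h4 : 1 ≤ i ∧ i ≤ T := ⟨by omega, by omega⟩
    simp only [y, h4, and_self, if_true]
    rcases min_choice (s₀ a) (s₀ b) with h | h
    · have : c (i - 1) = a := hs.injective (by omega)
      simp only [this, if_true]
      split_ifs <;> norm_num
    · have : c (i - 1) = b := hs.injective (by omega)
      simp only [this, if_true]
      split_ifs <;> norm_num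
  have hun : ∀ r ≤ 4, ∀ t, 4 * m + 1 + r ≤ t → uncovered y t ≤ 1 - r / 4 := by
    intro r hr t ht
    have hsum : (r : ℝ) / 4 ≤ ∑ i ∈ Finset.Ico 1 t, y i := by
      calc (r : ℝ) / 4 = ∑ i ∈ Finset.Ico (4 * m + 1) (4 * m + 1 + r), (1 / 4 : ℝ) := by
            simp; ring
        _ ≤ ∑ i ∈ Finset.Ico (4 * m + 1) (4 * m + 1 + r), y i :=
            Finset.sum_le_sum fun i hi => by
              have := Finset.mem_Ico.1 hi
              exact hyc i this.1 (by omega)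
        _ ≤ _ := Finset.sum_le_sum_of_subset_of_nonneg
            (Finset.Ico_subset_Ico (by omega) ht) fun i _ _ => hy i
    refine max_le ?_ (by linarith)
    have : (r : ℝ) ≤ 4 := by exact_mod_cast hr
    linarith
  have hone : ∀ t, uncovered y t ≤ 1 := fun t => by
    have : 0 ≤ ∑ i ∈ Finset.Ico 1 t, y i := Finset.sum_nonneg fun i _ => hy i
    exact max_le one_pos.le (by linarith)
  -- In the covering slot the uncovered part descends at least as fast as `1, 3/4, 1/2, 1/4`. The
  -- sum is at most `4m + 5/2`, which saves `3/2` against four full quarters; this slack pays for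
  -- all later additive errors.
  have hsumu : ∑ t ∈ Finset.Icc 1 (T + 1), uncovered y t ≤ 4 * (m + 1 : ℝ) - 3 / 2 := by
    have h1 : ∑ t ∈ Finset.Icc 1 (T + 1), uncovered y t
        = ∑ t ∈ Finset.Icc 1 (4 * m + 4), uncovered y t := by
      symm
      refine Finset.sum_subset (Finset.Icc_subset_Icc le_rfl (by omega)) fun t ht ht' => ?_
      simp only [Finset.mem_Icc] at ht ht'
      have := hun 4 le_rfl t (by omega)
      norm_num at this
      exact le_antisymm this (uncovered_nonneg y t)
    rw [h1, Finset.sum_Icc_succ_top (by omega), Finset.sum_Icc_succ_top (by omega),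
      Finset.sum_Icc_succ_top (by omega), Finset.sum_Icc_succ_top (by omega)]
    have h2 : ∑ t ∈ Finset.Icc 1 (4 * m), uncovered y t ≤ 4 * m := by
      refine (Finset.sum_le_sum (g := fun _ => (1 : ℝ)) fun t _ => hone t).trans ?_
      simp
    have h3 := hun 1 (by norm_num) (4 * m + 1 + 1) le_rfl
    have h4 := hun 2 (by norm_num) (4 * m + 2 + 1) (by omega)
    have h5 := hun 3 (by norm_num) (4 * m + 3 + 1) (by omega)
    have h6 := hone (4 * m + 1)
    norm_num at h3 h4 h5
    linarith
  have h1 := sum_sq_le_sum_uncovered y hy T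
  rw [hm]
  push_cast
  linarith

/-- The greedy choices against an optimum schedule. -/
theorem pairSum_deficit_le_opt (G : SimpleGraph V) {T : ℕ} (hT : T = 4 * Fintype.card V)
    (hT0 : 0 < T) (d : ℕ → ℕ → V)
    (hd : ∀ j < T ^ 6, ∀ q < T, ∀ v, score G T d j q v ≤ score G T d j q (d j q)) :
    pairSum G T (fun a b s => deficit T d (T ^ 6) a b s ^ 2) / (16 * ((T ^ 6 : ℕ) : ℝ) ^ 2)
      ≤ 2 * (16 / 3 * opt G - 15 / 8 * G.edgeFinset.card) := by
  obtain ⟨s₀, hs, hopt⟩ := exists_cost_eq_opt G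
  have hex : ∀ q, ∃ v, q < T → s₀ v = q / 4 + 1 := by
    intro q
    by_cases hq : q < T
    · obtain ⟨v, hv⟩ := hs.exists_eq (t := q / 4 + 1) (by omega) (by omega)
      exact ⟨v, fun _ => hv⟩
    · obtain ⟨v, -⟩ := hs.exists_eq (t := 1) le_rfl (by omega)
      exact ⟨v, fun h => absurd h hq⟩
  choose c hc using hex
  have h1 := pairSum_deficit_le G (T := T) (by omega) d (T ^ 6) hd c
  have h2 : pairSum G T (fun a b s => (max 0 (4 - (contrib T c a s + contrib T c b s))) ^ 2)
      ≤ 2 * (64 / 3 * (4 * opt G - 3 / 2 * G.edgeFinset.card)) := by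
    calc _ ≤ ∑ a, ∑ b, (if G.Adj a b then 64 / 3 * (4 * (coverTime s₀ s(a, b) : ℝ) - 3 / 2)
          else 0) := by
          refine Finset.sum_le_sum fun a _ => Finset.sum_le_sum fun b _ => ?_
          split_ifs
          · rw [coverTime_mk]
            exact sum_sq_contrib_le hT hs hc a b
          · exact le_rfl
      _ = _ := by
          rw [sum_sum_adj_eq G fun e => 64 / 3 * (4 * (coverTime s₀ e : ℝ) - 3 / 2),
            ← Finset.mul_sum, Finset.sum_sub_distrib, ← Finset.mul_sum, ← hopt, cost]
          push_cast
          simp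
          ring
  -- After division by `16 k²` with `k = T ^ 6`, the greedy error is a quarter of the number of
  -- edges. It lowers the saving per edge from `2` to `15/8`.
  have hsqrt : √((T ^ 6 : ℕ) : ℝ) = (T : ℝ) ^ 3 := by
    push_cast
    rw [show (T : ℝ) ^ 6 = ((T : ℝ) ^ 3) ^ 2 by ring]
    exact Real.sqrt_sq (by positivity)
  rw [hsqrt] at h1
  have hTr : (0 : ℝ) < T := by exact_mod_cast hT0
  rw [div_le_iff₀ (by positivity)]
  refine h1.trans ?_
  have h3 := mul_le_mul_of_nonneg_left h2 (show (0 : ℝ) ≤ ((T ^ 6 : ℕ) : ℝ) ^ 2 by positivity)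
  push_cast at h3 ⊢
  nlinarith [h3]

end Greedy

end MSVC

namespace MSVC

/-! ### Rounding with finitely many thresholds -/

section Sampling

open MeasureTheory Filter Topology

variable {V : Type*}

/-- The uniform distribution on `M` thresholds. -/
noncomputable def uniformFin (M : ℕ) [NeZero M] : Measure (Fin M) :=
  (PMF.uniformOfFintype (Fin M)).toMeasure

instance (M : ℕ) [NeZero M] : IsProbabilityMeasure (uniformFin M) :=
  inferInstanceAs (IsProbabilityMeasure (PMF.uniformOfFintype (Fin M)).toMeasure)

open Classical in
lemma uniformFin_real (M : ℕ) [NeZero M] (P : Fin M → Prop) :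
    (uniformFin M).real {x | P x} = ((Finset.univ.filter P).card : ℝ) / M := by
  rw [measureReal_def, uniformFin,
    PMF.toMeasure_uniformOfFintype_apply _ (Set.toFinite _).measurableSet]
  simp [Fintype.card_subtype]

lemma lintegral_pi_uniformFin [Fintype V] (M : ℕ) [NeZero M] (g : (V → Fin M) → ℝ≥0∞) :
    ∫⁻ ω, g ω ∂(Measure.pi fun _ : V => uniformFin M) =
      (∑ᶠ ω, g ω) / (M : ℝ≥0∞) ^ Fintype.card V := by
  classical
  rw [lintegral_fintype, finsum_eq_sum_of_fintype, div_eq_mul_inv, Finset.sum_mul]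
  refine Finset.sum_congr rfl fun ω _ => ?_
  rw [Measure.pi_singleton]
  have : ∀ v, uniformFin M {ω v} = (M : ℝ≥0∞)⁻¹ := fun v => by
    rw [uniformFin, PMF.toMeasure_uniformOfFintype_apply _ (measurableSet_singleton _)]
    simp
  simp [this, ENNReal.inv_pow]

/-- The tentative slot of a vertex whose progress up to time `s` is `z s`. -/
noncomputable def level (T : ℕ) (z : ℕ → ℝ) (M : ℕ) (x : Fin M) : ℕ := by
  classical
  exact ((Finset.range T).filter fun s => z s * M < x + 1).card

lemma level_le (T : ℕ) (z : ℕ → ℝ) (M : ℕ) (x : Fin M) : level T z M x ≤ T := by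
  classical
  exact (Finset.card_filter_le _ _).trans (by simp)

/-- By monotonicity the times counted by `level` form an initial segment, so `level` is the first
time at which `z` reaches the threshold, capped at `T`. -/
lemma level_le_iff {T : ℕ} {z : ℕ → ℝ} (hz : Monotone z) {M : ℕ} (x : Fin M) {t : ℕ} (ht : t < T) :
    level T z M x ≤ t ↔ (x : ℝ) + 1 ≤ z t * M := by
  classical
  constructor
  · intro h
    by_contra! hlt
    have : Finset.range (t + 1) ⊆ (Finset.range T).filter fun s => z s * M < x + 1 := by
      intro s hs
      have hs := Finset.mem_range.1 hs
      refine Finset.mem_filter.2 ⟨Finset.mem_range.2 (by omega), lt_of_le_of_lt ?_ hlt⟩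
      exact mul_le_mul_of_nonneg_right (hz (by omega)) (by positivity)
    have := Finset.card_le_card this
    rw [Finset.card_range] at this
    unfold level at h
    omega
  · intro h
    have : ((Finset.range T).filter fun s => z s * M < x + 1) ⊆ Finset.range t := by
      intro s hs
      obtain ⟨-, hs⟩ := Finset.mem_filter.1 hs
      rw [Finset.mem_range]
      by_contra! hts
      have := mul_le_mul_of_nonneg_right (hz hts) (show (0 : ℝ) ≤ M by positivity)
      linarith
    simpa [level] using Finset.card_le_card this

open Classical in
lemma card_add_one_le {M : ℕ} {r : ℝ} (hr : 0 ≤ r) :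
    ((Finset.univ.filter fun x : Fin M => (x : ℝ) + 1 ≤ r).card : ℝ) ≤ r := by
  refine le_trans ?_ (Nat.floor_le hr)
  rw [Nat.cast_le]
  calc _ ≤ (Finset.range ⌊r⌋₊).card := by
        refine Finset.card_le_card_of_injOn (fun x => (x : ℕ)) (fun x hx => ?_)
          fun x _ y _ h => Fin.ext h
        have hx := (Finset.mem_filter.1 hx).2
        have : (x : ℕ) + 1 ≤ ⌊r⌋₊ := Nat.le_floor (by push_cast; exact hx)
        simpa using this
    _ = _ := Finset.card_range _

open Classical in
lemma card_lt_add_one_le {M : ℕ} {r : ℝ} (hr : 0 ≤ r) :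
    ((Finset.univ.filter fun x : Fin M => r < (x : ℝ) + 1).card : ℝ) ≤ max 0 (M - r) + 1 := by
  have h1 : (Finset.univ.filter fun x : Fin M => r < (x : ℝ) + 1).card ≤ M - ⌊r⌋₊ := by
    calc _ ≤ (Finset.Ico ⌊r⌋₊ M).card := by
          refine Finset.card_le_card_of_injOn (fun x => (x : ℕ)) (fun x hx => ?_)
            fun x _ y _ h => Fin.ext h
          have hx := (Finset.mem_filter.1 hx).2
          have : ⌊r⌋₊ < (x : ℕ) + 1 := (Nat.floor_lt hr).2 (by push_cast; exact hx)
          simp only [Finset.coe_Ico, Set.mem_Ico]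
          exact ⟨by omega, x.2⟩
      _ = _ := Nat.card_Ico _ _
  have h2 := Nat.lt_floor_add_one r
  have h3 : ((M - ⌊r⌋₊ : ℕ) : ℝ) ≤ max 0 (M - r) + 1 := by
    rcases le_total M ⌊r⌋₊ with h | h
    · rw [Nat.sub_eq_zero_of_le h]
      have := le_max_left (0 : ℝ) (M - r)
      push_cast
      linarith
    · rw [Nat.cast_sub h]
      have := le_max_right (0 : ℝ) (M - r)
      linarith
  exact (Nat.cast_le.2 h1).trans h3

/-- Thresholds are `x + 1` rather than `x`, so discretization never places a vertex too early and
there is no error in this direction. -/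
lemma uniformFin_level_le {T : ℕ} {z : ℕ → ℝ} (hz : Monotone z) (hz0 : z 0 = 0) (M : ℕ) [NeZero M]
    {t : ℕ} (ht : t < T) : (uniformFin M).real {x | level T z M x ≤ t} ≤ z t := by
  classical
  have hM : (0 : ℝ) < M := by exact_mod_cast Nat.pos_of_ne_zero (NeZero.ne M)
  have h0 : 0 ≤ z t := hz0 ▸ hz (Nat.zero_le t)
  simp_rw [level_le_iff hz _ ht]
  rw [uniformFin_real, div_le_iff₀ hM]
  exact card_add_one_le (by positivity)

/-- Rounding to whole thresholds costs at most one of the `M`, hence the error `1 / M`. -/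
lemma uniformFin_lt_level_le {T : ℕ} {z : ℕ → ℝ} (hz : Monotone z) (hz0 : z 0 = 0) (M : ℕ)
    [NeZero M] {t : ℕ} (ht : t < T) :
    (uniformFin M).real {x | t < level T z M x} ≤ max 0 (1 - z t) + 1 / M := by
  classical
  have hM : (0 : ℝ) < M := by exact_mod_cast Nat.pos_of_ne_zero (NeZero.ne M)
  have h0 : 0 ≤ z t := hz0 ▸ hz (Nat.zero_le t)
  simp_rw [← not_le, level_le_iff hz _ ht, not_le]
  rw [uniformFin_real, div_le_iff₀ hM, add_mul, one_div_mul_cancel hM.ne',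
    max_mul_of_nonneg _ _ hM.le, zero_mul, sub_mul, one_mul]
  exact card_lt_add_one_le (by positivity)

/-- Here ties count in full against the edge, which costs the constant `1/2`. The product `(S t - S
(t + 1)) S (t + 1)` is at most half the difference of the squares. -/
lemma summation_by_parts_le' {S : ℕ → ℝ} (h0 : S 0 = 1) (hS : ∀ t, 0 ≤ S t) (T : ℕ) :
    ∑ t ∈ Finset.range T, (S t - S (t + 1)) * (((t + 1 : ℕ) : ℝ) / 3 + S (t + 1))
      ≤ 1 / 2 + 1 / 3 * ∑ t ∈ Finset.range T, S t := by
  have key : ∑ t ∈ Finset.range T, (S t - S (t + 1)) * (((t + 1 : ℕ) : ℝ) / 3 + S (t + 1))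
      ≤ 1 / 3 * ∑ t ∈ Finset.range T, S t - 1 / 3 * T * S T + 1 / 2 * (1 - S T ^ 2) := by
    induction T with
    | zero => simp [h0]
    | succ T ih =>
      rw [Finset.sum_range_succ, Finset.sum_range_succ]
      push_cast at ih ⊢
      nlinarith [sq_nonneg (S T - S (T + 1))]
  have h1 := mul_nonneg (Nat.cast_nonneg (α := ℝ) T) (hS T)
  have h2 := sq_nonneg (S T)
  linarith

/-- The schedule for the thresholds `ω`; ties are broken by `e`. -/
noncomputable def levelSchedule [Fintype V] (T : ℕ) (Z : V → ℕ → ℝ) (M : ℕ) (e : V → ℕ)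
    (ω : V → Fin M) : V → ℕ :=
  rank fun v => toLex (level T (Z v) M (ω v), e v)

lemma injective_level {T : ℕ} {Z : V → ℕ → ℝ} {M : ℕ} {e : V → ℕ} (he : Function.Injective e)
    (ω : V → Fin M) : Function.Injective fun v => toLex (level T (Z v) M (ω v), e v) :=
  fun v w h => he (by simpa using congrArg (fun p => (ofLex p).2) h)

/-- The analysis of kernel rounding in quarter units: mass `t/3` by time `t` is the rate `4/3` per
slot. The term `2 / M` collects the threshold errors of the two endpoints. -/
lemma lintegral_coverTime_level_le [Fintype V] {T : ℕ} (hT : 3 * Fintype.card V ≤ T)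
    {Z : V → ℕ → ℝ} (hZ : ∀ v, Monotone (Z v)) (hZ0 : ∀ v, Z v 0 = 0)
    (hsum : ∀ t < T, ∑ v, Z v t ≤ t / 3) (M : ℕ) [NeZero M] {e : V → ℕ}
    (he : Function.Injective e) {a b : V} (hab : a ≠ b) :
    ∫⁻ ω, (coverTime (levelSchedule T Z M e ω) s(a, b) : ℝ≥0∞)
      ∂(Measure.pi fun _ : V => uniformFin M) ≤ ENNReal.ofReal (1 / 2 + 1 / 3 *
        ∑ s ∈ Finset.range T, ((max 0 (1 - (Z a s + Z b s) / 2)) ^ 2 + 2 / M)) := by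
  classical
  have hM : (0 : ℝ) < M := by exact_mod_cast Nat.pos_of_ne_zero (NeZero.ne M)
  have hM1 : (1 : ℝ) ≤ M := by exact_mod_cast Nat.pos_of_ne_zero (NeZero.ne M)
  have hcard : 0 < Fintype.card V := Fintype.card_pos_iff.2 ⟨a⟩
  set ν := uniformFin M with hν
  let f : V → Fin M → ℕ∞ := fun v x => (level T (Z v) M x : ℕ∞)
  let q : V → ℕ → ℝ := fun v t => ν.real {x | t < level T (Z v) M x}
  let p : V → ℕ → ℝ := fun v t => ν.real {x | level T (Z v) M x ≤ t}
  have hpq : ∀ v t, p v t = 1 - q v t := fun v t => by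
    have : {x | level T (Z v) M x ≤ t} = {x | t < level T (Z v) M x}ᶜ := by ext; simp
    simp only [p, q, this]
    rw [probReal_compl_eq_one_sub (Set.toFinite _).measurableSet]
  have hq0 : ∀ v t, 0 ≤ q v t := fun v t => measureReal_nonneg
  have hp0 : ∀ v t, 0 ≤ p v t := fun v t => measureReal_nonneg
  have hlevel1 : ∀ v x, 1 ≤ level T (Z v) M x := fun v x => by
    by_contra! h
    have h1 := (level_le_iff (T := T) (hZ v) x (t := 0) (by omega)).1 (by omega)
    rw [hZ0, zero_mul] at h1
    have : (0 : ℝ) ≤ x := by positivity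
    linarith
  let S : ℕ → ℝ := fun t => q a t * q b t
  have hS0 : ∀ t, 0 ≤ S t := fun t => mul_nonneg (hq0 _ _) (hq0 _ _)
  have hqT : ∀ v t, T ≤ t → q v t = 0 := fun v t ht => by
    have : {x | t < level T (Z v) M x} = ∅ := by
      ext x
      have := level_le T (Z v) M x
      simp only [Set.mem_ofPred_eq, Set.mem_empty_iff_false, iff_false]
      omega
    simp only [q, this, measureReal_empty]
  have hST : ∀ t, T ≤ t → S t = 0 := fun t ht => by simp [S, hqT a t ht]
  have hS1 : S 0 = 1 := by
    have : ∀ v, q v 0 = 1 := fun v => by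
      have : {x | 0 < level T (Z v) M x} = Set.univ := by
        ext x
        exact iff_of_true (hlevel1 v x) trivial
      simp only [q, this, probReal_univ]
    simp [S, this]
  have hSle : ∀ t < T, S t ≤ (max 0 (1 - (Z a t + Z b t) / 2)) ^ 2 + 2 / M := by
    intro t ht
    have h1 := uniformFin_lt_level_le (hZ a) (hZ0 a) M ht
    have h2 := uniformFin_lt_level_le (hZ b) (hZ0 b) M ht
    have h3 := mul_max_le_sq (Z a t) (Z b t)
    have h4 : q b t ≤ 1 := by linarith [hpq b t, hp0 b t]
    have h5 : max 0 (1 - Z a t) ≤ 1 := by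
      have : 0 ≤ Z a t := hZ0 a ▸ hZ a (Nat.zero_le t)
      exact max_le one_pos.le (by linarith)
    have h6 : (0 : ℝ) ≤ 1 / M := by positivity
    have h7 : (2 : ℝ) / M = 1 / M + 1 / M := by ring
    have h8 : 0 ≤ max 0 (1 - Z a t) := le_max_left _ _
    change q a t ≤ _ at h1
    change q b t ≤ _ at h2
    calc S t ≤ (max 0 (1 - Z a t) + 1 / M) * q b t := mul_le_mul_of_nonneg_right h1 (hq0 _ _)
      _ = max 0 (1 - Z a t) * q b t + 1 / M * q b t := by ring
      _ ≤ max 0 (1 - Z a t) * (max 0 (1 - Z b t) + 1 / M) + 1 / M * 1 := by gcongr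
      _ = max 0 (1 - Z a t) * max 0 (1 - Z b t) + max 0 (1 - Z a t) * (1 / M) + 1 / M := by ring
      _ ≤ max 0 (1 - Z a t) * max 0 (1 - Z b t) + 1 * (1 / M) + 1 / M := by gcongr
      _ ≤ _ := by linarith
  -- The covering vertex counts 1, the others at most `t/3` minus the placement probabilities `p a
  -- t` and `p b t`, and `1 - p a t - p b t ≤ S t`.
  have key := lintegral_delay_le ν (f := f) (fun v => measurable_of_finite _)
    (fun v x => by simpa [f] using hlevel1 v x) hab
    (fun s t => if s ≤ t then 1 else 0) (S := S)
    (fun t => by simp [S, q, f]) ?_ (fun t => (t : ℝ) / 3 + S t) ?_ (R := 1 / 2 + 1 / 3 *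
        ∑ s ∈ Finset.range T, ((max 0 (1 - (Z a s + Z b s) / 2)) ^ 2 + 2 / M)) ?_
  · refine le_trans (lintegral_mono fun ω => ?_) key
    rw [levelSchedule, coverTime_rank_eq (injective_level he ω) hab]
    push_cast
    refine add_le_add le_rfl (Finset.sum_le_sum fun w _ => ?_)
    split_ifs with h1 h2
    · simp
    · exfalso
      apply h2
      simp only [Prod.Lex.toLex_le_toLex] at h1
      refine le_min (Nat.cast_le.2 ?_) (Nat.cast_le.2 ?_)
      · rcases h1.1 with h | h
        exacts [h.le, h.1.le]
      · rcases h1.2 with h | h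
        exacts [h.le, h.1.le]
    · simp
    · simp
  · refine tendsto_const_nhds.congr' ?_
    filter_upwards [eventually_ge_atTop T] with t ht
    exact (hST t ht).symm
  · intro t _
    have hint : ∀ w, ∫⁻ x, (if f w x ≤ t then (1 : ℝ≥0∞) else 0) ∂ν = ENNReal.ofReal (p w t) := by
      intro w
      have : (fun x => if f w x ≤ t then (1 : ℝ≥0∞) else 0)
          = Set.indicator {x | level T (Z w) M x ≤ t} 1 := by
        ext x
        simp [f, Set.indicator_apply]
      rw [this, lintegral_indicator_one (Set.toFinite _).measurableSet]
      simp [p, ofReal_measureReal]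
    simp_rw [hint]
    rw [← ENNReal.ofReal_sum_of_nonneg fun w _ => hp0 w t, ← ENNReal.ofReal_one,
      ← ENNReal.ofReal_add one_pos.le (Finset.sum_nonneg fun w _ => hp0 w t)]
    refine ENNReal.ofReal_le_ofReal ?_
    have hsplit := Finset.sum_sdiff (f := fun w => p w t) (Finset.subset_univ {a, b})
    rw [Finset.sum_pair hab] at hsplit
    -- From time `T` on every vertex is placed, and the cap is harmless because `3 * Fintype.card V
    -- ≤ T`.
    rcases lt_or_ge t T with ht | ht
    · have h1 : ∑ w, p w t ≤ t / 3 :=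
        (Finset.sum_le_sum fun w _ => uniformFin_level_le (hZ w) (hZ0 w) M ht).trans (hsum t ht)
      have h2 : S t = (1 - p a t) * (1 - p b t) := by simp [S, hpq]
      have h3 := mul_nonneg (hp0 a t) (hp0 b t)
      rw [h2]
      nlinarith
    · have h1 : ∑ w, p w t = Fintype.card V := by simp [hpq, hqT _ t ht]
      have h2 : (3 : ℝ) * Fintype.card V ≤ t := by exact_mod_cast hT.trans ht
      have h3 : ∀ v, p v t = 1 := fun v => by simp [hpq, hqT v t ht]
      rw [hST t ht]
      rw [h3, h3] at hsplit
      linarith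
  · intro T'
    refine (summation_by_parts_le' hS1 hS0 T').trans ?_
    have h1 : ∑ t ∈ Finset.range T', S t ≤ ∑ t ∈ Finset.range T, S t := by
      calc _ ≤ ∑ t ∈ Finset.range (max T T'), S t :=
            Finset.sum_le_sum_of_subset_of_nonneg
              (Finset.range_subset_range.2 (le_max_right _ _)) fun t _ _ => hS0 t
        _ = _ := by
            symm
            refine Finset.sum_subset (Finset.range_subset_range.2 (le_max_left _ _)) fun t _ ht => ?_
            exact hST t (by simpa using ht)
    have h2 : ∑ t ∈ Finset.range T, S t
        ≤ ∑ s ∈ Finset.range T, ((max 0 (1 - (Z a s + Z b s) / 2)) ^ 2 + 2 / M) :=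
      Finset.sum_le_sum fun s hs => hSle s (Finset.mem_range.1 hs)
    linarith

lemma total_mono (T : ℕ) (d : ℕ → ℕ → V) (j : ℕ) (v : V) : Monotone (total T d j v) := by
  classical
  intro s t h
  refine Finset.sum_le_sum fun j' _ => Finset.sum_le_sum fun q _ => ?_
  split_ifs
  · exact gain_mono h q
  · exact le_rfl

lemma total_zero (T : ℕ) (d : ℕ → ℕ → V) (j : ℕ) (v : V) : total T d j v 0 = 0 := by
  classical
  refine Finset.sum_eq_zero fun j' _ => Finset.sum_eq_zero fun q _ => ?_
  rw [gain_eq_zero (Nat.zero_le q), ite_self]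

lemma sum_total [Fintype V] {T : ℕ} (d : ℕ → ℕ → V) (j : ℕ) {t : ℕ} (ht : t < T) :
    ∑ v, total T d j v t = j * (2 / 3 * t) := by
  classical
  have h1 : ∀ j', ∑ v, contrib T (d j') v t = 2 / 3 * t := by
    intro j'
    unfold contrib
    rw [Finset.sum_comm, ← sum_one_sub_survival]
    simp only [Finset.sum_ite_eq, Finset.mem_univ, if_true]
    have h2 : ∑ q ∈ Finset.range T, gain t q = ∑ q ∈ Finset.range t, gain t q := by
      symm
      refine Finset.sum_subset (Finset.range_subset_range.2 ht.le) fun q _ hq => ?_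
      exact gain_eq_zero (by simpa using hq)
    rw [h2, Finset.range_eq_Ico]
    have e := Finset.sum_Ico_add' (fun i => 1 - survival t i) 0 t 1
    rw [show Finset.Icc 1 t = Finset.Ico (0 + 1) (t + 1) from by ext; simp, ← e]
    rfl
  unfold total
  rw [Finset.sum_comm]
  simp [h1]

open Classical in
/-- Greedy choices, rounded with `M` thresholds, give a `16 / 9`-approximation. -/
theorem sum_cost_levelSchedule_le [Fintype V] (G : SimpleGraph V) {T : ℕ}
    (hT : T = 4 * Fintype.card V) (hT0 : 0 < T) (d : ℕ → ℕ → V)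
    (hd : ∀ j < T ^ 6, ∀ q < T, ∀ v, score G T d j q v ≤ score G T d j q (d j q))
    {M : ℕ} (hM : 64 * Fintype.card V ≤ 3 * M) {e : V → ℕ} (he : Function.Injective e) :
    (∑ ω : V → Fin M, (cost G (levelSchedule T
      (fun v s => total T d (T ^ 6) v s / (2 * (T ^ 6 : ℕ))) M e ω) : ℝ)) / M ^ Fintype.card V
      ≤ 16 / 9 * opt G := by
  have hM0 : M ≠ 0 := by omega
  have : NeZero M := ⟨hM0⟩
  have hTr : (0 : ℝ) < T := by exact_mod_cast hT0
  have hMr : (0 : ℝ) < M := by exact_mod_cast Nat.pos_of_ne_zero hM0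
  have hk : (0 : ℝ) < (T ^ 6 : ℕ) := by push_cast; positivity
  set k := T ^ 6 with hkT
  set Z : V → ℕ → ℝ := fun v s => total T d k v s / (2 * (k : ℝ)) with hZ
  have hedge : ∀ a b, G.Adj a b → (∑ ω : V → Fin M,
      (coverTime (levelSchedule T Z M e ω) s(a, b) : ℝ)) / M ^ Fintype.card V ≤
      1 / 2 + 1 / 3 * ∑ s ∈ Finset.range T, (deficit T d k a b s ^ 2 / (16 * (k : ℝ) ^ 2) + 2 / M) := by
    intro a b hab
    have h1 := lintegral_coverTime_level_le (T := T) (Z := Z) (by omega)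
      (fun v s t h => div_le_div_of_nonneg_right (total_mono T d k v h) (by positivity))
      (fun v => by simp [hZ, total_zero])
      (fun t ht => by
        rw [← Finset.sum_div, sum_total d k ht, div_le_div_iff₀ (by positivity) (by norm_num)]
        exact le_of_eq (by ring)) M he hab.ne
    rw [lintegral_pi_uniformFin, finsum_eq_sum_of_fintype] at h1
    have h2 : (∑ ω : V → Fin M, (coverTime (levelSchedule T Z M e ω) s(a, b) : ℝ≥0∞)) /
        (M : ℝ≥0∞) ^ Fintype.card V = ENNReal.ofReal ((∑ ω : V → Fin M,
        (coverTime (levelSchedule T Z M e ω) s(a, b) : ℝ)) / M ^ Fintype.card V) := by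
      rw [ENNReal.ofReal_div_of_pos (by positivity),
        ENNReal.ofReal_sum_of_nonneg fun _ _ => by positivity, ENNReal.ofReal_pow (by positivity)]
      simp
    rw [h2, ENNReal.ofReal_le_ofReal_iff (by positivity)] at h1
    refine h1.trans (le_of_eq ?_)
    congr 2
    refine Finset.sum_congr rfl fun s _ => ?_
    congr 1
    have h3 : deficit T d k a b s = 4 * k * max 0 (1 - (Z a s + Z b s) / 2) := by
      rw [deficit, mul_max_of_nonneg _ _ (by positivity), mul_zero]
      congr 1
      simp only [hZ]
      field_simp
      ring
    rw [h3]
    field_simp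
    ring
  have hsum : (∑ ω : V → Fin M, (cost G (levelSchedule T Z M e ω) : ℝ)) / M ^ Fintype.card V
      = ∑ e' ∈ G.edgeFinset, (∑ ω : V → Fin M,
        (coverTime (levelSchedule T Z M e ω) e' : ℝ)) / M ^ Fintype.card V := by
    rw [← Finset.sum_div, Finset.sum_comm]
    congr 1
    refine Finset.sum_congr rfl fun ω _ => ?_
    rw [cost]
    push_cast
    rfl
  rw [hsum]
  have h2 : 2 * ∑ e' ∈ G.edgeFinset, (∑ ω : V → Fin M,
        (coverTime (levelSchedule T Z M e ω) e' : ℝ)) / M ^ Fintype.card V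
      ≤ 2 * G.edgeFinset.card * (1 / 2 + 1 / 3 * (T * (2 / M))) + 1 / 3 *
        (pairSum G T (fun a b s => deficit T d k a b s ^ 2) / (16 * (k : ℝ) ^ 2)) := by
    rw [← sum_sum_adj_eq]
    have h3 : pairSum G T (fun a b s => deficit T d k a b s ^ 2) / (16 * (k : ℝ) ^ 2)
        = ∑ a, ∑ b, if G.Adj a b then
          ∑ s ∈ Finset.range T, deficit T d k a b s ^ 2 / (16 * (k : ℝ) ^ 2) else 0 := by
      unfold pairSum
      simp_rw [Finset.sum_div]
      refine Finset.sum_congr rfl fun a _ => Finset.sum_congr rfl fun b _ => ?_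
      split_ifs
      · rw [Finset.sum_div]
      · simp
    have h4 := sum_sum_adj_eq G fun _ => (1 / 2 + 1 / 3 * (T * (2 / M)) : ℝ)
    rw [Finset.sum_const, nsmul_eq_mul, ← mul_assoc 2] at h4
    rw [h3, ← h4, Finset.mul_sum, ← Finset.sum_add_distrib]
    refine Finset.sum_le_sum fun a _ => ?_
    rw [Finset.mul_sum, ← Finset.sum_add_distrib]
    refine Finset.sum_le_sum fun b _ => ?_
    split_ifs with hab
    · refine (hedge a b hab).trans (le_of_eq ?_)
      rw [Finset.sum_add_distrib]
      simp
      ring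
    · simp
  have h5 := pairSum_deficit_le_opt G hT hT0 d hd
  rw [← hkT] at h5
  -- The additive errors per edge in twice the cost are 1 for ties and `2/3 * 3/8 = 1/4` for the
  -- thresholds. Together they equal the available slack `2/3 * 15/8`, so nothing is left over.
  have h6 : (T : ℝ) * (2 / M) ≤ 3 / 8 := by
    have : (64 : ℝ) * Fintype.card V ≤ 3 * M := by exact_mod_cast hM
    rw [← mul_div_assoc, div_le_div_iff₀ hMr (by norm_num), hT]
    push_cast
    linarith
  have h7 := mul_le_mul_of_nonneg_left h6 (show (0 : ℝ) ≤ G.edgeFinset.card by positivity)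
  linarith

end Sampling

end MSVC

namespace MSVC

/-! ### Programs that fill tables -/

section Fill

open Polynomial

namespace Term

/-- The data after the values of `t` for the first `i` indices have been stored from `o` on;
every variable of `t` stands for the index. -/
def fillData (t : Term) (o : ℕ) (δ : ℕ → ℕ) : ℕ → ℕ → ℕ
  | 0 => δ
  | i + 1 => Function.update (t.fillData o δ i) (o + i) (t.eval (t.fillData o δ i) fun _ => i)

lemma fillData_of_notMem (t : Term) (o : ℕ) (δ : ℕ → ℕ) (i : ℕ) {a : ℕ} (h : a < o ∨ o + i ≤ a) :
    t.fillData o δ i a = δ a := by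
  induction i with
  | zero => rfl
  | succ i ih =>
    rw [fillData, Function.update_of_ne (by omega), ih (by omega)]

lemma fillData_add (t : Term) (o : ℕ) (δ : ℕ → ℕ) {i j : ℕ} (h : j < i) :
    t.fillData o δ i (o + j) = t.eval (t.fillData o δ j) fun _ => j := by
  induction i with
  | zero => omega
  | succ i ih =>
    rcases Nat.lt_succ_iff_lt_or_eq.1 h with h | rfl
    · rw [fillData, Function.update_of_ne (by omega), ih h]
    · rw [fillData, Function.update_self]

lemma size_fillData_le {t : Term} {o : ℕ} (ho : 0 < o) {δ : ℕ → ℕ} {s : ℕ}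
    (hδ : ∀ a, (δ a).size ≤ s) (ht : ∀ δ' ρ : ℕ → ℕ, δ' 0 = δ 0 → (t.eval δ' ρ).size ≤ s) (i a : ℕ) :
    (t.fillData o δ i a).size ≤ s := by
  induction i generalizing a with
  | zero => exact hδ a
  | succ i ih =>
    rw [fillData]
    rcases eq_or_ne a (o + i) with rfl | h
    · rw [Function.update_self]
      exact ht _ _ (t.fillData_of_notMem o δ i (.inl ho))
    · rw [Function.update_of_ne h]
      exact ih a

/-- `p` changes the data by `F` in polynomial time. -/
def Transforms (base : Bound) (p : Prog) (F : (ℕ → ℕ) → ℕ → ℕ) : Prop :=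
  ∀ q : ℕ[X], ∃ q' P : ℕ[X], ∀ (δ : ℕ → ℕ) (m : Mem), HoldsData base δ m →
    MemBound (q.eval (δ 0)) m → ∃ k m', k ≤ P.eval (δ 0) ∧ Runs p m k m' ∧
      HoldsData base (F δ) m' ∧ MemBound (q'.eval (δ 0)) m'

lemma Transforms.seq {base : Bound} {p p' : Prog} {F F' : (ℕ → ℕ) → ℕ → ℕ}
    (h : Transforms base p F) (h' : Transforms base p' F') (hF : ∀ δ, F δ 0 = δ 0) :
    Transforms base (Prog.seq p p') fun δ => F' (F δ) := by
  intro q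
  obtain ⟨q₁, P₁, h₁⟩ := h q
  obtain ⟨q₂, P₂, h₂⟩ := h' q₁
  refine ⟨q₂, P₁ + P₂, fun δ m hδ hm => ?_⟩
  obtain ⟨k, m', hk, hr, hδ', hm'⟩ := h₁ δ m hδ hm
  have h₂' := h₂ (F δ) m' hδ'
  rw [hF] at h₂'
  obtain ⟨l, m'', hl, hr', hδ'', hm''⟩ := h₂' hm'
  exact ⟨k + l, m'', by rw [eval_add]; omega, Runs.seq hr hr', hδ'', hm''⟩

/-- Stores the values of `t` for the indices below `cnt` from `off` on. -/
def fill (base off cnt : Bound) (t : Term) : Prog :=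
  Prog.seq (Prog.store (stackExpr base 0) (Expr.const 0))
    (Prog.loop (Expr.sub cnt.expr (Expr.load (stackExpr base 0)))
      (Prog.seq (compile base t (fun _ => 0) 1)
        (Prog.seq (Prog.store (dataExpr base (Expr.add off.expr (Expr.load (stackExpr base 0))))
            (Expr.load (stackExpr base 1)))
          (Prog.store (stackExpr base 0)
            (Expr.add (Expr.load (stackExpr base 0)) (Expr.const 1))))))

lemma HoldsData.update_data {base : Bound} {δ : ℕ → ℕ} {m : Mem} (h : HoldsData base δ m)
    {a : ℕ} (ha : a ≠ 0) (v : ℕ) :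
    HoldsData base (Function.update δ a v) (Function.update m (dataAddr (base.val (δ 0)) a) v) := by
  intro c
  rw [Function.update_of_ne ha.symm]
  rcases eq_or_ne c a with rfl | hc
  · simp
  · rw [Function.update_of_ne hc,
      Function.update_of_ne fun h' => hc (dataAddr_injective _ h'), h c]

/-- The length bound for `t` depends on cell 0 alone and not on the entries already stored. So
lengths do not compound although each entry may read all earlier ones. -/
theorem transforms_fill (base off cnt : Bound) (t : Term) (hoff : ∀ n, 0 < off.val n) {qt : ℕ[X]}
    (ht : ∀ δ ρ : ℕ → ℕ, (t.eval δ ρ).size ≤ qt.eval (δ 0)) :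
    Transforms base (fill base off cnt t)
      fun δ => t.fillData (off.val (δ 0)) δ (cnt.val (δ 0)) := by
  intro q
  obtain ⟨P, hP⟩ := exists_compileSpec base t (fun _ => 0) 1 (fun _ => one_pos)
  obtain ⟨Q₁, hQ₁⟩ := exists_runs_storeStack base 0 (Expr.const 0)
  obtain ⟨Q₂, hQ₂⟩ := exists_runs_store
    (dataExpr base (Expr.add off.expr (Expr.load (stackExpr base 0)))) (Expr.load (stackExpr base 1))
  obtain ⟨Q₃, hQ₃⟩ := exists_runs_storeStack base 0
    (Expr.add (Expr.load (stackExpr base 0)) (Expr.const 1))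
  obtain ⟨Q₄, hQ₄⟩ := (Expr.sub cnt.expr (Expr.load (stackExpr base 0))).exists_bound
  set Wp : ℕ[X] := q + qt + t.ranges + cnt.poly with hWp
  set Xp : ℕ[X] := t.maxLen.comp Wp + Wp with hXp
  refine ⟨Xp, Q₁.comp Xp + (cnt.poly + 1) * (2 * (P + (Q₂ + Q₃) + Q₄).comp Xp + 1),
    fun δ m hδ hm => ?_⟩
  set n := δ 0 with hn
  set B := base.val n with hB
  set N := cnt.val n with hN
  set W := Wp.eval n with hW
  set Y := Xp.eval n with hY
  have hWe : W = q.eval n + qt.eval n + t.ranges.eval n + N := by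
    simp [hW, hWp, Bound.eval_poly, hN]
  have hYe : Y = t.maxLen.eval W + W := by simp [hY, hXp, hW, eval_comp]
  set D := t.fillData (off.val n) δ with hD
  have hD0 : ∀ i, D i 0 = n := fun i => t.fillData_of_notMem _ δ i (.inl (hoff n))
  have hδq : ∀ a, (δ a).size ≤ W := fun a => by
    have := hm (dataAddr B a)
    rw [hδ a] at this
    omega
  have hDW : ∀ i a, (D i a).size ≤ W := size_fillData_le (hoff n) hδq fun δ' ρ h0 => by
    have := ht δ' ρ
    rw [h0, ← hn] at this
    omega
  have hmY : MemBound Y m := fun a => (hm a).trans (by omega)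
  let I : ℕ → Mem → Prop := fun i m' =>
    i ≤ N ∧ HoldsData base (D i) m' ∧ m' (stackAddr B 0) = i ∧ MemBound Y m'
  obtain ⟨k₁, hk₁, hrun₁, hb₁⟩ := hQ₁ Y δ m hδ hmY (by simp [Expr.val])
  have hI₀ : I 0 (Function.update m (stackAddr B 0) 0) :=
    ⟨Nat.zero_le _, hδ.update_stack 0 0, by simp, hb₁⟩
  have hloop := exists_runs_loop (c := Expr.sub cnt.expr (Expr.load (stackExpr base 0)))
    (p := Prog.seq (compile base t (fun _ => 0) 1)
        (Prog.seq (Prog.store (dataExpr base (Expr.add off.expr (Expr.load (stackExpr base 0))))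
            (Expr.load (stackExpr base 1)))
          (Prog.store (stackExpr base 0)
            (Expr.add (Expr.load (stackExpr base 0)) (Expr.const 1)))))
    (b := N) (K := (P + (Q₂ + Q₃) + Q₄).eval Y) I ?_ ?_ hI₀
  · obtain ⟨k₂, m', hk₂, hrun₂, -, hd', -, hb'⟩ := hloop
    refine ⟨k₁ + k₂, m', ?_, Runs.seq hrun₁ hrun₂, hd', hb'⟩
    rw [eval_add, eval_comp, ← hY]
    refine add_le_add hk₁ (hk₂.trans (le_of_eq ?_))
    simp [eval_comp, Bound.eval_poly, ← hY, ← hN]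
  · rintro i m' ⟨-, hd', hc', hb'⟩
    have h4 := (hQ₄ Y m' hb').2
    refine ⟨?_, h4.trans ?_⟩
    · simp only [Expr.val, val_stackExpr, Bound.val_expr, hd'.zero, hD0, ← hB, hc', hN]
    · simp only [eval_add]; omega
  · rintro i hi m₀ ⟨-, hd₀, hc₀, hb₀⟩
    have hB' : base.val (D i 0) = B := by rw [hD0]
    obtain ⟨l₁, m₁, hl₁, hr₁, hv₁, heq₁, hb₁⟩ := hP W Y (D i) (fun _ => i) m₀ (hDW i)
      (fun _ => (size_le_self i).trans (by omega)) (by rw [hD0]; omega) (by omega) (by omega) hd₀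
      (fun _ => by rw [hB', hc₀]) hb₀
    have hd₁ := hd₀.of_eq 1 heq₁
    rw [hB'] at hv₁ heq₁
    have hc₁ : m₁ (stackAddr B 0) = i := by
      rw [heq₁ _ (stackAddr_ne one_pos), hc₀]
    have hm₁ : m₁ 0 = n := hd₁.zero.trans (hD0 i)
    have hval : (Expr.load (stackExpr base 1)).val m₁ = t.eval (D i) fun _ => i := by
      simp only [Expr.val, val_stackExpr, hm₁, ← hB, hv₁]
    have haddr : (dataExpr base (Expr.add off.expr (Expr.load (stackExpr base 0)))).val m₁
        = dataAddr B (off.val n + i) := by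
      simp only [val_dataExpr, Expr.val, val_stackExpr, Bound.val_expr, hm₁, ← hB, hc₁]
    have hsz : (t.eval (D i) fun _ => i).size ≤ Y := by
      have := ht (D i) fun _ => i
      rw [hD0] at this
      omega
    obtain ⟨l₂, hl₂, hr₂⟩ := hQ₂ Y m₁ hb₁ (by rw [hval]; exact hsz)
    rw [hval, haddr] at hr₂
    have hb₂ := hb₁.update (dataAddr B (off.val n + i)) hsz
    have hd₂ := hd₁.update_data (a := off.val n + i) (by have := hoff n; omega)
      (t.eval (D i) fun _ => i)
    rw [hB'] at hd₂
    change HoldsData base (D (i + 1)) _ at hd₂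
    set m₂ := Function.update m₁ (dataAddr B (off.val n + i)) (t.eval (D i) fun _ => i) with hm₂
    have hval' : (Expr.add (Expr.load (stackExpr base 0)) (Expr.const 1)).val m₂ = i + 1 := by
      simp only [Expr.val, val_stackExpr, hd₂.zero, hD0, ← hB]
      rw [hm₂, Function.update_of_ne (dataAddr_ne_stackAddr _ _ _).symm, hc₁]
    obtain ⟨l₃, hl₃, hr₃, hb₃⟩ := hQ₃ Y _ m₂ hd₂ hb₂ (by
      rw [hval']
      exact (size_le_self _).trans (by omega))
    have hd₃ := hd₂.update_stack 0 (i + 1)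
    rw [hval', hD0, ← hB] at hr₃ hb₃
    rw [hD0, ← hB] at hd₃
    refine ⟨l₁ + (l₂ + l₃), _, ?_, Runs.seq hr₁ (Runs.seq hr₂ hr₃), hi, hd₃, by simp, hb₃⟩
    simp only [eval_add]; omega

/-- Stores the value of `t` in the cell `0`. -/
def finish (base : Bound) (t : Term) : Prog :=
  Prog.seq (Prog.store (stackExpr base 0) (Expr.const 0))
    (Prog.seq (compile base t (fun _ => 0) 1)
      (Prog.store (Expr.const 0) (Expr.load (stackExpr base 1))))

/-- Cell 0 holds the number of vertices, on which every term and address depends, so it can be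
overwritten only at the very end. -/
theorem exists_runs_finish (base : Bound) (t : Term) (q : ℕ[X]) : ∃ P : ℕ[X],
    ∀ (δ : ℕ → ℕ) (m : Mem), HoldsData base δ m → MemBound (q.eval (δ 0)) m →
      ∃ k m', k ≤ P.eval (δ 0) ∧ Runs (finish base t) m k m' ∧
        m' 0 = t.eval δ (fun _ => 0) ∧ ∀ a, a ≠ 0 → a ≤ base.val (δ 0) → m' a = δ a := by
  obtain ⟨P, hP⟩ := exists_compileSpec base t (fun _ => 0) 1 (fun _ => one_pos)
  obtain ⟨Q₁, hQ₁⟩ := exists_runs_storeStack base 0 (Expr.const 0)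
  obtain ⟨Q₂, hQ₂⟩ := exists_runs_store (Expr.const 0) (Expr.load (stackExpr base 1))
  set Wp : ℕ[X] := q + t.ranges with hWp
  set Xp : ℕ[X] := t.maxLen.comp Wp + Wp with hXp
  refine ⟨Q₁.comp Xp + (P.comp Xp + Q₂.comp Xp), fun δ m hδ hm => ?_⟩
  set n := δ 0 with hn
  set B := base.val n with hB
  set W := Wp.eval n with hW
  set Y := Xp.eval n with hY
  have hWe : W = q.eval n + t.ranges.eval n := by simp [hW, hWp]
  have hYe : Y = t.maxLen.eval W + W := by simp [hY, hXp, hW, eval_comp]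
  have hmY : MemBound Y m := fun a => (hm a).trans (by omega)
  obtain ⟨k₁, hk₁, hrun₁, hb₁⟩ := hQ₁ Y δ m hδ hmY (by simp [Expr.val])
  have hd₁ := hδ.update_stack 0 ((Expr.const 0).val m)
  obtain ⟨k₂, m₂, hk₂, hrun₂, hv₂, heq₂, hb₂⟩ := hP W Y δ (fun _ => 0) _
    (fun a => by have := hm (dataAddr B a); rw [hδ a] at this; omega)
    (by simp) (by rw [← hn]; omega) (by omega) (by omega) hd₁ (fun _ => by simp [Expr.val]) hb₁
  have hd₂ := hd₁.of_eq 1 heq₂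
  have hval : (Expr.load (stackExpr base 1)).val m₂ = t.eval δ fun _ => 0 := by
    simp only [Expr.val, val_stackExpr, hd₂.zero, hv₂]
  obtain ⟨k₃, hk₃, hrun₃⟩ := hQ₂ Y m₂ hb₂ (by
    simp only [Expr.val]
    exact hb₂ _)
  rw [hval] at hrun₃
  refine ⟨k₁ + (k₂ + k₃), _, ?_, Runs.seq hrun₁ (Runs.seq hrun₂ hrun₃), by simp [Expr.val],
    fun a ha0 ha => ?_⟩
  · simp only [eval_add, eval_comp, ← hY]; omega
  · rw [Function.update_of_ne (by simpa [Expr.val] using ha0)]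
    have := hd₂ a
    rwa [← hn, dataAddr, Nat.sub_eq_zero_of_le ha, add_zero] at this

end Term

end Fill

end MSVC

namespace MSVC

/-! ### The algorithm -/

section Algorithm

/-- The weight of part `q + 1` at time `s`, multiplied by `(s + 1) (s + 2)`. -/
def weight (s q : ℕ) : ℕ := (s + 1) * (s + 2) - (q + 1) * (q + 2)

/-- The rounds before `j` in which `v` was chosen, weighted for time `s`; `π` lists the choices. -/
def progress (T k : ℕ) (π : ℕ → ℕ) (j v s : ℕ) : ℕ :=
  -- Index `i` encodes round `i / T` and part `i - i / T * T`. Truncated subtraction encodes tests: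
  -- `1 - (1 - (b - a))` indicates `a < b`, and `1 - ((a - b) + (b - a))` indicates `a = b`.
  ∑ i ∈ Finset.range (k * T),
    (1 - (1 - (j - i / T))) * ((1 - ((π i - v) + (v - π i))) * weight s (i - i / T * T))

/-- The value of the choice of `v` for part `q` in round `j`. -/
def value (n T k : ℕ) (A : ℕ → ℕ → ℕ) (π : ℕ → ℕ) (j q v : ℕ) : ℕ :=
  -- The product over all times serves as a common denominator; its square clears the denominators
  -- of both the deficit and the gain.
  ∑ u ∈ Finset.range n, A v u * ∑ s ∈ Finset.range T,
    (((∏ s' ∈ Finset.range T, (s' + 1) * (s' + 2)) / ((s + 1) * (s + 2))) *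
      ((∏ s' ∈ Finset.range T, (s' + 1) * (s' + 2)) / ((s + 1) * (s + 2)))) *
      ((4 * j * ((s + 1) * (s + 2)) - (progress T k π j v s + progress T k π j u s)) * weight s q)

/-- The index below `n` of the largest key. -/
def largest (n : ℕ) (key : ℕ → ℕ) : ℕ :=
  ∑ v ∈ Finset.range n, v * (1 - ∑ w ∈ Finset.range n, (1 - (1 - (key w - key v))))

/-- The choice number `i`. -/
def choice (n T k : ℕ) (A : ℕ → ℕ → ℕ) (π : ℕ → ℕ) (i : ℕ) : ℕ :=
  -- Adding `v` to `n` times the value makes the keys distinct, as `largest` requires, without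
  -- changing the order of different values.
  largest n fun v => n * value n T k A π (i / T) (i - i / T * T) v + v

/-- The threshold with the binary digits `r`. -/
def threshold (p : ℕ) (r : ℕ → ℕ) : ℕ :=
  ∑ i ∈ Finset.range p, r i * ∏ j ∈ Finset.range p, (1 + (1 - (1 - (i - j))))

/-- The tentative slot of `v` for the thresholds given by the binary digits `r`. -/
def tentativeLevel (T k p : ℕ) (π : ℕ → ℕ) (r : ℕ → ℕ → ℕ) (v : ℕ) : ℕ :=
  ∑ s ∈ Finset.range T, (1 - (1 -
    ((threshold p (r v) + 1) * (2 * k * ((s + 1) * (s + 2))) -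
      (∏ _j ∈ Finset.range p, 2) * progress T k π k v s)))

/-- The slot of `v` for the tentative slots `τ`; ties are broken by the numbers of the vertices. -/
def slot (n : ℕ) (τ : ℕ → ℕ) (v : ℕ) : ℕ :=
  ∑ w ∈ Finset.range n,
    ((1 - (1 - (τ v - τ w))) + (1 - ((τ w - τ v) + (τ v - τ w))) * (1 - (w - v)))

namespace Term

instance : Add Term := ⟨bin Op.add⟩

instance : Sub Term := ⟨bin Op.sub⟩

instance : Mul Term := ⟨bin Op.mul⟩

instance : Div Term := ⟨bin Op.div⟩

/-- `big BigOp.sum`. -/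
def sum (b : Bound) (x : ℕ) (t : Term) : Term := big BigOp.sum b x t

/-- `big BigOp.prod`. -/
def prod (b : Bound) (x : ℕ) (t : Term) : Term := big BigOp.prod b x t

section Eval

variable (δ ρ : ℕ → ℕ) (a b : Term)

lemma eval_const (c : ℕ) : (const c).eval δ ρ = c := rfl

lemma eval_bound (b : Bound) : (bound b).eval δ ρ = b.val (δ 0) := rfl

lemma eval_var (x : ℕ) : (var x).eval δ ρ = ρ x := rfl

lemma eval_load : (load a).eval δ ρ = δ (a.eval δ ρ) := rfl

lemma eval_add : (a + b).eval δ ρ = a.eval δ ρ + b.eval δ ρ := rfl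

lemma eval_sub : (a - b).eval δ ρ = a.eval δ ρ - b.eval δ ρ := rfl

lemma eval_mul : (a * b).eval δ ρ = a.eval δ ρ * b.eval δ ρ := rfl

lemma eval_div : (a / b).eval δ ρ = a.eval δ ρ / b.eval δ ρ := rfl

lemma eval_sum (b : Bound) (x : ℕ) (t : Term) : (sum b x t).eval δ ρ =
    ∑ i ∈ Finset.range (b.val (δ 0)), t.eval δ (Function.update ρ x i) := rfl

lemma eval_prod (b : Bound) (x : ℕ) (t : Term) : (prod b x t).eval δ ρ =
    ∏ i ∈ Finset.range (b.val (δ 0)), t.eval δ (Function.update ρ x i) := rfl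

end Eval

/-- The number of parts of the time axis. -/
def parts : Bound := Bound.mul (Bound.const 4) Bound.size

/-- The number of rounds. -/
def rounds : Bound :=
  Bound.mul (Bound.mul (Bound.mul parts parts) (Bound.mul parts parts)) (Bound.mul parts parts)

/-- The number of choices. -/
def choices : Bound := Bound.mul rounds parts

/-- The number of random bits for one vertex. -/
def digits : Bound := Bound.add Bound.size (Bound.const 5)

/-- The number of cells for the input. -/
def inputSize : Bound :=
  Bound.add (Bound.add (Bound.mul Bound.size Bound.size) (Bound.mul Bound.size digits))
    (Bound.const 1)

/-- The term for `(s + 1) (s + 2)`. -/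
def denom (s : Term) : Term := (s + const 1) * (s + const 2)

/-- The indicator of `a < b`. -/
def lt (a b : Term) : Term := const 1 - (const 1 - (b - a))

/-- The indicator of `a = b`. -/
def eq (a b : Term) : Term := const 1 - ((a - b) + (b - a))

/-- The remainder of the division of `i` by the number of parts. -/
def part (i : Term) : Term := i - i / bound parts * bound parts

/-- The term for `progress`; it uses the variable `6`. -/
def progressTerm (j v s : Term) : Term :=
  sum choices 6 (lt (var 6 / bound parts) j *
    (eq (load (bound inputSize + var 6)) v * (denom s - denom (part (var 6)))))

/-- The term for `value`; it uses the variables from `3` on. -/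
def valueTerm (v : Term) : Term :=
  sum Bound.size 3 (load (bound Bound.size * v + var 3 + const 1) * sum parts 4
    (((prod parts 5 (denom (var 5)) / denom (var 4)) *
      (prod parts 5 (denom (var 5)) / denom (var 4))) *
      ((const 4 * (var 0 / bound parts) * denom (var 4) -
        (progressTerm (var 0 / bound parts) v (var 4) +
          progressTerm (var 0 / bound parts) (var 3) (var 4))) *
        (denom (var 4) - denom (part (var 0))))))

/-- The term for `choice`. -/
def choiceTerm : Term :=
  sum Bound.size 1 (var 1 * (const 1 - sum Bound.size 2
    (lt (bound Bound.size * valueTerm (var 1) + var 1)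
      (bound Bound.size * valueTerm (var 2) + var 2))))

/-- The term for `threshold`; it uses the variables `3` and `4`. -/
def thresholdTerm (v : Term) : Term :=
  sum digits 3 (load (bound (Bound.mul Bound.size Bound.size) + (v * bound digits + var 3) + const 1)
    * prod digits 4 (const 1 + lt (var 4) (var 3)))

/-- The term for `tentativeLevel`; it uses the variables from `2` on. -/
def levelTerm (v : Term) : Term :=
  sum parts 2 (lt (prod digits 3 (const 2) * progressTerm (bound rounds) v (var 2))
    ((thresholdTerm v + const 1) * (const 2 * bound rounds * denom (var 2))))

/-- The term for `slot`; it uses the variables from `1` on. -/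
def slotTerm (v : Term) : Term :=
  sum Bound.size 1 (lt (levelTerm (var 1)) (levelTerm v) +
    eq (levelTerm (var 1)) (levelTerm v) * (const 1 - (var 1 - v)))

lemma val_parts (n : ℕ) : parts.val n = 4 * n := rfl

lemma val_rounds (n : ℕ) : rounds.val n = (4 * n) ^ 6 := by
  simp only [rounds, Bound.val, val_parts]
  ring

lemma val_choices (n : ℕ) : choices.val n = (4 * n) ^ 6 * (4 * n) := by
  rw [choices, Bound.val, val_rounds, val_parts]

lemma val_digits (n : ℕ) : digits.val n = n + 5 := rfl

lemma val_inputSize (n : ℕ) : inputSize.val n = n * n + n * (n + 5) + 1 := rfl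

lemma eval_progressTerm {j v s : Term} {δ ρ : ℕ → ℕ} {j' v' s' : ℕ}
    (hj : ∀ i, j.eval δ (Function.update ρ 6 i) = j')
    (hv : ∀ i, v.eval δ (Function.update ρ 6 i) = v')
    (hs : ∀ i, s.eval δ (Function.update ρ 6 i) = s') :
    (progressTerm j v s).eval δ ρ = progress (4 * δ 0) ((4 * δ 0) ^ 6)
      (fun i => δ (inputSize.val (δ 0) + i)) j' v' s' := by
  simp only [progressTerm, denom, lt, eq, part, eval_const, eval_bound, eval_var, eval_load,
    eval_add, eval_sub, eval_mul, eval_div, eval_sum, val_parts, val_choices, progress, weight,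
    hj, hv, hs, Function.update_self]

/-- The hypothesis on `v` asks for independence of all variables from 3 on, so the binders inside
the term cannot capture it. -/
lemma eval_valueTerm {v : Term} {δ ρ : ℕ → ℕ} {v' : ℕ}
    (hv : ∀ ρ' : ℕ → ℕ, (∀ y < 3, ρ' y = ρ y) → v.eval δ ρ' = v') :
    (valueTerm v).eval δ ρ = value (δ 0) (4 * δ 0) ((4 * δ 0) ^ 6)
      (fun v u => δ (δ 0 * v + u + 1)) (fun i => δ (inputSize.val (δ 0) + i))
      (ρ 0 / (4 * δ 0)) (ρ 0 - ρ 0 / (4 * δ 0) * (4 * δ 0)) v' := by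
  rw [valueTerm, eval_sum, value, Bound.val]
  refine Finset.sum_congr rfl fun u _ => ?_
  have h0 := hv (Function.update ρ 3 u) fun y hy => Function.update_of_ne (by omega) _ _
  rw [eval_mul, eval_sum, val_parts]
  simp only [eval_load, eval_add, eval_mul, eval_bound, eval_const, eval_var, h0,
    Function.update_self, Bound.val]
  congr 1
  refine Finset.sum_congr rfl fun s _ => ?_
  have h4 : ∀ ρ' : ℕ → ℕ, (∀ y < 5, ρ' y = Function.update (Function.update ρ 3 u) 4 s y) →
      ρ' 0 = ρ 0 ∧ v.eval δ ρ' = v' ∧ ρ' 3 = u ∧ ρ' 4 = s := fun ρ' h => by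
    refine ⟨?_, hv ρ' fun y hy => ?_, ?_, ?_⟩
    · rw [h 0 (by omega), Function.update_of_ne (by omega), Function.update_of_ne (by omega)]
    · rw [h y (by omega), Function.update_of_ne (by omega), Function.update_of_ne (by omega)]
    · rw [h 3 (by omega), Function.update_of_ne (by omega), Function.update_self]
    · rw [h 4 (by omega), Function.update_self]
  have h5 : ∀ i, _ := fun i =>
    h4 (Function.update (Function.update (Function.update ρ 3 u) 4 s) 6 i) fun y hy =>
      Function.update_of_ne (by omega) _ _
  have h6 := h4 _ fun y _ => rfl
  have hj : ∀ i, (var 0 / bound parts).eval δ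
      (Function.update (Function.update (Function.update ρ 3 u) 4 s) 6 i) = ρ 0 / (4 * δ 0) :=
    fun i => by rw [eval_div, eval_var, eval_bound, val_parts, (h5 i).1]
  have h1 := eval_progressTerm (δ := δ) hj (fun i => (h5 i).2.1) (s := var 4)
    (fun i => (h5 i).2.2.2)
  have h2 := eval_progressTerm (δ := δ) (v := var 3) hj (fun i => (h5 i).2.2.1) (s := var 4)
    (fun i => (h5 i).2.2.2)
  simp only [denom, part, weight, eval_const, eval_bound, eval_var, eval_add, eval_sub, eval_mul,
    eval_div, eval_prod, h1, h2, h6, val_parts, Function.update_self]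

lemma eval_choiceTerm (δ : ℕ → ℕ) (i : ℕ) : choiceTerm.eval δ (fun _ => i) =
    choice (δ 0) (4 * δ 0) ((4 * δ 0) ^ 6) (fun v u => δ (δ 0 * v + u + 1))
      (fun i => δ (inputSize.val (δ 0) + i)) i := by
  rw [choiceTerm, eval_sum, choice, largest, Bound.val]
  refine Finset.sum_congr rfl fun v _ => ?_
  rw [eval_mul, eval_sub, eval_sum, eval_var, eval_const, Function.update_self, Bound.val]
  refine congrArg (fun z => v * (1 - z)) (Finset.sum_congr rfl fun w _ => ?_)
  have h1 := eval_valueTerm (v := var 1) (δ := δ)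
    (ρ := Function.update (Function.update (fun _ => i) 1 v) 2 w) (v' := v)
    (fun ρ' h => by
      rw [eval_var, h 1 (by omega), Function.update_of_ne (by omega), Function.update_self])
  have h2 := eval_valueTerm (v := var 2) (δ := δ)
    (ρ := Function.update (Function.update (fun _ => i) 1 v) 2 w) (v' := w)
    (fun ρ' h => by rw [eval_var, h 2 (by omega), Function.update_self])
  have h3 : Function.update (Function.update (fun _ => i) 1 v) 2 w 0 = i := by
    rw [Function.update_of_ne (by omega), Function.update_of_ne (by omega)]
  have h4 : Function.update (Function.update (fun _ => i) 1 v) 2 w 1 = v := by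
    rw [Function.update_of_ne (by omega), Function.update_self]
  rw [h3] at h1 h2
  simp only [lt, eval_const, eval_bound, eval_var, eval_add, eval_sub, eval_mul, h1, h2, h4,
    Function.update_self, Bound.val]

lemma eval_thresholdTerm {v : Term} {δ ρ : ℕ → ℕ} {v' : ℕ}
    (hv : ∀ i, v.eval δ (Function.update ρ 3 i) = v') :
    (thresholdTerm v).eval δ ρ = threshold (δ 0 + 5)
      fun i => δ (δ 0 * δ 0 + (v' * (δ 0 + 5) + i) + 1) := by
  simp [thresholdTerm, lt, eval_const, eval_bound, eval_var, eval_load,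
    eval_add, eval_sub, eval_mul, eval_sum, eval_prod, val_digits, threshold, hv, Bound.val]

lemma eval_levelTerm {v : Term} {δ ρ : ℕ → ℕ} {v' : ℕ}
    (hv : ∀ ρ' : ℕ → ℕ, (∀ y < 2, ρ' y = ρ y) → v.eval δ ρ' = v') :
    (levelTerm v).eval δ ρ = tentativeLevel (4 * δ 0) ((4 * δ 0) ^ 6) (δ 0 + 5)
      (fun i => δ (inputSize.val (δ 0) + i))
      (fun v i => δ (δ 0 * δ 0 + (v * (δ 0 + 5) + i) + 1)) v' := by
  rw [levelTerm, eval_sum, tentativeLevel, val_parts]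
  refine Finset.sum_congr rfl fun s _ => ?_
  have h1 := eval_progressTerm (j := bound rounds) (v := v) (s := var 2) (δ := δ)
    (ρ := Function.update ρ 2 s) (j' := (4 * δ 0) ^ 6) (v' := v') (s' := s)
    (fun i => val_rounds _) (fun i => hv _ fun y hy => by
      rw [Function.update_of_ne (by omega), Function.update_of_ne (by omega)])
    (fun i => by simp [eval_var])
  have h2 := eval_thresholdTerm (v := v) (δ := δ) (ρ := Function.update ρ 2 s) (v' := v')
    (fun i => hv _ fun y hy => by
      rw [Function.update_of_ne (by omega), Function.update_of_ne (by omega)])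
  simp only [lt, denom, eval_const, eval_bound, eval_var, eval_add, eval_sub, eval_mul, eval_prod,
    h1, h2, val_digits, val_rounds, Function.update_self]

lemma eval_slotTerm {v : Term} {δ ρ : ℕ → ℕ} {v' : ℕ}
    (hv : ∀ ρ' : ℕ → ℕ, ρ' 0 = ρ 0 → v.eval δ ρ' = v') : (slotTerm v).eval δ ρ =
    slot (δ 0) (tentativeLevel (4 * δ 0) ((4 * δ 0) ^ 6) (δ 0 + 5)
      (fun i => δ (inputSize.val (δ 0) + i))
      (fun v i => δ (δ 0 * δ 0 + (v * (δ 0 + 5) + i) + 1))) v' := by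
  rw [slotTerm, eval_sum, slot, Bound.val]
  refine Finset.sum_congr rfl fun w _ => ?_
  have h1 := eval_levelTerm (v := v) (δ := δ) (ρ := Function.update ρ 1 w) (v' := v')
    (fun ρ' h => hv _ (by rw [h 0 (by omega), Function.update_of_ne (by omega)]))
  have h2 := eval_levelTerm (v := var 1) (δ := δ) (ρ := Function.update ρ 1 w) (v' := w)
    (fun ρ' h => by rw [eval_var, h 1 (by omega), Function.update_self])
  have h3 := hv (Function.update ρ 1 w) (Function.update_of_ne (by omega) _ _)
  simp only [lt, eq, eval_const, eval_var, eval_add, eval_sub, eval_mul, h1, h2, h3,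
    Function.update_self]

end Term

end Algorithm

end MSVC

namespace MSVC

/-! ### The algorithm is correct -/

section Correct

lemma indicator_lt (a b : ℕ) : 1 - (1 - (b - a)) = if a < b then 1 else 0 := by
  split_ifs <;> omega

lemma indicator_eq (a b : ℕ) : 1 - ((a - b) + (b - a)) = if a = b then 1 else 0 := by
  split_ifs <;> omega

lemma indicator_le (a b : ℕ) : 1 - (a - b) = if a ≤ b then 1 else 0 := by
  split_ifs <;> omega

lemma sum_range_mul {M : Type*} [AddCommMonoid M] (f : ℕ → M) (k T : ℕ) :
    ∑ i ∈ Finset.range (k * T), f i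
      = ∑ j ∈ Finset.range k, ∑ q ∈ Finset.range T, f (j * T + q) := by
  induction k with
  | zero => simp
  | succ k ih => rw [Nat.succ_mul, Finset.sum_range_add, ih, Finset.sum_range_succ]

lemma mul_add_div_of_lt {T q : ℕ} (h : q < T) (j : ℕ) : (j * T + q) / T = j := by
  rw [add_comm, Nat.add_mul_div_right _ _ (by omega), Nat.div_eq_of_lt h, zero_add]

lemma progress_eq {T k j : ℕ} (hj : j ≤ k) (π : ℕ → ℕ) (v s : ℕ) :
    progress T k π j v s = ∑ j' ∈ Finset.range j, ∑ q ∈ Finset.range T,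
      if π (j' * T + q) = v then weight s q else 0 := by
  rw [progress, sum_range_mul]
  have h : ∀ j' ∈ Finset.range k, (∑ q ∈ Finset.range T, (1 - (1 - (j - (j' * T + q) / T))) *
      ((1 - ((π (j' * T + q) - v) + (v - π (j' * T + q)))) *
        weight s (j' * T + q - (j' * T + q) / T * T)))
      = if j' < j then ∑ q ∈ Finset.range T, if π (j' * T + q) = v then weight s q else 0
        else 0 := by
    intro j' _
    split_ifs with hjj
    · refine Finset.sum_congr rfl fun q hq => ?_
      rw [mul_add_div_of_lt (Finset.mem_range.1 hq), indicator_lt, indicator_eq, if_pos hjj,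
        Nat.add_sub_cancel_left]
      split_ifs <;> simp
    · refine Finset.sum_eq_zero fun q hq => ?_
      rw [mul_add_div_of_lt (Finset.mem_range.1 hq), indicator_lt, if_neg hjj, zero_mul]
  rw [Finset.sum_congr rfl h, ← Finset.sum_filter]
  refine Finset.sum_congr ?_ fun _ _ => rfl
  ext j'
  simp only [Finset.mem_filter, Finset.mem_range]
  omega

lemma cast_sub_eq_max (a b : ℕ) : ((a - b : ℕ) : ℝ) = max 0 ((a : ℝ) - b) := by
  rcases le_total b a with h | h
  · rw [Nat.cast_sub h, max_eq_right (sub_nonneg.2 (Nat.cast_le.2 h))]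
  · rw [Nat.sub_eq_zero_of_le h, max_eq_left (sub_nonpos.2 (Nat.cast_le.2 h)), Nat.cast_zero]

lemma cast_weight (s q : ℕ) : (weight s q : ℝ) = gain s q * (((s : ℝ) + 1) * (s + 2)) := by
  rw [weight]
  rcases lt_or_ge q s with h | h
  · have h1 : (q + 1) * (q + 2) ≤ (s + 1) * (s + 2) := by gcongr
    rw [Nat.cast_sub h1, gain, survival_of_le (by omega)]
    push_cast
    field_simp
    ring
  · have h1 : (s + 1) * (s + 2) ≤ (q + 1) * (q + 2) := by gcongr
    rw [Nat.sub_eq_zero_of_le h1, gain_eq_zero h]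
    simp

/-- `π` lists the choices `d` of the rounds before `j`. -/
def Lists {n : ℕ} (T : ℕ) (π : ℕ → ℕ) (d : ℕ → ℕ → Fin n) (j : ℕ) : Prop :=
  ∀ j' < j, ∀ q < T, π (j' * T + q) = d j' q

lemma cast_progress {n T k j : ℕ} (hj : j ≤ k) {π : ℕ → ℕ} {d : ℕ → ℕ → Fin n}
    (hd : Lists T π d j) (v : Fin n) (s : ℕ) :
    (progress T k π j v s : ℝ) = total T d j v s * (((s : ℝ) + 1) * (s + 2)) := by
  rw [progress_eq hj, total, Finset.sum_mul]
  push_cast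
  refine Finset.sum_congr rfl fun j' hj' => ?_
  rw [contrib, Finset.sum_mul]
  refine Finset.sum_congr rfl fun q hq => ?_
  rw [hd j' (Finset.mem_range.1 hj') q (Finset.mem_range.1 hq)]
  by_cases h : d j' q = v
  · simp [h, cast_weight]
  · simp [h, Fin.val_inj]

lemma cast_deficit {n T k j : ℕ} (hj : j ≤ k) {π : ℕ → ℕ} {d : ℕ → ℕ → Fin n}
    (hd : Lists T π d j) (v u : Fin n) (s : ℕ) :
    ((4 * j * ((s + 1) * (s + 2)) - (progress T k π j v s + progress T k π j u s) : ℕ) : ℝ)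
      = deficit T d j v u s * (((s : ℝ) + 1) * (s + 2)) := by
  rw [cast_sub_eq_max, deficit, max_mul_of_nonneg _ _ (by positivity), zero_mul]
  push_cast
  rw [cast_progress hj hd, cast_progress hj hd]
  congr 1
  ring

/-- The scaling factor is the same for all vertices, so comparing integers is the same as comparing
scores. -/
lemma cast_value {n T k j : ℕ} (G : SimpleGraph (Fin n)) {A : ℕ → ℕ → ℕ}
    (hA : ∀ v u : Fin n, (G.Adj v u → A v u = 1) ∧ (¬ G.Adj v u → A v u = 0))
    (hj : j ≤ k) {π : ℕ → ℕ} {d : ℕ → ℕ → Fin n} (hd : Lists T π d j) (q : ℕ) (v : Fin n) :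
    (value n T k A π j q v : ℝ) =
      ((∏ s' ∈ Finset.range T, (s' + 1) * (s' + 2) : ℕ) : ℝ) ^ 2 * score G T d j q v := by
  set L := ∏ s' ∈ Finset.range T, (s' + 1) * (s' + 2) with hL
  rw [value, score, Finset.sum_range, Finset.mul_sum]
  push_cast
  refine Finset.sum_congr rfl fun u _ => ?_
  by_cases h : G.Adj v u
  · rw [(hA v u).1 h, if_pos h, Nat.cast_one, one_mul, Finset.mul_sum]
    refine Finset.sum_congr rfl fun s hs => ?_
    have hdvd : (s + 1) * (s + 2) ∣ L := Finset.dvd_prod_of_mem _ hs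
    have h1 := cast_deficit hj hd v u s
    have h2 : ((s : ℝ) + 1) * (s + 2) ≠ 0 := by positivity
    rw [← hL, h1, cast_weight, Nat.cast_div hdvd (by push_cast; exact h2)]
    push_cast
    field_simp
  · rw [(hA v u).2 h, if_neg h]
    simp

/-- The inner sum counts larger keys. Since keys are distinct it vanishes for exactly one index, and
truncated subtraction kills all other terms. -/
lemma largest_spec {n : ℕ} (hn : 0 < n) {key : ℕ → ℕ}
    (hkey : ∀ v < n, ∀ w < n, key v = key w → v = w) :
    largest n key < n ∧ ∀ w < n, key w ≤ key (largest n key) := by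
  obtain ⟨v, hv, hmax⟩ := Finset.exists_max_image (Finset.range n) key ⟨0, Finset.mem_range.2 hn⟩
  have hv' := Finset.mem_range.1 hv
  have h : largest n key = v := by
    rw [largest, Finset.sum_eq_single_of_mem v hv]
    · have : ∑ w ∈ Finset.range n, (1 - (1 - (key w - key v))) = 0 :=
        Finset.sum_eq_zero fun w hw => by
          have := hmax w hw
          omega
      rw [this, Nat.sub_zero, mul_one]
    · intro w hw hwv
      have hlt : key w < key v := lt_of_le_of_ne (hmax w hw) fun h =>
        hwv (hkey w (Finset.mem_range.1 hw) v hv' h)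
      have : 1 ≤ ∑ u ∈ Finset.range n, (1 - (1 - (key u - key w))) := by
        have := Finset.single_le_sum (f := fun u => 1 - (1 - (key u - key w)))
          (fun _ _ => Nat.zero_le _) hv
        omega
      rw [Nat.sub_eq_zero_of_le this, mul_zero]
  rw [h]
  exact ⟨hv', fun w hw => hmax w (Finset.mem_range.2 hw)⟩

lemma choice_spec {n T k : ℕ} (hn : 0 < n) (G : SimpleGraph (Fin n)) {A : ℕ → ℕ → ℕ}
    (hA : ∀ v u : Fin n, (G.Adj v u → A v u = 1) ∧ (¬ G.Adj v u → A v u = 0))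
    {j q : ℕ} (hj : j < k) (hq : q < T) {π : ℕ → ℕ} {d : ℕ → ℕ → Fin n} (hd : Lists T π d j) :
    ∃ c : Fin n, choice n T k A π (j * T + q) = c ∧ ∀ v, score G T d j q v ≤ score G T d j q c := by
  have h : choice n T k A π (j * T + q) = largest n fun v => n * value n T k A π j q v + v := by
    rw [choice, mul_add_div_of_lt hq, Nat.add_sub_cancel_left]
  obtain ⟨h1, h2⟩ := largest_spec hn (key := fun v => n * value n T k A π j q v + v)
    fun v hv w hw hvw => by
      have := congrArg (· % n) hvw
      simpa [Nat.mod_eq_of_lt hv, Nat.mod_eq_of_lt hw] using this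
  rw [h]
  generalize largest n (fun v => n * value n T k A π j q v + v) = c at h1 h2
  refine ⟨⟨c, h1⟩, rfl, fun v => ?_⟩
  have h3 : value n T k A π j q v ≤ value n T k A π j q c := by
    have h4 := h2 v v.2
    by_contra! hlt
    have : n * (value n T k A π j q c + 1) ≤ n * value n T k A π j q v := Nat.mul_le_mul_left n hlt
    rw [mul_add] at this
    omega
  have h5 : (value n T k A π j q v : ℝ) ≤ value n T k A π j q c := Nat.cast_le.2 h3
  rw [cast_value G hA hj.le hd q v, cast_value G hA hj.le hd q ⟨c, h1⟩] at h5
  refine le_of_mul_le_mul_left h5 ?_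
  have : 0 < ∏ s' ∈ Finset.range T, (s' + 1) * (s' + 2) := Finset.prod_pos fun s _ => by positivity
  positivity

/-- The choices do not depend on the representation of the graph. -/
lemma choice_congr {n T k : ℕ} (G : SimpleGraph (Fin n)) {A A' : ℕ → ℕ → ℕ}
    (hA : ∀ v u : Fin n, (G.Adj v u → A v u = 1) ∧ (¬ G.Adj v u → A v u = 0))
    (hA' : ∀ v u : Fin n, (G.Adj v u → A' v u = 1) ∧ (¬ G.Adj v u → A' v u = 0))
    {j q : ℕ} (hj : j < k) (hq : q < T) {π π' : ℕ → ℕ} {d : ℕ → ℕ → Fin n} (hd : Lists T π d j)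
    (hd' : Lists T π' d j) : choice n T k A π (j * T + q) = choice n T k A' π' (j * T + q) := by
  have h : ∀ v < n, value n T k A π j q v = value n T k A' π' j q v := fun v hv => by
    have h1 := cast_value G hA hj.le hd q ⟨v, hv⟩
    have h2 := cast_value G hA' hj.le hd' q ⟨v, hv⟩
    exact_mod_cast h1.trans h2.symm
  rw [choice, choice, mul_add_div_of_lt hq, Nat.add_sub_cancel_left, largest, largest]
  refine Finset.sum_congr rfl fun v hv => ?_
  rw [h v (Finset.mem_range.1 hv)]
  refine congrArg (fun z => v * (1 - z)) (Finset.sum_congr rfl fun w hw => ?_)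
  rw [h w (Finset.mem_range.1 hw)]

/-- `π` lists choices made one after the other. -/
def IsRun {n : ℕ} (G : SimpleGraph (Fin n)) (T k : ℕ) (π : ℕ → ℕ) : Prop :=
  ∀ i < k * T, ∃ (A : ℕ → ℕ → ℕ) (π' : ℕ → ℕ),
    (∀ v u : Fin n, (G.Adj v u → A v u = 1) ∧ (¬ G.Adj v u → A v u = 0)) ∧
    (∀ i' < i, π' i' = π i') ∧ π i = choice n T k A π' i

lemma Lists.congr {n T j : ℕ} {π π' : ℕ → ℕ} {d : ℕ → ℕ → Fin n} (h : Lists T π d j)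
    (hπ : ∀ i < j * T, π' i = π i) : Lists T π' d j := fun j' hj' q hq => by
  rw [hπ, h j' hj' q hq]
  calc j' * T + q < j' * T + T := by omega
    _ = (j' + 1) * T := by ring
    _ ≤ _ := Nat.mul_le_mul_right T hj'

/-- The choices use only the graph and earlier choices. Hence all random bits lead to the same list,
and the only randomness left is in the thresholds. -/
lemma IsRun.lists {n T k : ℕ} {G : SimpleGraph (Fin n)} {π π' : ℕ → ℕ} (h : IsRun G T k π)
    (h' : IsRun G T k π') {d : ℕ → ℕ → Fin n} (hd : Lists T π d k) : Lists T π' d k := by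
  have key : ∀ j ≤ k, Lists T π' d j := by
    intro j
    induction j with
    | zero => exact fun _ j' hj' => absurd hj' (Nat.not_lt_zero _)
    | succ j ih =>
      intro hj j' hj' q hq
      rcases Nat.lt_succ_iff_lt_or_eq.1 hj' with hlt | rfl
      · exact ih (by omega) j' hlt q hq
      · have hi : j' * T + q < k * T := by
          calc j' * T + q < j' * T + T := by omega
            _ = (j' + 1) * T := by ring
            _ ≤ _ := Nat.mul_le_mul_right T hj
        obtain ⟨A₁, π₁, hA₁, hπ₁, e₁⟩ := h _ hi
        obtain ⟨A₂, π₂, hA₂, hπ₂, e₂⟩ := h' _ hi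
        have hd₀ : Lists T π d j' := fun i hi => hd i (by omega)
        rw [e₂, ← hd j' (by omega) q hq, e₁]
        exact choice_congr G hA₂ hA₁ (by omega) hq
          ((ih (by omega)).congr fun i hi => hπ₂ i (by omega))
          (hd₀.congr fun i hi => hπ₁ i (by omega))
  exact key k le_rfl

lemma IsRun.exists_lists {n T k : ℕ} (hn : 0 < n) {G : SimpleGraph (Fin n)} {π : ℕ → ℕ}
    (h : IsRun G T k π) : ∃ d : ℕ → ℕ → Fin n, Lists T π d k ∧
      ∀ j < k, ∀ q < T, ∀ v, score G T d j q v ≤ score G T d j q (d j q) := by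
  -- The remainder only serves the type; `step` shows that the entries are below `n` already.
  let d : ℕ → ℕ → Fin n := fun j q => ⟨π (j * T + q) % n, Nat.mod_lt _ hn⟩
  have step : ∀ j < k, Lists T π d j → ∀ q < T, π (j * T + q) = d j q ∧
      ∀ v, score G T d j q v ≤ score G T d j q (d j q) := by
    intro j hj hd q hq
    have hi : j * T + q < k * T := by
      calc j * T + q < j * T + T := by omega
        _ = (j + 1) * T := by ring
        _ ≤ _ := Nat.mul_le_mul_right T hj
    obtain ⟨A, π', hA, hπ', e⟩ := h _ hi
    obtain ⟨c, hc, hmax⟩ := choice_spec hn G hA hj hq (hd.congr fun i hi => hπ' i (by omega))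
    rw [← e] at hc
    have : d j q = c := Fin.ext (by simp [d, hc, Nat.mod_eq_of_lt c.2])
    rw [this]
    exact ⟨hc, hmax⟩
  have key : ∀ j ≤ k, Lists T π d j := by
    intro j
    induction j with
    | zero => exact fun _ j' hj' => absurd hj' (Nat.not_lt_zero _)
    | succ j ih =>
      intro hj j' hj' q hq
      rcases Nat.lt_succ_iff_lt_or_eq.1 hj' with hlt | rfl
      · exact ih (by omega) j' hlt q hq
      · exact (step j' (by omega) (ih (by omega)) q hq).1
  exact ⟨d, key k le_rfl, fun j hj q hq => (step j hj (key j hj.le) q hq).2⟩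

lemma threshold_eq (p : ℕ) (r : ℕ → ℕ) :
    threshold p r = ∑ i ∈ Finset.range p, r i * 2 ^ i := by
  refine Finset.sum_congr rfl fun i hi => ?_
  congr 1
  have hi' := Finset.mem_range.1 hi
  have h : ∀ j ∈ Finset.range p, 1 + (1 - (1 - (i - j))) = if j < i then 2 else 1 := fun j _ => by
    rw [indicator_lt]; split_ifs <;> rfl
  rw [Finset.prod_congr rfl h, ← Finset.prod_filter, Finset.prod_const]
  congr 1
  have : (Finset.range p).filter (· < i) = Finset.range i := by
    ext j
    simp only [Finset.mem_filter, Finset.mem_range]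
    omega
  rw [this, Finset.card_range]

/-- The integer comparison is the real one multiplied by `2k (s + 1) (s + 2)`. -/
lemma tentativeLevel_eq {n T k p : ℕ} (hk : 0 < k) {π : ℕ → ℕ} {d : ℕ → ℕ → Fin n}
    (hd : Lists T π d k) (r : ℕ → ℕ → ℕ) (v : Fin n) {x : Fin (2 ^ p)}
    (hx : threshold p (r v) = x) :
    tentativeLevel T k p π r v = level T (fun s => total T d k v s / (2 * (k : ℝ))) (2 ^ p) x := by
  classical
  rw [tentativeLevel, level, Finset.card_filter]
  refine Finset.sum_congr rfl fun s _ => ?_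
  rw [indicator_lt, hx]
  have hk' : (0 : ℝ) < k := by exact_mod_cast hk
  refine if_congr ?_ rfl rfl
  rw [← Nat.cast_lt (α := ℝ)]
  push_cast
  rw [cast_progress le_rfl hd, Finset.prod_const, Finset.card_range, div_mul_eq_mul_div,
    div_lt_iff₀ (by positivity)]
  have h2 : (0 : ℝ) < ((s : ℝ) + 1) * (s + 2) := by positivity
  rw [← mul_lt_mul_iff_left₀ h2 (b := total T d k v s * 2 ^ p)]
  refine Eq.to_iff ?_
  congr 1 <;> ring

lemma slot_eq {n T : ℕ} {Z : Fin n → ℕ → ℝ} {M : ℕ} {ω : Fin n → Fin M} {τ : ℕ → ℕ}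
    (hτ : ∀ v : Fin n, τ v = level T (Z v) M (ω v)) (v : Fin n) :
    slot n τ v = levelSchedule T Z M (fun v : Fin n => (v : ℕ)) ω v := by
  classical
  rw [slot, Finset.sum_range, levelSchedule, rank, Finset.card_filter]
  refine Finset.sum_congr rfl fun w _ => ?_
  rw [indicator_lt, indicator_eq, indicator_le, hτ, hτ]
  simp only [Prod.Lex.toLex_le_toLex]
  generalize level T (Z w) M (ω w) = x
  generalize level T (Z v) M (ω v) = y
  rcases lt_trichotomy x y with h | h | h
  · simp [h, h.ne]
  · simp [h]
  · simp [h.not_gt, h.ne']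

end Correct

end MSVC

namespace MSVC

/-! ### The approximation algorithm -/

section Final

open Polynomial Term

/-- The thresholds given by the random bits. -/
noncomputable def thresholds (n p : ℕ) : (Fin (n * p) → Bool) ≃ (Fin n → Fin (2 ^ p)) :=
  (finProdFinEquiv.symm.arrowCongr finTwoEquiv.symm).trans
    ((Equiv.curry _ _ _).trans (Equiv.piCongrRight fun _ => finFunctionFinEquiv))

lemma val_thresholds {n p : ℕ} (r : Fin (n * p) → Bool) (v : Fin n) :
    (thresholds n p r v : ℕ) =
      ∑ i : Fin p, (if r (finProdFinEquiv (v, i)) = true then 1 else 0) * 2 ^ (i : ℕ) := by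
  simp only [thresholds, Equiv.trans_apply, Equiv.piCongrRight_apply, Pi.map_apply,
    finFunctionFinEquiv_apply, Equiv.curry_apply, Function.curry_apply, Equiv.arrowCongr_apply,
    Function.comp_apply, Equiv.symm_symm]
  refine Finset.sum_congr rfl fun i _ => ?_
  cases r (finProdFinEquiv (v, i)) <;> rfl

section Input

variable {n b : ℕ} (G : SimpleGraph (Fin n)) (r : Fin b → Bool)

lemma inputMem_zero : inputMem G r 0 = n := if_pos rfl

lemma inputMem_adj (v u : Fin n) : (G.Adj v u → inputMem G r (n * v + u + 1) = 1) ∧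
    (¬ G.Adj v u → inputMem G r (n * v + u + 1) = 0) := by
  refine ⟨fun h => ?_, fun h => ?_⟩
  · rw [inputMem, if_neg (by omega), if_pos (.inl ⟨v, u, h, rfl⟩)]
  · rw [inputMem, if_neg (by omega), if_neg]
    rintro (⟨i, j, hij, e⟩ | ⟨i, -, e⟩)
    · have h1 : n * (v : ℕ) + u = n * i + j := by omega
      have hv : (v : ℕ) = i := by
        have := congrArg (· / n) h1
        simpa [Nat.mul_add_div (Fin.pos v), Nat.div_eq_of_lt] using this
      have hu : (u : ℕ) = j := by rw [hv] at h1; omega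
      exact h (Fin.ext hv ▸ Fin.ext hu ▸ hij)
    · have : n * (v : ℕ) + n ≤ n * n := by
        rw [← Nat.mul_succ]
        exact Nat.mul_le_mul_left n v.2
      have := u.2
      omega

lemma inputMem_bit (i : Fin b) :
    inputMem G r (n * n + i + 1) = if r i = true then 1 else 0 := by
  rw [inputMem, if_neg (by omega)]
  by_cases h : r i = true
  · rw [if_pos (.inr ⟨i, h, rfl⟩), if_pos h]
  · rw [if_neg h, if_neg]
    rintro (⟨i', j, -, e⟩ | ⟨i', hi', e⟩)
    · have : n * (i' : ℕ) + n ≤ n * n := by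
        rw [← Nat.mul_succ]
        exact Nat.mul_le_mul_left n i'.2
      have := j.2
      omega
    · have : i = i' := Fin.ext (by omega)
      exact h (this ▸ hi')

lemma inputMem_of_lt {a : ℕ} (ha : n * n + b < a) : inputMem G r a = 0 := by
  rw [inputMem, if_neg (by omega), if_neg]
  rintro (⟨i, j, -, e⟩ | ⟨i, -, e⟩)
  · have : n * (i : ℕ) + n ≤ n * n := by
      rw [← Nat.mul_succ]
      exact Nat.mul_le_mul_left n i.2
    have := j.2
    omega
  · have := i.2
    omega

lemma memBound_inputMem : MemBound (n + 1) (inputMem G r) := fun a => by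
  refine (size_le_self _).trans ?_
  unfold inputMem
  split_ifs <;> omega

end Input

/-- Only data beyond the input is displaced by the layout, and there the memory is zero. -/
lemma holdsData_inputMem {n : ℕ} (G : SimpleGraph (Fin n)) (r : Fin (n * (n + 5)) → Bool) :
    HoldsData inputSize (inputMem G r) (inputMem G r) := fun a => by
  rw [inputMem_zero, val_inputSize]
  rcases le_total a (n * n + n * (n + 5) + 1) with h | h
  · rw [dataAddr, Nat.sub_eq_zero_of_le h, add_zero]
  · rw [inputMem_of_lt G r (a := a) (by omega), inputMem_of_lt G r (by rw [dataAddr]; omega)]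

/-- The outer sum has `n` terms, each below `n`, whatever the table contains; the huge intermediate
values enter only through indicators. -/
lemma size_eval_choiceTerm_le (δ ρ : ℕ → ℕ) :
    (choiceTerm.eval δ ρ).size ≤ (X * X : ℕ[X]).eval (δ 0) := by
  refine (size_le_self _).trans ?_
  rw [choiceTerm, eval_sum, Polynomial.eval_mul, eval_X, Bound.val]
  refine (Finset.sum_le_card_nsmul _ _ (δ 0) fun v hv => ?_).trans (by simp)
  rw [Term.eval_mul, Term.eval_sub, eval_var, eval_const, Function.update_self]
  calc _ ≤ v * 1 := Nat.mul_le_mul_left v (Nat.sub_le 1 _)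
    _ ≤ _ := by have := Finset.mem_range.1 hv; omega

lemma size_eval_slotTerm_le (t : Term) (δ ρ : ℕ → ℕ) :
    ((slotTerm t).eval δ ρ).size ≤ (X * 2 : ℕ[X]).eval (δ 0) := by
  refine (size_le_self _).trans ?_
  rw [slotTerm, Term.eval_sum, Polynomial.eval_mul, eval_X, eval_ofNat, Bound.val]
  refine (Finset.sum_le_card_nsmul _ _ 2 fun v hv => ?_).trans (by simp)
  simp only [Term.eval_add, Term.eval_mul, Term.eval_sub, lt, Term.eq, eval_const]
  have : ∀ x y : ℕ, (1 - x) * (1 - y) ≤ 1 * 1 := fun x y =>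
    Nat.mul_le_mul (Nat.sub_le _ _) (Nat.sub_le _ _)
  exact add_le_add (Nat.sub_le _ _) (this _ _)

/-- The algorithm. -/
def algorithm : Prog :=
  Prog.seq
    (Prog.seq (fill inputSize inputSize choices choiceTerm)
      -- Cells `1` to `n` are overwritten, which destroys matrix entries only; slots depend on the
      -- random bits and the choices. Cell 0 is spared, so the index is shifted by one, and the
      -- entry in cell `n` belongs to no vertex.
      (fill inputSize (Bound.const 1) Bound.size (slotTerm (var 0 + const 1))))
    (finish inputSize (slotTerm (var 0)))

/-- The data after the choices have been made. -/
def chosenData (δ : ℕ → ℕ) : ℕ → ℕ :=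
  choiceTerm.fillData (inputSize.val (δ 0)) δ (choices.val (δ 0))

/-- The data after `i` slots have been computed. -/
def slottedData (δ : ℕ → ℕ) (i : ℕ) : ℕ → ℕ :=
  (slotTerm (var 0 + const 1)).fillData 1 (chosenData δ) i

lemma inputSize_pos (n : ℕ) : 0 < inputSize.val n := by
  rw [val_inputSize]
  exact Nat.succ_pos _

lemma chosenData_of_lt (δ : ℕ → ℕ) {a : ℕ} (ha : a < inputSize.val (δ 0)) :
    chosenData δ a = δ a := fillData_of_notMem _ _ _ _ (.inl ha)

lemma chosenData_zero (δ : ℕ → ℕ) : chosenData δ 0 = δ 0 := chosenData_of_lt δ (inputSize_pos _)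

lemma slottedData_zero (δ : ℕ → ℕ) (i : ℕ) : slottedData δ i 0 = δ 0 :=
  (fillData_of_notMem _ _ _ _ (.inl one_pos)).trans (chosenData_zero δ)

lemma exists_runs_algorithm : ∃ P : ℕ[X], ∀ (n : ℕ) (G : SimpleGraph (Fin n))
    (r : Fin (n * (n + 5)) → Bool), ∃ k m', k ≤ P.eval n ∧ Runs algorithm (inputMem G r) k m' ∧
      m' 0 = (slotTerm (var 0)).eval (slottedData (inputMem G r) n) (fun _ => 0) ∧
      ∀ a, a ≠ 0 → a < n → m' a = slottedData (inputMem G r) n a := by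
  obtain ⟨q, P, h⟩ := (transforms_fill inputSize inputSize choices choiceTerm inputSize_pos
    size_eval_choiceTerm_le).seq
    (transforms_fill inputSize (Bound.const 1) Bound.size (slotTerm (var 0 + const 1))
      (fun _ => one_pos) (size_eval_slotTerm_le _)) (fun δ => chosenData_zero δ) (X + 1)
  obtain ⟨Q, h'⟩ := exists_runs_finish inputSize (slotTerm (var 0)) q
  refine ⟨P + Q, fun n G r => ?_⟩
  have h0 := inputMem_zero G r
  obtain ⟨k, m, hk, hr, hd, hm⟩ := h _ _ (holdsData_inputMem G r) (by
    rw [h0]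
    simpa using memBound_inputMem G r)
  have e : (slotTerm (var 0 + const 1)).fillData ((Bound.const 1).val (chosenData (inputMem G r) 0))
      (chosenData (inputMem G r)) (Bound.size.val (chosenData (inputMem G r) 0))
      = slottedData (inputMem G r) n := by
    rw [chosenData_zero, h0]
    rfl
  change HoldsData inputSize ((slotTerm (var 0 + const 1)).fillData
    ((Bound.const 1).val (chosenData (inputMem G r) 0)) (chosenData (inputMem G r))
    (Bound.size.val (chosenData (inputMem G r) 0))) m at hd
  rw [e] at hd
  have hs0 : slottedData (inputMem G r) n 0 = n := (slottedData_zero _ _).trans h0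
  obtain ⟨l, m', hl, hr', h1, h2⟩ := h' _ m hd (by rwa [hs0, ← h0])
  refine ⟨k + l, m', ?_, Runs.seq hr hr', h1, fun a ha han => h2 a ha ?_⟩
  · rw [h0] at hk
    rw [hs0] at hl
    rw [Polynomial.eval_add]
    omega
  · rw [hs0, val_inputSize]
    nlinarith

/-- The list of the choices. -/
noncomputable def chosen {n : ℕ} (G : SimpleGraph (Fin n)) (r : Fin (n * (n + 5)) → Bool)
    (i : ℕ) : ℕ :=
  chosenData (inputMem G r) (inputSize.val n + i)

lemma add_lt_inputSize {n : ℕ} (v u : Fin n) : n * (v : ℕ) + u + 1 < inputSize.val n := by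
  rw [val_inputSize]
  have : n * (v : ℕ) + n ≤ n * n := by
    rw [← Nat.mul_succ]
    exact Nat.mul_le_mul_left n v.2
  have := u.2
  have : n * 5 ≤ n * (n + 5) := Nat.mul_le_mul_left n (by omega)
  omega

/-- Entry `i` is computed from the partly filled table, in which the matrix is intact and the
earlier entries are final. -/
lemma isRun_chosen {n : ℕ} (G : SimpleGraph (Fin n)) (r : Fin (n * (n + 5)) → Bool) :
    IsRun G (4 * n) ((4 * n) ^ 6) (chosen G r) := by
  intro i hi
  have h0 := inputMem_zero G r
  rw [← val_choices, ← h0] at hi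
  set D := choiceTerm.fillData (inputSize.val n) (inputMem G r) with hD
  have hD0 : D i 0 = n := (fillData_of_notMem _ _ _ _ (.inl (inputSize_pos n))).trans h0
  refine ⟨fun v u => D i (n * v + u + 1), fun i' => D i (inputSize.val n + i'), fun v u => ?_,
    fun i' hi' => ?_, ?_⟩
  · have : D i (n * v + u + 1) = inputMem G r (n * v + u + 1) :=
      fillData_of_notMem _ _ _ _ (.inl (add_lt_inputSize v u))
    simp only [this]
    exact inputMem_adj G r v u
  · have h1 := choiceTerm.fillData_add (inputSize.val n) (inputMem G r) hi'
    have h2 := choiceTerm.fillData_add (inputSize.val n) (inputMem G r) (hi'.trans hi)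
    rw [chosen, chosenData]
    simp only [h0] at h2 ⊢
    rw [h2, ← h1]
  · have h1 := choiceTerm.fillData_add (inputSize.val n) (inputMem G r) hi
    have h2 := eval_choiceTerm (D i) i
    rw [chosen, chosenData]
    simp only [h0] at h1 ⊢
    rw [h1, ← hD, h2]
    simp only [hD0]

lemma eval_slotTerm_eq {n : ℕ} {G : SimpleGraph (Fin n)} {r : Fin (n * (n + 5)) → Bool}
    {d : ℕ → ℕ → Fin n} (hd : Lists (4 * n) (chosen G r) d ((4 * n) ^ 6)) (i : ℕ) (hi : i ≤ n)
    {t : Term} {ρ : ℕ → ℕ} (v : Fin n)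
    (hv : ∀ ρ' : ℕ → ℕ, ρ' 0 = ρ 0 → t.eval (slottedData (inputMem G r) i) ρ' = v) :
    (slotTerm t).eval (slottedData (inputMem G r) i) ρ =
      levelSchedule (4 * n) (fun v s => total (4 * n) d ((4 * n) ^ 6) v s /
        (2 * (((4 * n) ^ 6 : ℕ) : ℝ))) (2 ^ (n + 5)) (fun v : Fin n => (v : ℕ))
        (thresholds n (n + 5) r) v := by
  have hn := Fin.pos v
  have h0 := inputMem_zero G r
  have hS0 : slottedData (inputMem G r) i 0 = n := (slottedData_zero _ _).trans h0
  -- Everything the slots depend on lies beyond cell `n`, so slots already written do not influence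
  -- later ones.
  have hS : ∀ a, n < a → slottedData (inputMem G r) i a = chosenData (inputMem G r) a :=
    fun a ha => fillData_of_notMem _ _ _ _ (.inr (by omega))
  rw [eval_slotTerm hv, hS0]
  refine slot_eq (fun w => ?_) v
  have hπ : (fun j => slottedData (inputMem G r) i (inputSize.val n + j)) = chosen G r := by
    ext j
    rw [hS _ (by rw [val_inputSize]; nlinarith), chosen]
  rw [hπ]
  refine tentativeLevel_eq (by positivity) hd _ w ?_
  rw [threshold_eq, val_thresholds, Finset.sum_range]
  refine Finset.sum_congr rfl fun j _ => ?_
  congr 1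
  have h1 : n * n + ((w : ℕ) * (n + 5) + j) + 1
      = n * n + ((finProdFinEquiv (w, j) : Fin (n * (n + 5))) : ℕ) + 1 := by
    rw [finProdFinEquiv_apply_val]
    ring
  have h2 := (finProdFinEquiv (w, j) : Fin (n * (n + 5))).2
  rw [h1, hS _ (by nlinarith), chosenData_of_lt _ (by rw [h0, val_inputSize]; omega),
    inputMem_bit]

theorem isRandPolyTimeApprox_algorithm : IsRandPolyTimeApprox algorithm (16 / 9) := by
  classical
  obtain ⟨P, hP⟩ := exists_runs_algorithm
  have key : ∀ (n b : ℕ) (hb : b = n * (n + 5)) (G : SimpleGraph (Fin n)),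
      ∃ s : (Fin b → Bool) → Fin n → ℕ,
      (∀ r, IsSchedule (s r) ∧ ∃ (k : ℕ) (m : Mem), k ≤ P.eval n ∧
          Runs algorithm (inputMem G r) k m ∧ ∀ v : Fin n, m v = s r v) ∧
      (∑ r, (cost G (s r) : ℝ)) / 2 ^ b ≤ 16 / 9 * (opt G : ℝ) := by
    rintro n b rfl G
    rcases Nat.eq_zero_or_pos n with rfl | hn
    · refine ⟨fun _ v => v.elim0, fun r => ⟨?_, ?_⟩, ?_⟩
      · exact ⟨fun v => v.elim0, fun v => v.elim0, fun t ht => by simp at ht⟩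
      · obtain ⟨k, m, hk, hr, -⟩ := hP 0 G r
        exact ⟨k, m, hk, hr, fun v => v.elim0⟩
      · have : ∀ s : Fin 0 → ℕ, cost G s = 0 := fun s => by
          refine Finset.sum_eq_zero fun e _ => ?_
          induction e using Sym2.ind with
          | _ a b => exact a.elim0
        simp only [this]
        simp
    -- The run with all bits zero fixes the choices `d`; by `IsRun.lists` every other run makes the
    -- same ones.
    · obtain ⟨d, hd, hgreedy⟩ := (isRun_chosen G fun _ => false).exists_lists hn
      have hd' := fun r => (isRun_chosen G fun _ => false).lists (isRun_chosen G r) hd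
      let S : (Fin n → Fin (2 ^ (n + 5))) → Fin n → ℕ :=
        levelSchedule (4 * n) (fun v s => total (4 * n) d ((4 * n) ^ 6) v s /
          (2 * (((4 * n) ^ 6 : ℕ) : ℝ))) (2 ^ (n + 5)) fun v : Fin n => (v : ℕ)
      refine ⟨fun r => S (thresholds n (n + 5) r), fun r => ⟨?_, ?_⟩, ?_⟩
      · exact isSchedule_rank (injective_level Fin.val_injective _)
      · obtain ⟨k, m, hk, hr, h1, h2⟩ := hP n G r
        refine ⟨k, m, hk, hr, fun v => ?_⟩
        rcases Nat.eq_zero_or_pos (v : ℕ) with hv | hv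
        · rw [hv, h1]
          exact eval_slotTerm_eq (hd' r) n le_rfl v fun ρ' h => by rw [eval_var, h, hv]
        · rw [h2 v hv.ne' v.2]
          obtain ⟨i, hi⟩ : ∃ i, (v : ℕ) = 1 + i := ⟨v - 1, by omega⟩
          have hin : i < n := by have := v.2; omega
          rw [hi, slottedData, fillData_add _ _ _ hin]
          exact eval_slotTerm_eq (hd' r) i hin.le v fun ρ' h => by
            rw [Term.eval_add, eval_var, eval_const, h, hi, add_comm]
      -- The bits of a vertex give `2 ^ (n + 5)` thresholds, enough because `64 n ≤ 96 * 2 ^ n`.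
      -- Uniform bits are uniform thresholds under the bijection `thresholds`.
      · have h1 := sum_cost_levelSchedule_le G (T := 4 * n) (by simp) (by omega) d hgreedy
          (M := 2 ^ (n + 5)) (by
            rw [Fintype.card_fin, pow_add]
            have := Nat.lt_two_pow_self (n := n)
            omega) (e := fun v : Fin n => (v : ℕ)) Fin.val_injective
        refine le_trans (le_of_eq ?_) h1
        rw [Fintype.card_fin]
        push_cast
        rw [← pow_mul, mul_comm (n + 5) n]
        congr 1
        refine (Equiv.sum_comp (thresholds n (n + 5)) fun ω => (cost G (S ω) : ℝ)).trans ?_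
        push_cast [S]
        congr 1
        ext ω
        simp only [Finset.mem_univ]
  exact ⟨X * (X + 5), P, fun n G => key n _ (by simp) G⟩

end Final

end MSVC

theorem mainTheorem2 :
    -- The LP has an optimum, and it is a relaxation with integrality gap at most `16/9`;
    -- kernel rounding of every feasible LP solution loses at most a factor `16/9` in expectation,
    -- hence kernel rounding of an optimum one is a `16/9`-approximation.
    (∀ (V : Type*) [Fintype V] (G : SimpleGraph V),
      (∃ x u, MSVC.IsLPOptimum G x u) ∧
      MSVC.lpValue G ≤ (MSVC.opt G : ENNReal) ∧
      (MSVC.opt G : ENNReal) ≤ 16 / 9 * MSVC.lpValue G ∧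
      (∀ x u, MSVC.LPFeasible G x u →
        (∀ α ρ, MSVC.IsSchedule (MSVC.roundedSchedule x α ρ)) ∧
        Measurable (MSVC.tieAverage G x) ∧
        MSVC.expectedCost G x ≤ 16 / 9 * MSVC.lpCost G u) ∧
      (∀ x u, MSVC.IsLPOptimum G x u →
        MSVC.expectedCost G x ≤ 16 / 9 * (MSVC.opt G : ENNReal))) ∧
    -- There is a polynomial time `16/9`-approximation algorithm.
    (∃ p : MSVC.Prog, MSVC.IsRandPolyTimeApprox p (16 / 9)) ∧
    -- The factor is tight for the LP, as disjoint cliques show.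
    (∀ δ : ℝ, 0 < δ → ∃ ε₀ : ℝ, 0 < ε₀ ∧ ∀ ε : ℝ, 0 < ε → ε < ε₀ →
      ∃ k₀ : ℕ, ∀ k : ℕ, k₀ ≤ k → ∃ N₀ : ℕ, ∀ N : ℕ, N₀ ≤ N →
        0 < MSVC.lpValue (MSVC.gapInstance ε k N) ∧
        MSVC.lpValue (MSVC.gapInstance ε k N) ≤
          ENNReal.ofReal ((1 + δ) * ((N : ℝ) ^ 3 / (4 * ε))) ∧
        (1 - δ) * (4 * (N : ℝ) ^ 3 / (9 * ε)) ≤ (MSVC.opt (MSVC.gapInstance ε k N) : ℝ) ∧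
        ENNReal.ofReal (16 / 9 - δ) * MSVC.lpValue (MSVC.gapInstance ε k N) ≤
          (MSVC.opt (MSVC.gapInstance ε k N) : ENNReal)) := by
  refine ⟨fun V _ G => ⟨MSVC.exists_isLPOptimum G, MSVC.lpValue_le_opt G, MSVC.opt_le_lpValue G,
    fun x u h => ⟨fun α ρ => MSVC.isSchedule_orderBy _ ρ, MSVC.measurable_tieAverage G x,
      MSVC.expectedCost_le h⟩, fun x u h => h.expectedCost_le_opt⟩,
    ⟨MSVC.algorithm, MSVC.isRandPolyTimeApprox_algorithm⟩, MSVC.exists_tight⟩
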